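/- Let $k$ be a field of characteristic zero and $V$ an irreducible variety over $k$ (an integral separated scheme of finite type) with function field $K$. Let $\mathcal L\subset \mathrm{Der}_k(K,K)$ be a singular foliation on $V$, i.e. a $K$-linear Lie subalgebra, with $K$-basis $\delta_1,\dots,\delta_r$. For a coherent fractional ideal sheaf $M\subset K$ let $P(M)$ be the sheaf of submodules of $K^{r+1}$ generated by the rows $(f,\delta_1f,\dots,\delta_rf)$, $f\in M$ (first principal parts of $M$ along the foliation), and let $F(M)=\Lambda^{r+1}P(M)/\mathrm{torsion}$, regarded as the fractional ideal sheaf generated by the determinants of $(r+1)$-tuples in $P(M)$. Products are products of fractional ideals. On an integral scheme $W$ with a birational morphism to $V$ the foliation lifts to the same Lie algebra of derivations of the function field. It is nonsingular if its sheaf of differentials, the image $\Omega$ of $\Omega_{W/k}$ in the dual space of $\mathcal L$ (by $dx\mapsto(\delta\mapsto\delta(x))$), is locally free; then we say that $W\to V$ resolves the foliation. The Gauss blowup of a foliated variety is the lowest domain of definition of its Gauss map, i.e. the final one among the integral birational modifications on which the pullback of $\Omega$ modulo torsion is locally free. Consider the equation $$F(I\,F(I))=F(I)^{r+2}\qquad(*)$$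 for a nonzero ideal sheaf $I$ on $V$. 1. If the blowup of some nonzero ideal sheaf of $V$ resolves the foliation, then $(*)$ holds for some nonzero ideal sheaf $I$. 2. Conversely, if a nonzero ideal sheaf $I$ satisfies $(*)$, then blowing up $I$ and following by one Gauss blowup resolves the foliation (both blowups exist), and the composite is a locally projective birational map: locally on $V$ it is the blowup of a nonzero ideal sheaf. 3. If moreover every nonzero ideal sheaf on $V$ contains an invertible ideal sheaf (as is the case when $V$ is quasi-projective, so that every torsion free rank one coherent sheaf becomes an ideal sheaf after twisting by a divisor), then the existence of a nonzero ideal sheaf satisfying $(*)$ implies that the blowup of some nonzero ideal sheaf of $V$ resolves the foliation. -/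

import Mathlib

universe u

open CategoryTheory AlgebraicGeometry

noncomputable section

namespace FoliatedVariety

/-! ### The operator `F` on submodules of a field -/

section Algebra

variable {A K : Type*} [CommRing A] [Field K] [Algebra A K] {r : ℕ}

/-- The row `(f, δ₁ f, …, δᵣ f)`. -/
def row (δ : Fin r → Derivation ℤ K K) (f : K) : Fin (r + 1) → K :=
  Fin.cons f fun i => δ i f

/-- The module `P(M)` of first principal parts of `M` along `δ₁, …, δᵣ`: the `A`-span of the rows
`(f, δ₁ f, …, δᵣ f)`, `f ∈ M`. -/
def principalParts (δ : Fin r → Derivation ℤ K K) (M : Submodule A K) :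
    Submodule A (Fin (r + 1) → K) :=
  Submodule.span A (row δ '' (M : Set K))

/-- `F(M) = Λ^{r+1} P(M) / torsion`, that is, the image of `Λ^{r+1} P(M)` in
`Λ^{r+1} (K^{r+1}) = K`: the `A`-span of the determinants of `(r+1)`-tuples in `P(M)`. -/
def gaussF (δ : Fin r → Derivation ℤ K K) (M : Submodule A K) : Submodule A K :=
  Submodule.span A {d | ∃ p : Fin (r + 1) → Fin (r + 1) → K,
    (∀ i, p i ∈ principalParts δ M) ∧ d = Matrix.det (Matrix.of p)}

end Algebra

/-! ### Foliations on integral schemes over a field -/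

variable {k : Type u} [Field k] {V W : Scheme.{u}}

/-- The inclusion of the ground field in the function field. -/
def constants [IsIntegral V] (s : V ⟶ Spec (.of k)) : k →+* V.functionField :=
  ((Scheme.ΓSpecIso (.of k)).inv ≫ s.appTop ≫ V.presheaf.germ ⊤ (genericPoint V) trivial).hom

/-- A singular foliation on an integral `k`-scheme with function field `K`: a `K`-linear Lie
subalgebra of `Der_k(K, K)`. The `k`-derivations of `K` are the derivations that vanish on `k`. -/
structure Foliation [IsIntegral V] (s : V ⟶ Spec (.of k)) where
  /-- The derivations that belong to the foliation. -/
  carrier : Submodule V.functionField (Derivation ℤ V.functionField V.functionField)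
  map_constants : ∀ D ∈ carrier, ∀ c : k, D (constants s c) = 0
  lie_mem : ∀ D ∈ carrier, ∀ E ∈ carrier, ⁅D, E⁆ ∈ carrier

lemma genericPoint_specializes [IsIntegral V] [IsIntegral W] (π : W ⟶ V) [IsDominant π] :
    π (genericPoint W) ⤳ genericPoint V := by
  have h1 : IsGenericPoint (π (genericPoint W)) (closure (π '' Set.univ)) :=
    (genericPoint_spec W).image π.continuous
  have h2 : closure (π '' Set.univ) = Set.univ := by
    rw [Set.image_univ]; exact π.denseRange.closure_range
  rw [h2] at h1
  exact specializes_of_eq (h1.eq (genericPoint_spec V))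

/-- The homomorphism of function fields induced by a dominant morphism of integral schemes. -/
def functionFieldMap [IsIntegral V] [IsIntegral W] (π : W ⟶ V) [IsDominant π] :
    V.functionField →+* W.functionField :=
  (V.presheaf.stalkSpecializes (genericPoint_specializes π) ≫ π.stalkMap (genericPoint W)).hom

namespace Foliation

/-- The foliation lifted along `π : W ⟶ V`: it is spanned by the `k`-derivations of the function
field of `W` which restrict to a derivation of the foliation on the function field of `V`. For
`π` birational it is the same Lie algebra, carried over to the function field of `W`. -/
def lift [IsIntegral V] [IsIntegral W] {s : V ⟶ Spec (.of k)} (L : Foliation s) (π : W ⟶ V)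
    [IsDominant π] : Foliation (π ≫ s) where
  carrier := Submodule.span W.functionField
    {E | (∀ c : k, E (constants (π ≫ s) c) = 0) ∧
      ∃ D ∈ L.carrier, ∀ a, E (functionFieldMap π a) = functionFieldMap π (D a)}
  map_constants D hD c := by
    induction hD using Submodule.span_induction with
    | mem x hx => exact hx.1 c
    | zero => rfl
    | add x y _ _ hx hy => rw [Derivation.add_apply, hx, hy, add_zero]
    | smul a x _ hx => rw [Derivation.smul_apply, hx, smul_zero]
  lie_mem D hD E hE := by
    induction hD, hE using Submodule.span_induction₂ with
    | mem_mem x y hx hy =>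
      obtain ⟨hx0, D, hD, hxD⟩ := hx
      obtain ⟨hy0, E, hE, hyE⟩ := hy
      refine Submodule.subset_span ⟨fun c => ?_, ⁅D, E⁆, L.lie_mem D hD E hE, fun a => ?_⟩
      · rw [Derivation.commutator_apply, hx0, hy0, map_zero, map_zero, sub_zero]
      · rw [Derivation.commutator_apply, Derivation.commutator_apply, hyE, hxD, hxD, hyE, map_sub]
    | zero_left y hy => rw [zero_lie]; exact Submodule.zero_mem _
    | zero_right x hx => rw [lie_zero]; exact Submodule.zero_mem _
    | add_left x y z _ _ _ h1 h2 => rw [add_lie]; exact Submodule.add_mem _ h1 h2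
    | add_right x y z _ _ _ h1 h2 => rw [lie_add]; exact Submodule.add_mem _ h1 h2
    | smul_left a x y hx hy h =>
      have e : ⁅a • x, y⁆ = a • ⁅x, y⁆ - y a • x := by
        ext f
        simp only [Derivation.commutator_apply, Derivation.smul_apply, Derivation.sub_apply,
          smul_eq_mul, Derivation.leibniz]
        ring
      rw [e]
      exact Submodule.sub_mem _ (Submodule.smul_mem _ _ h) (Submodule.smul_mem _ _ hx)
    | smul_right a x y hx hy h =>
      have e : ⁅x, a • y⁆ = a • ⁅x, y⁆ + x a • y := by
        ext f
        simp only [Derivation.commutator_apply, Derivation.smul_apply, Derivation.add_apply,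
          smul_eq_mul, Derivation.leibniz]
        ring
      rw [e]
      exact Submodule.add_mem _ (Submodule.smul_mem _ _ h) (Submodule.smul_mem _ _ hy)

variable [IsIntegral V] {s : V ⟶ Spec (.of k)} (L : Foliation s)

/-- The differential of a rational function along the foliation, `f ↦ (δ ↦ δ f)`. -/
def ev (f : V.functionField) : L.carrier →ₗ[V.functionField] V.functionField where
  toFun D := (D : Derivation ℤ V.functionField V.functionField) f
  map_add' _ _ := rfl
  map_smul' _ _ := rfl

/-- The stalk at `x` of the sheaf `Ω` of differentials along the foliation: the image of
`Ω_{V/k, x}` in the dual of the foliation. -/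
def differentials (x : V) :
    Submodule (V.presheaf.stalk x) (L.carrier →ₗ[V.functionField] V.functionField) :=
  Submodule.span _ {ω | ∃ f : V.presheaf.stalk x, ω = L.ev (algebraMap _ V.functionField f)}

/-- The foliation is nonsingular: its sheaf of differentials is locally free. (The rank is then
the dimension of the foliation, since `Ω` spans the dual of the foliation over `K`.) -/
def IsNonsingular : Prop :=
  ∀ x : V, Module.Free (V.presheaf.stalk x) (L.differentials x)

/-- The stalk at `w : W` of the pull-back, modulo torsion, of `Ω` along a birational
morphism `π : W ⟶ V`. -/
def pullbackDifferentials [IsIntegral W] (π : W ⟶ V) [IsDominant π] (w : W) :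
    Submodule (W.presheaf.stalk w) ((L.lift π).carrier →ₗ[W.functionField] W.functionField) :=
  Submodule.span _ {ω | ∃ f : V.presheaf.stalk (π w),
    ω = (L.lift π).ev (algebraMap _ W.functionField (π.stalkMap w f))}

/-- The Gauss rational map, from `V` to the Grassmannian of locally free quotients of
`Ω_{V/k}` of rank the dimension of the foliation, extends to a morphism on the birational
modification `W` of `V`: the pull-back of `Ω` modulo torsion is locally free. -/
structure ExtendsGaussMap [IsIntegral W] (π : W ⟶ V) [IsDominant π] : Prop where
  birational : Function.Bijective (functionFieldMap π)
  free : ∀ w : W, Module.Free (W.presheaf.stalk w) (L.pullbackDifferentials π w)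

/-- `π : W ⟶ V` is the Gauss blowup of the foliated variety `V`, the lowest domain of definition
of the Gauss rational map: the map extends to `W`, and every integral birational modification of
`V` to which it extends factors uniquely through `W`. -/
structure IsGaussBlowup [IsIntegral W] (π : W ⟶ V) [IsDominant π] : Prop where
  extendsGaussMap : L.ExtendsGaussMap π
  existsUnique_lift : ∀ (T : Scheme.{u}) [IsIntegral T] (g : T ⟶ V) [IsDominant g],
    L.ExtendsGaussMap g → ∃! h : T ⟶ W, h ≫ π = g

end Foliation

/-! ### Blowups -/

/-- An ideal sheaf is invertible if it is locally generated by one nonzerodivisor. -/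
def IsInvertible (J : V.IdealSheafData) : Prop :=
  ∀ x : V, ∃ U : V.affineOpens, x ∈ U.1 ∧
    ∃ a ∈ nonZeroDivisors Γ(V, U.1), J.ideal U = Ideal.span {a}

/-- `π : W ⟶ V` is the blowup of the ideal sheaf `I`, by its universal property: the inverse image
ideal sheaf is invertible on `W`, and `W` is universal for this. -/
structure IsBlowup (I : V.IdealSheafData) (π : W ⟶ V) : Prop where
  isInvertible : IsInvertible (I.comap π)
  existsUnique_lift : ∀ (T : Scheme.{u}) (g : T ⟶ V), IsInvertible (I.comap g) →
    ∃! h : T ⟶ W, h ≫ π = g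

/-- A morphism to an integral scheme is locally a blowup if, locally on the target, it is the
blowup of a nonzero ideal sheaf. For morphisms between varieties: it is birational and locally
projective. -/
def IsLocallyBlowup (π : W ⟶ V) : Prop :=
  ∀ x : V, ∃ U : V.Opens, x ∈ U ∧ ∃ J : U.toScheme.IdealSheafData, J ≠ ⊥ ∧ IsBlowup J (π ∣_ U)

/-- Every nonzero ideal sheaf contains an invertible one. Equivalently on a variety, every torsion
free rank one coherent sheaf becomes an ideal sheaf after twisting by a Cartier divisor. Affine,
quasi-projective and locally factorial varieties have this property. -/
def HasEnoughDivisors (V : Scheme.{u}) : Prop :=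
  ∀ I : V.IdealSheafData, I ≠ ⊥ → ∃ D : V.IdealSheafData, IsInvertible D ∧ D ≤ I

/-! ### Resolutions and the equation -/

variable [IsIntegral V] {s : V ⟶ Spec (.of k)} (L : Foliation s)

/-- Some blowup of a nonzero ideal sheaf of `V` resolves the foliation. -/
def Foliation.ResolvableByBlowup : Prop :=
  ∃ I : V.IdealSheafData, I ≠ ⊥ ∧ ∃ (W : Scheme.{u}) (_ : IsIntegral W) (π : W ⟶ V)
    (_ : IsDominant π), IsBlowup I π ∧ (L.lift π).IsNonsingular

variable {L}

/-- The ideal of sections of `I` over an affine open set, as a fractional ideal. -/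
def sections (I : V.IdealSheafData) (U : V.affineOpens) [Nonempty U.1] :
    Submodule Γ(V, U.1) V.functionField :=
  Submodule.map (Algebra.linearMap Γ(V, U.1) V.functionField) (I.ideal U)

/-- The equation `F(I F(I)) = F(I)^{r+2}`, as an equality of fractional ideals on every affine
open set, where `F` is computed with a basis of the foliation. (Another basis multiplies both
sides by the same rational function.) -/
def SatisfiesGaussEquation {r : ℕ} (b : Module.Basis (Fin r) V.functionField L.carrier)
    (I : V.IdealSheafData) : Prop :=
  ∀ (U : V.affineOpens) [Nonempty U.1],
    gaussF (fun i => (b i).1) (sections I U * gaussF (fun i => (b i).1) (sections I U)) =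
      gaussF (fun i => (b i).1) (sections I U) ^ (r + 2)

end FoliatedVariety

end

/-!
# Resolving a foliation by blowing up an ideal sheaf

Everything takes place inside the function field `K` of `V`. A foliation with basis `δ₁, …, δᵣ` is
nonsingular on a birational modification `W ⟶ V` iff in each local ring `R ⊆ K` of `W` the jacobian
determinants `det (δᵢ xⱼ)`, `xⱼ ∈ R`, generate a nonzero principal fractional ideal
(`Frame.free_iff`); likewise the Gauss map extends to `W` iff the jacobians of the functions on `V`
generate a principal ideal in the local rings of `W`. The determinants of rows `(f, δ₁ f, …, δᵣ f)`
are related to the jacobians by a change of generators: if `f ∈ M` generates `M R`, and `R` is the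
local ring generated by the functions on `V` and the quotients `m / f`, `m ∈ M`, then
`F(M) R = f ^ (r + 1) F(R)` (`span_gaussF_eq`), while `F(R)` is the ideal of jacobians, as `1 ∈ R`
has zero differential. So on the blowup of `M` the fractional ideal `F(M)` becomes principal
exactly where the jacobian ideal does (`hasPrincipalJacobian_iff_gaussF`), and the Gauss blowup of
the blowup of `M` is the blowup of `M F(M)` (`FracIdeal.IsModel.exists_isGaussBlowup`,
`FracIdeal.IsModel.isModel_of_isGaussBlowup`).

*From the equation to a resolution.* On the blowup of `M F(M)` the fractional ideal `F(M)` is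
principal. If `F(M F(M)) = F(M) ^ (r + 2)`, then `F(M F(M))` is principal too, and the relation
between `F` and jacobians, applied to `M F(M)` instead of `M`, says that the foliation on this
blowup is nonsingular (`hasPrincipalJacobian_of_gaussEquation`). Locally on `V` a common denominator
turns `M F(M)` into an ideal with the same blowup. If every nonzero ideal sheaf contains an
invertible one, this works globally: multiply by an invertible ideal sheaf contained in the sheaf
of denominators of `M F(M)` (`FracIdeal.resolvableByBlowup`).

*From a resolution to the equation.* Suppose that the foliation is nonsingular on the blowup of `I`.
Both sides of the equation for the powers of `I` then agree in the local rings of the blowup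
(`span_gaussF_mul_gaussF`), hence locally on `V` up to multiplication by a power of `I`
(`FracIdeal.exists_pow_mul_mem`). To get rid of this power, `I` is replaced by a large power `I ^ n`.
In characteristic zero `I ^ (r + 1)` is generated, as a module, by the powers `f ^ (r + 1)`, `f ∈ I`,
so that `I ^ (r + 1) F(Q) ≤ F(I Q)` (`pow_mul_gaussF_le`); with the Artin-Rees lemma it follows that
`F(I ^ (n + 1) Q) = I ^ (r + 1) F(I ^ n Q)` for large `n` (`exists_gaussF_pow_smul_eq`). Hence for
large `n` both sides of the equation for `I ^ n` are large powers of `I` times modules which do not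
depend on `n`, and the equation holds (`exists_forall_ge_gaussEquation`). As `V` is covered by
finitely many affine open sets, one `n` serves for all of them.

The geometry is supplied by an explicit construction. A family of subrings of `K` that is closed
under localization defines a scheme by gluing spectra (`SubringModel`); the charts `A[M / f]` over
the affine open sets of `V` give the blowup of a coherent fractional ideal sheaf `M`
(`FracIdeal.Model`), whose local rings are local subrings of `K` (`locRing`), and which has the
universal property of the blowup (`FracIdeal.existsUnique_lift`). A morphism to `V` that is
the blowup of an ideal sheaf, or a Gauss blowup, is identified with such a model by its universal
property.
-/

noncomputable section

namespace FoliatedVariety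

/-! ### Spans over two rings and determinants -/

section SpanTower

variable {A R K E : Type*} [CommRing A] [CommRing R] [Field K] [Algebra A K] [Algebra R K]
  [AddCommGroup E] [Module K E] [Module A E] [Module R E] [IsScalarTower A K E]
  [IsScalarTower R K E]

lemma smul_mem_of_range_le (h : (algebraMap A K).range ≤ (algebraMap R K).range)
    (N : Submodule R E) (a : A) {x : E} (hx : x ∈ N) : a • x ∈ N := by
  obtain ⟨b, hb⟩ := h ⟨a, rfl⟩
  rw [← algebraMap_smul K a x, ← hb, algebraMap_smul]
  exact N.smul_mem b hx

lemma span_le_of_range_le (h : (algebraMap A K).range ≤ (algebraMap R K).range)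
    {S : Set E} {N : Submodule R E} (hS : S ⊆ N) {x : E} (hx : x ∈ Submodule.span A S) :
    x ∈ N := by
  induction hx using Submodule.span_induction with
  | mem x hx => exact hS hx
  | zero => exact N.zero_mem
  | add x y _ _ hx hy => exact N.add_mem hx hy
  | smul a x _ hx => exact smul_mem_of_range_le h N a hx

lemma span_span_of_range_le (h : (algebraMap A K).range ≤ (algebraMap R K).range) (S : Set E) :
    Submodule.span R (Submodule.span A S : Set E) = Submodule.span R S :=
  le_antisymm (Submodule.span_le.2 fun _ hx => span_le_of_range_le h Submodule.subset_span hx)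
    (Submodule.span_mono Submodule.subset_span)

lemma span_mul_of_range_le (h : (algebraMap A K).range ≤ (algebraMap R K).range)
    (M N : Submodule A K) :
    Submodule.span R ((M * N : Submodule A K) : Set K) =
      Submodule.span R (M : Set K) * Submodule.span R (N : Set K) := by
  rw [Submodule.mul_eq_span_mul_set, span_span_of_range_le h, Submodule.span_mul_span]

lemma span_pow_of_range_le (h : (algebraMap A K).range ≤ (algebraMap R K).range)
    (M : Submodule A K) (n : ℕ) :
    Submodule.span R ((M ^ n : Submodule A K) : Set K) = Submodule.span R (M : Set K) ^ n := by
  rw [Submodule.pow_eq_span_pow_set, span_span_of_range_le h, Submodule.span_pow]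

end SpanTower

section DetSpan

/-- A multilinear map sends tuples in the span of `S` to the span of the values on tuples in `S`. -/
lemma multilinear_mem_span {A E F : Type*} [CommRing A] [AddCommGroup E] [Module A E]
    [AddCommGroup F] [Module A F] {ι : Type*} [Fintype ι] [DecidableEq ι]
    (f : MultilinearMap A (fun _ : ι => E) F) (S : Set E) (p : ι → E)
    (hp : ∀ i, p i ∈ Submodule.span A S) :
    f p ∈ Submodule.span A {d | ∃ s : ι → E, (∀ i, s i ∈ S) ∧ d = f s} := by
  suffices H : ∀ (t : Finset ι) (p : ι → E), (∀ i ∈ t, p i ∈ Submodule.span A S) →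
      (∀ i ∉ t, p i ∈ S) → f p ∈ Submodule.span A {d | ∃ s : ι → E, (∀ i, s i ∈ S) ∧ d = f s} from
    H Finset.univ p (fun i _ => hp i) (by simp)
  intro t
  induction t using Finset.induction_on with
  | empty => exact fun p _ h => Submodule.subset_span ⟨p, fun i => h i (by simp), rfl⟩
  | insert i t hi ih =>
    intro p h1 h2
    have key : ∀ x ∈ Submodule.span A S, f (Function.update p i x) ∈
        Submodule.span A {d | ∃ s : ι → E, (∀ i, s i ∈ S) ∧ d = f s} := by
      intro x hx
      induction hx using Submodule.span_induction with
      | mem x hx =>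
        refine ih _ (fun j hj => ?_) (fun j hj => ?_)
        · rw [Function.update_of_ne (by rintro rfl; exact hi hj)]
          exact h1 j (Finset.mem_insert_of_mem hj)
        · by_cases hji : j = i
          · subst hji; rwa [Function.update_self]
          · rw [Function.update_of_ne hji]
            exact h2 j (by simp [hji, hj])
      | zero => rw [f.map_update_zero]; exact Submodule.zero_mem _
      | add x y _ _ hx hy => rw [f.map_update_add]; exact Submodule.add_mem _ hx hy
      | smul a x _ hx => rw [f.map_update_smul]; exact Submodule.smul_mem _ _ hx
    simpa using key (p i) (h1 i (Finset.mem_insert_self _ _))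

variable {A R K : Type*} [CommRing A] [CommRing R] [Field K] [Algebra A K] [Algebra R K] {n : ℕ}

/-- The span of the determinants of `n`-tuples in a submodule `P` of `K^n`: the image of `Λ^n P`
in `Λ^n K^n = K`. -/
def detSpan (P : Submodule A (Fin n → K)) : Submodule A K :=
  Submodule.span A {d | ∃ p : Fin n → Fin n → K, (∀ i, p i ∈ P) ∧ d = Matrix.det (Matrix.of p)}

lemma detSpan_mono {P Q : Submodule A (Fin n → K)} (h : P ≤ Q) : detSpan P ≤ detSpan Q :=
  Submodule.span_mono fun _ ⟨p, hp, hd⟩ => ⟨p, fun i => h (hp i), hd⟩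

lemma detSpan_span (S : Set (Fin n → K)) :
    detSpan (Submodule.span A S) = Submodule.span A
      {d | ∃ p : Fin n → Fin n → K, (∀ i, p i ∈ S) ∧ d = Matrix.det (Matrix.of p)} := by
  refine le_antisymm (Submodule.span_le.2 ?_) (Submodule.span_mono ?_)
  · rintro _ ⟨p, hp, rfl⟩
    exact multilinear_mem_span
      ((Matrix.detRowAlternating (R := K) (n := Fin n)).toMultilinearMap.restrictScalars A) S p hp
  · rintro _ ⟨p, hp, rfl⟩
    exact ⟨p, fun i => Submodule.subset_span (hp i), rfl⟩

lemma span_detSpan (h : (algebraMap A K).range ≤ (algebraMap R K).range)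
    (P : Submodule A (Fin n → K)) :
    Submodule.span R (detSpan P : Set K) =
      detSpan (Submodule.span R (P : Set (Fin n → K))) := by
  rw [detSpan, span_span_of_range_le h, detSpan_span]
  rfl

/-- Multiplying all vectors by a matrix multiplies the span of determinants by its determinant. -/
lemma detSpan_map_vecMul (N : Matrix (Fin n) (Fin n) K) (S : Set (Fin n → K)) :
    detSpan (Submodule.span A ((fun v => Matrix.vecMul v N) '' S)) =
      Submodule.map (LinearMap.mulRight A N.det) (detSpan (Submodule.span A S)) := by
  rw [detSpan_span, detSpan_span, Submodule.map_span]
  congr 1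
  ext d
  constructor
  · rintro ⟨p, hp, rfl⟩
    choose q hq hqp using hp
    refine ⟨_, ⟨q, hq, rfl⟩, ?_⟩
    rw [LinearMap.mulRight_apply, ← Matrix.det_mul]
    congr 1
    ext i j
    rw [Matrix.mul_apply, Matrix.of_apply, ← hqp]
    rfl
  · rintro ⟨_, ⟨q, hq, rfl⟩, rfl⟩
    refine ⟨fun i => Matrix.vecMul (q i) N, fun i => ⟨q i, hq i, rfl⟩, ?_⟩
    rw [LinearMap.mulRight_apply, ← Matrix.det_mul]
    congr 1

end DetSpan

/-! ### Formal properties of the operator `F` -/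

section GaussF

variable {A R K : Type*} [CommRing A] [CommRing R] [Field K] [Algebra A K] [Algebra R K] {r : ℕ}
  (δ : Fin r → Derivation ℤ K K)

lemma gaussF_eq_detSpan (M : Submodule A K) : gaussF δ M = detSpan (principalParts δ M) := rfl

/-- The vector `(0, δ₁ x, …, δᵣ x)`. -/
def drow (x : K) : Fin (r + 1) → K := Fin.cons 0 fun i => δ i x

lemma row_mul (x y : K) : row δ (x * y) = x • row δ y + y • drow δ x := by
  ext i
  refine Fin.cases ?_ (fun i => ?_) i
  · simp [row, drow]
  · simp only [row, drow, Pi.add_apply, Pi.smul_apply, Fin.cons_succ, Derivation.leibniz,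
      smul_eq_mul]

lemma row_add (x y : K) : row δ (x + y) = row δ x + row δ y := by
  ext i; refine Fin.cases ?_ (fun i => ?_) i <;> simp [row]

lemma drow_mul (x y : K) : drow δ (x * y) = x • drow δ y + y • drow δ x := by
  ext i
  refine Fin.cases ?_ (fun i => ?_) i <;> simp [drow]

lemma drow_add (x y : K) : drow δ (x + y) = drow δ x + drow δ y := by
  ext i; refine Fin.cases ?_ (fun i => ?_) i <;> simp [drow]

lemma drow_neg (x : K) : drow δ (-x) = -drow δ x := by
  ext i; refine Fin.cases ?_ (fun i => ?_) i <;> simp [drow]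

lemma drow_zero : drow δ 0 = 0 := by
  ext i; refine Fin.cases ?_ (fun i => ?_) i <;> simp [drow]

lemma drow_one : drow δ 1 = 0 := by
  ext i; refine Fin.cases ?_ (fun i => ?_) i <;> simp [drow]

lemma drow_inv {x : K} (hx : x ≠ 0) : drow δ x⁻¹ = -((x⁻¹ * x⁻¹) • drow δ x) := by
  have h := drow_mul δ x x⁻¹
  rw [mul_inv_cancel₀ hx, drow_one] at h
  have h2 : x⁻¹ • (x • drow δ x⁻¹ + x⁻¹ • drow δ x) = 0 := by rw [← h, smul_zero]
  rw [smul_add, smul_smul, smul_smul, inv_mul_cancel₀ hx, one_smul] at h2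
  exact eq_neg_of_add_eq_zero_left h2

lemma gaussF_mono {M N : Submodule A K} (h : M ≤ N) : gaussF δ M ≤ gaussF δ N :=
  detSpan_mono (Submodule.span_mono (Set.image_mono h))

/-- The matrix of multiplication by the first order jet of `f`. -/
def jetMatrix (f : K) : Matrix (Fin (r + 1)) (Fin (r + 1)) K :=
  Matrix.of fun i j => if i = j then f else if i = 0 then row δ f j else 0

lemma det_jetMatrix (f : K) : (jetMatrix δ f).det = f ^ (r + 1) := by
  rw [Matrix.det_of_isUpperTriangular]
  · simp [jetMatrix]
  · intro i j hij
    have h1 : i ≠ j := (ne_of_lt hij).symm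
    have h2 : i ≠ 0 := fun h => by simp [h] at hij
    simp [jetMatrix, h1, h2]

lemma row_vecMul_jetMatrix (f g : K) : Matrix.vecMul (row δ g) (jetMatrix δ f) = row δ (f * g) := by
  ext j
  rw [Matrix.vecMul, dotProduct, Fin.sum_univ_succ]
  refine Fin.cases ?_ (fun j => ?_) j
  · simp [jetMatrix, row, mul_comm]
  · simp [jetMatrix, row, Derivation.leibniz, mul_comm, (Fin.succ_ne_zero _).symm, add_comm]

/-- `F(f M) = f^{r+1} F(M)` for a single element `f`. -/
lemma gaussF_map_mulLeft (f : K) (M : Submodule A K) :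
    gaussF δ (M.map (LinearMap.mulLeft A f)) =
      (gaussF δ M).map (LinearMap.mulLeft A (f ^ (r + 1))) := by
  have h : row δ '' (M.map (LinearMap.mulLeft A f) : Set K) =
      (fun v => Matrix.vecMul v (jetMatrix δ f)) '' (row δ '' (M : Set K)) := by
    rw [Set.image_image, Submodule.map_coe, Set.image_image]
    exact Set.image_congr fun x _ => (row_vecMul_jetMatrix δ f x).symm
  rw [gaussF_eq_detSpan, gaussF_eq_detSpan, principalParts, h, detSpan_map_vecMul, det_jetMatrix]
  congr 1
  ext x
  simp [mul_comm]

/-- `F(M) R` is the determinant span of `P(M) R`. -/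
lemma span_gaussF (h : (algebraMap A K).range ≤ (algebraMap R K).range) (M : Submodule A K) :
    Submodule.span R (gaussF δ M : Set K) =
      detSpan (Submodule.span R (row δ '' (M : Set K))) := by
  rw [gaussF_eq_detSpan, span_detSpan h, principalParts, span_span_of_range_le h]

end GaussF

/-! ### Local rings generated by a set -/

section LocallyGenerated

variable {K : Type*} [Field K] {r : ℕ} (δ : Fin r → Derivation ℤ K K)

/-- The subring `R` is generated by `S` as a local ring: it is the only subring of `R` that
contains `S` and contains the inverses of those of its elements that are units of `R`. -/
def LocallyGenerates (S : Set K) (R : Subring K) : Prop :=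
  S ⊆ R ∧ ∀ R' : Subring K, S ⊆ R' → R' ≤ R → (∀ x ∈ R', x⁻¹ ∈ R → x⁻¹ ∈ R') → R ≤ R'

lemma LocallyGenerates.mono {S S' : Set K} {R : Subring K} (h : LocallyGenerates S R)
    (hS : S ⊆ S') (hR : S' ⊆ R) : LocallyGenerates S' R :=
  ⟨hR, fun R' h1 h2 h3 => h.2 R' (hS.trans h1) h2 h3⟩

/-- Multiples of differentials in a given module are closed under the operations of a local
ring. -/
lemma LocallyGenerates.smul_drow_mem {S : Set K} {R : Subring K} (h : LocallyGenerates S R) (m : K)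
    (N : Submodule R (Fin (r + 1) → K)) (hS : ∀ x ∈ S, m • drow δ x ∈ N) {x : K} (hx : x ∈ R) :
    m • drow δ x ∈ N := by
  have hsmul : ∀ {y : K} (_ : y ∈ R) {v : Fin (r + 1) → K} (_ : v ∈ N), y • v ∈ N :=
    fun {y} hy {v} hv => N.smul_mem (⟨y, hy⟩ : R) hv
  let R' : Subring K :=
    { carrier := {x | x ∈ R ∧ m • drow δ x ∈ N}
      mul_mem' := by
        rintro x y ⟨hx, hx'⟩ ⟨hy, hy'⟩
        refine ⟨R.mul_mem hx hy, ?_⟩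
        rw [drow_mul, smul_add, smul_comm m x, smul_comm m y]
        exact N.add_mem (hsmul hx hy') (hsmul hy hx')
      one_mem' := ⟨R.one_mem, by rw [drow_one, smul_zero]; exact N.zero_mem⟩
      add_mem' := by
        rintro x y ⟨hx, hx'⟩ ⟨hy, hy'⟩
        refine ⟨R.add_mem hx hy, ?_⟩
        rw [drow_add, smul_add]
        exact N.add_mem hx' hy'
      zero_mem' := ⟨R.zero_mem, by rw [drow_zero, smul_zero]; exact N.zero_mem⟩
      neg_mem' := by
        rintro x ⟨hx, hx'⟩
        refine ⟨R.neg_mem hx, ?_⟩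
        rw [drow_neg, smul_neg]
        exact N.neg_mem hx' }
  refine (h.2 R' (fun x hx => ⟨h.1 hx, hS x hx⟩) (fun x hx => hx.1) ?_ hx).2
  rintro x ⟨hx, hx'⟩ hxi
  refine ⟨hxi, ?_⟩
  by_cases h0 : x = 0
  · rw [h0, inv_zero, drow_zero, smul_zero]; exact N.zero_mem
  · rw [drow_inv δ h0, smul_neg, smul_comm]
    exact N.neg_mem (hsmul (R.mul_mem hxi hxi) hx')

variable {A : Type*} [CommRing A] [Algebra A K]

lemma algebraMap_range_subring (R : Subring K) : (algebraMap R K).range = R := by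
  ext x
  exact ⟨by rintro ⟨y, rfl⟩; exact y.2, fun hx => ⟨⟨x, hx⟩, rfl⟩⟩

lemma range_le_of_locallyGenerates {S : Set K} {R : Subring K}
    (h : LocallyGenerates ((algebraMap A K).range ∪ S) R) :
    (algebraMap A K).range ≤ (algebraMap R K).range := by
  rw [algebraMap_range_subring]
  exact fun x hx => h.1 (Or.inl hx)

/-- The operator `F` commutes with localization. -/
lemma span_gaussF_of_localization {R : Subring K}
    (h : LocallyGenerates ((algebraMap A K).range : Set K) R) (M : Submodule A K) :
    Submodule.span R (gaussF δ M : Set K) = gaussF δ (Submodule.span R (M : Set K)) := by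
  have hAR : (algebraMap A K).range ≤ (algebraMap R K).range := by
    rw [algebraMap_range_subring]; exact h.1
  rw [span_gaussF δ hAR, gaussF_eq_detSpan, principalParts]
  refine congrArg detSpan (le_antisymm (Submodule.span_mono (Set.image_mono
    Submodule.subset_span)) (Submodule.span_le.2 ?_))
  rintro _ ⟨x, hx, rfl⟩
  set N := Submodule.span R (row δ '' (M : Set K)) with hN
  have hM : ∀ m ∈ M, row δ m ∈ N := fun m hm => Submodule.subset_span ⟨m, hm, rfl⟩
  have hd : ∀ m ∈ M, ∀ y ∈ R, m • drow δ y ∈ N := by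
    intro m hm y hy
    refine h.smul_drow_mem δ m N ?_ hy
    rintro _ ⟨a, rfl⟩
    have h1 := row_mul δ (algebraMap A K a) m
    rw [eq_comm, ← eq_sub_iff_add_eq'] at h1
    rw [h1, algebraMap_smul]
    refine N.sub_mem (hM _ ?_) (smul_mem_of_range_le hAR N a (hM m hm))
    rw [← Algebra.smul_def]
    exact M.smul_mem a hm
  change row δ x ∈ N
  induction hx using Submodule.span_induction with
  | mem x hx => exact hM x hx
  | zero =>
    have : row δ (0 : K) = 0 := by simpa using row_mul δ 0 0
    rw [this]; exact N.zero_mem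
  | add x y _ _ hx hy => rw [row_add]; exact N.add_mem hx hy
  | smul a x hx' hx =>
    rw [Subring.smul_def, smul_eq_mul, row_mul]
    refine N.add_mem (N.smul_mem a hx) ?_
    refine Submodule.span_induction (p := fun x _ => x • drow δ (a : K) ∈ N)
      (fun m hm => hd m hm a a.2) ?_ ?_ ?_ hx'
    · rw [zero_smul]; exact N.zero_mem
    · intro x y _ _ hx hy; rw [add_smul]; exact N.add_mem hx hy
    · intro b x _ hx
      rw [smul_assoc]; exact N.smul_mem b hx

/-- The key formula: if `f ∈ M` generates `M R`, and `R` is generated as a local ring by `A` and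
`M / f`, then `F(M) R = f^{r+1} F_R(R)`. Multiplication by `f` acts on the rows through `jetMatrix`,
of determinant `f^{r+1}`, so that `M` may be replaced by `M / f`. By the Leibniz rule, the
differentials of local generators of `R` span those of all elements; hence so do the rows. -/
lemma span_gaussF_eq {R : Subring K} {M : Submodule A K} {f : K} (hf : f ∈ M) (hf0 : f ≠ 0)
    (h : LocallyGenerates ((algebraMap A K).range ∪ (fun m => m / f) '' M) R) :
    Submodule.span R (gaussF δ M : Set K) =
      (gaussF δ (1 : Submodule R K)).map (LinearMap.mulLeft R (f ^ (r + 1))) := by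
  have hAR := range_le_of_locallyGenerates h
  have hone : ((1 : Submodule R K) : Set K) = R := by
    ext x
    rw [SetLike.mem_coe, Submodule.mem_one]
    exact ⟨by rintro ⟨y, rfl⟩; exact y.2, fun hx => ⟨⟨x, hx⟩, rfl⟩⟩
  rw [← gaussF_map_mulLeft, span_gaussF δ hAR, gaussF_eq_detSpan, principalParts]
  have h1 : ∀ (S : Set K), row δ '' ((fun x => f * x) '' S) =
      (fun v => Matrix.vecMul v (jetMatrix δ f)) '' (row δ '' S) := fun S => by
    rw [Set.image_image, Set.image_image]
    exact Set.image_congr fun x _ => (row_vecMul_jetMatrix δ f x).symm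
  have h2 : (M : Set K) = (fun x => f * x) '' ((fun m => m / f) '' (M : Set K)) := by
    rw [Set.image_image]
    simp [mul_div_cancel₀ _ hf0]
  rw [Submodule.map_coe, hone]
  change _ = detSpan (Submodule.span R (row δ '' ((fun x => f * x) '' (R : Set K))))
  rw [h2, h1, h1, detSpan_map_vecMul, detSpan_map_vecMul]
  refine congrArg (Submodule.map _) (congrArg detSpan (le_antisymm
    (Submodule.span_mono (Set.image_mono ?_)) (Submodule.span_le.2 ?_)))
  · exact fun x hx => h.1 (Or.inr hx)
  rintro _ ⟨x, hx, rfl⟩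
  set N := Submodule.span R (row δ '' ((fun m => m / f) '' (M : Set K))) with hN
  have hM : ∀ m ∈ M, row δ (m / f) ∈ N := fun m hm => Submodule.subset_span ⟨_, ⟨m, hm, rfl⟩, rfl⟩
  have h1N : row δ (1 : K) ∈ N := by simpa [div_self hf0] using hM f hf
  have hrow : ∀ y : K, row δ y = y • row δ 1 + drow δ y := fun y => by
    simpa using row_mul δ y 1
  have hd : (1 : K) • drow δ x ∈ N := by
    refine h.smul_drow_mem δ 1 N ?_ hx
    rintro y (⟨a, rfl⟩ | ⟨m, hm, rfl⟩)
    · rw [one_smul, ← sub_eq_iff_eq_add'.2 (hrow (algebraMap A K a)), algebraMap_smul]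
      refine N.sub_mem ?_ (smul_mem_of_range_le hAR N a h1N)
      have := hM (a • f) (M.smul_mem a hf)
      rwa [Algebra.smul_def, mul_div_assoc, div_self hf0, mul_one] at this
    · rw [one_smul, ← sub_eq_iff_eq_add'.2 (hrow (m / f))]
      exact N.sub_mem (hM m hm)
        (N.smul_mem (⟨m / f, h.1 (Or.inr ⟨m, hm, rfl⟩)⟩ : R) h1N)
  rw [one_smul] at hd
  change row δ x ∈ N
  rw [hrow]
  exact N.add_mem (N.smul_mem (⟨x, hx⟩ : R) h1N) hd

end LocallyGenerated

/-! ### Powers of a module in characteristic zero -/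

section Polarization

variable {A K : Type*} [CommRing A] [Field K] [Algebra A K]

/-- A polynomial function with values in a submodule at all natural numbers has all its coefficients
in the submodule, if nonzero integers are invertible. -/
lemma coeff_mem_of_forall_eval_mem (hA : ∀ n : ℕ, n ≠ 0 → IsUnit (n : A)) (N : Submodule A K)
    {m : ℕ} (c : Fin m → K) (h : ∀ t : ℕ, ∑ i : Fin m, (t : K) ^ (i : ℕ) * c i ∈ N) (i : Fin m) :
    c i ∈ N := by
  let V : Matrix (Fin m) (Fin m) A := Matrix.vandermonde fun j : Fin m => ((j : ℕ) : A)
  have hV : IsUnit V.det := by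
    rw [Matrix.det_vandermonde]
    refine IsUnit.prod_iff.2 fun (a : Fin m) _ => IsUnit.prod_iff.2 fun (b : Fin m) hb => ?_
    have hab : (a : ℕ) < b := Fin.lt_def.1 (Finset.mem_Ioi.1 hb)
    rw [← Nat.cast_sub hab.le]
    exact hA _ (Nat.sub_ne_zero_of_lt hab)
  obtain ⟨u, hu⟩ := hV
  have h1 : ∀ j, ∑ k, V j k • c k ∈ N := fun j => by
    have := h j
    simpa [V, Matrix.vandermonde_apply, Algebra.smul_def] using this
  have h2 : V.det • c i = ∑ j, V.adjugate i j • ∑ k, V j k • c k := by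
    simp_rw [Finset.smul_sum, smul_smul]
    rw [Finset.sum_comm]
    simp_rw [← Finset.sum_smul, ← Matrix.mul_apply, Matrix.adjugate_mul, Matrix.smul_apply,
      Matrix.one_apply]
    simp
  have h3 : V.det • c i ∈ N := by
    rw [h2]
    exact N.sum_mem fun j _ => N.smul_mem _ (h1 j)
  have h4 : (↑u⁻¹ : A) • (V.det • c i) = c i := by
    rw [smul_smul, ← hu, Units.inv_mul, one_smul]
  rw [← h4]
  exact N.smul_mem _ h3

/-- In characteristic zero the power `M^n` is spanned by the `n`-th powers of elements of `M`. -/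
lemma mul_mem_of_forall_pow_mul_mem (hA : ∀ n : ℕ, n ≠ 0 → IsUnit (n : A)) (M N : Submodule A K)
    (n : ℕ) (d : K) (h : ∀ f ∈ M, f ^ n * d ∈ N) {x : K} (hx : x ∈ M ^ n) : x * d ∈ N := by
  suffices H : ∀ k ≤ n, ∀ x ∈ M ^ k, ∀ f ∈ M, x * f ^ (n - k) * d ∈ N by
    have := H n le_rfl x hx 0 M.zero_mem
    simpa using this
  intro k
  induction k with
  | zero =>
    intro _ x hx f hf
    rw [pow_zero, Submodule.mem_one] at hx
    obtain ⟨a, rfl⟩ := hx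
    rw [mul_assoc, ← Algebra.smul_def]
    exact N.smul_mem a (h f hf)
  | succ k ih =>
    intro hk x hx f hf
    rw [pow_succ] at hx
    induction hx using Submodule.mul_induction_on' with
    | mem_mul_mem a ha y hy =>
      obtain ⟨m, hm⟩ : ∃ m, n - k = m + 1 := ⟨n - k - 1, by omega⟩
      have hm' : n - (k + 1) = m := by omega
      -- the coefficient of `t` in `a * (f + t * y) ^ (m + 1) * d` is `(m + 1) * (a * y * f ^ m * d)`
      have key := coeff_mem_of_forall_eval_mem hA N (m := m + 2)
        (fun i => a * (y ^ (i : ℕ) * f ^ (m + 1 - i) * ((m + 1).choose i)) * d) (fun t => ?_) 1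
      · have hu := hA (m + 1) (Nat.succ_ne_zero m)
        obtain ⟨u, hu⟩ := hu
        rw [hm']
        have e : a * y * f ^ m * d = (↑u⁻¹ : A) • ((u : A) • (a * y * f ^ m * d)) := by
          rw [smul_smul, Units.inv_mul, one_smul]
        rw [e]
        refine N.smul_mem _ ?_
        rw [hu, Algebra.smul_def, map_natCast]
        convert key using 1
        simp
        ring
      · have h1 := ih (by omega) a ha ((t : A) • y + f) (M.add_mem (M.smul_mem _ hy) hf)
        rw [hm, Algebra.smul_def, map_natCast, add_pow, Finset.mul_sum, Finset.sum_mul,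
          Finset.sum_range] at h1
        convert h1 using 2
        rw [mul_pow]
        ring
    | add x y _ _ hx hy =>
      rw [add_mul, add_mul]
      exact N.add_mem hx hy

variable {r : ℕ} (δ : Fin r → Derivation ℤ K K)

/-- In characteristic zero `M^{r+1} F(Q) ≤ F(M Q)`. -/
lemma pow_mul_gaussF_le (hA : ∀ n : ℕ, n ≠ 0 → IsUnit (n : A)) (M Q : Submodule A K) :
    M ^ (r + 1) * gaussF δ Q ≤ gaussF δ (M * Q) := by
  rw [Submodule.mul_le]
  intro x hx d hd
  refine mul_mem_of_forall_pow_mul_mem hA M _ (r + 1) d (fun f hf => ?_) hx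
  have h1 : f ^ (r + 1) * d ∈ (gaussF δ Q).map (LinearMap.mulLeft A (f ^ (r + 1))) := ⟨d, hd, rfl⟩
  rw [← gaussF_map_mulLeft] at h1
  refine gaussF_mono δ ?_ h1
  rintro _ ⟨q, hq, rfl⟩
  exact Submodule.mul_mem_mul hf hq

end Polarization

/-! ### The modules `F(I^n Q)` for large `n` -/

section Stability

variable {A K : Type*} [CommRing A] [Field K] [Algebra A K]

lemma ideal_smul_eq_map_mul (I : Ideal A) (X : Submodule A K) :
    I • X = Submodule.map (Algebra.linearMap A K) I * X := by
  refine le_antisymm (Submodule.smul_le.2 fun a ha x hx => ?_) (Submodule.mul_le.2 ?_)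
  · rw [Algebra.smul_def]
    exact Submodule.mul_mem_mul ⟨a, ha, rfl⟩ hx
  · rintro _ ⟨a, ha, rfl⟩ x hx
    rw [Algebra.linearMap_apply, ← Algebra.smul_def]
    exact Submodule.smul_mem_smul ha hx

lemma map_linearMap_pow (I : Ideal A) (n : ℕ) :
    Submodule.map (Algebra.linearMap A K) (I ^ n) =
      Submodule.map (Algebra.linearMap A K) I ^ n :=
  Submodule.map_pow I (Algebra.ofId A K) n

lemma ideal_smul_pow (I : Ideal A) (X : Submodule A K) (n : ℕ) : (I • X) ^ n = I ^ n • X ^ n := by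
  rw [ideal_smul_eq_map_mul, ideal_smul_eq_map_mul, mul_pow, map_linearMap_pow]

lemma prod_mem_smul_pow {ι : Type*} (s : Finset ι) (I : Ideal A) (D : Submodule A K) (x : ι → K)
    (hx : ∀ i ∈ s, x i ∈ I • D) : ∏ i ∈ s, x i ∈ I ^ s.card • D ^ s.card := by
  rw [← ideal_smul_pow]
  induction s using Finset.cons_induction with
  | empty => simpa using Submodule.one_le.1 (le_refl (1 : Submodule A K))
  | cons i s hi ih =>
    rw [Finset.prod_cons, Finset.card_cons, pow_succ']
    exact Submodule.mul_mem_mul (hx i (by simp)) (ih fun j hj => hx j (by simp [hj]))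

lemma det_mem_smul_pow {n : ℕ} (I : Ideal A) (D : Submodule A K) (p : Matrix (Fin n) (Fin n) K)
    (hp : ∀ i j, p i j ∈ I • D) : p.det ∈ I ^ n • D ^ n := by
  rw [Matrix.det_apply]
  refine Submodule.sum_mem _ fun σ _ => ?_
  have := prod_mem_smul_pow Finset.univ I D (fun i => p (σ i) i) fun i _ => hp _ _
  rw [Finset.card_univ, Fintype.card_fin] at this
  rcases Int.units_eq_one_or (Equiv.Perm.sign σ) with h | h <;> rw [h]
  · simpa using this
  · simpa using this

variable {r : ℕ} (δ : Fin r → Derivation ℤ K K)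

/-- A finitely generated module that bounds the derivatives of elements of `Q`. -/
lemma exists_fg_derivation_bound (hE : ∃ E : Submodule A K, E.FG ∧ ∀ i a, δ i (algebraMap A K a) ∈ E)
    {Q : Submodule A K} (hQ : Q.FG) :
    ∃ D : Submodule A K, D.FG ∧ Q ≤ D ∧ (∀ i, ∀ q ∈ Q, δ i q ∈ D) ∧
      ∀ i a, ∀ q ∈ Q, q * δ i (algebraMap A K a) ∈ D := by
  obtain ⟨E, hE, hδ⟩ := hE
  obtain ⟨S, rfl⟩ := hQ
  let D₁ : Submodule A K := Submodule.span A (Set.range fun q : Fin r × S => δ q.1 q.2)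
  refine ⟨Submodule.span A S ⊔ D₁ ⊔ Submodule.span A S * E, ?_, ?_, ?_, ?_⟩
  · exact ((Submodule.fg_span S.finite_toSet).sup (Submodule.fg_span (Set.finite_range _))).sup
      ((Submodule.fg_span S.finite_toSet).mul hE)
  · exact le_sup_left.trans le_sup_left
  · intro i q hq
    induction hq using Submodule.span_induction with
    | mem q hq => exact Submodule.mem_sup_left (Submodule.mem_sup_right
        (Submodule.subset_span ⟨(i, ⟨q, hq⟩), rfl⟩))
    | zero => rw [map_zero]; exact Submodule.zero_mem _
    | add x y _ _ hx hy => rw [map_add]; exact Submodule.add_mem _ hx hy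
    | smul a x hx' hx =>
      rw [Algebra.smul_def, Derivation.leibniz, smul_eq_mul, smul_eq_mul, ← Algebra.smul_def]
      exact Submodule.add_mem _ (Submodule.smul_mem _ _ hx)
        (Submodule.mem_sup_right (Submodule.mul_mem_mul hx' (hδ i a)))
  · exact fun i a q hq => Submodule.mem_sup_right (Submodule.mul_mem_mul hq (hδ i a))

/-- `F(I^{n+1} Q)` is contained in `I^{(r+1) n} X` for a finitely generated module `X`. -/
lemma exists_gaussF_le_pow_smul
    (hE : ∃ E : Submodule A K, E.FG ∧ ∀ i a, δ i (algebraMap A K a) ∈ E)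
    (I : Ideal A) {Q : Submodule A K} (hQ : Q.FG) :
    ∃ X : Submodule A K, X.FG ∧ ∀ n, gaussF δ (I ^ (n + 1) • Q) ≤ (I ^ (r + 1)) ^ n • X := by
  obtain ⟨D, hD, hQD, hδQ, hδA⟩ := exists_fg_derivation_bound δ hE hQ
  refine ⟨D ^ (r + 1), hD.pow _, fun n => ?_⟩
  have H : ∀ n, ∀ x ∈ I ^ (n + 1) • Q, x ∈ I ^ n • D ∧ ∀ i, δ i x ∈ I ^ n • D := by
    intro n
    induction n with
    | zero =>
      intro x hx
      rw [pow_zero, one_smul]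
      have hxQ : x ∈ Q := Submodule.smul_le_right hx
      exact ⟨hQD hxQ, fun i => hδQ i x hxQ⟩
    | succ n ih =>
      intro x hx
      rw [pow_succ', mul_smul] at hx
      have hd : ∀ i, δ i x ∈ I ^ (n + 1) • D := by
        intro i
        induction hx using Submodule.smul_induction_on' with
        | smul f hf y hy =>
          rw [Algebra.smul_def f, Derivation.leibniz, smul_eq_mul, smul_eq_mul,
            ← Algebra.smul_def f]
          refine Submodule.add_mem _ ?_ ?_
          · rw [pow_succ', mul_smul]
            exact Submodule.smul_mem_smul hf ((ih y hy).2 i)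
          · clear ih
            induction hy using Submodule.smul_induction_on' with
            | smul a ha q hq =>
              rw [smul_mul_assoc]
              exact Submodule.smul_mem_smul ha (hδA i f q hq)
            | add x _ y _ hx hy => rw [add_mul]; exact Submodule.add_mem _ hx hy
        | add x _ y _ hx hy => rw [map_add]; exact Submodule.add_mem _ hx hy
      refine ⟨?_, hd⟩
      rw [← mul_smul, ← pow_succ'] at hx
      exact Submodule.smul_mono (Ideal.pow_le_pow_right (Nat.le_succ _)) hQD hx
  rw [gaussF_eq_detSpan, principalParts, detSpan_span, Submodule.span_le]
  rintro _ ⟨p, hp, rfl⟩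
  rw [← pow_mul, mul_comm, pow_mul]
  refine det_mem_smul_pow (I ^ n) D _ fun i j => ?_
  obtain ⟨x, hx, hxp⟩ := hp i
  rw [Matrix.of_apply, ← hxp]
  refine Fin.cases ?_ (fun j => ?_) j
  · simpa [row] using (H n x hx).1
  · simpa [row] using (H n x hx).2 j

/-- The sequence `F(I^n Q)` is a stable `I^{r+1}`-filtration from some point on: `F(I^n Q)` contains
`I^{r+1} F(I^{n-1} Q)` in characteristic zero, and the graded module of all `F(I^n Q)` is finite by
the Artin-Rees lemma. -/
lemma exists_gaussF_pow_smul_eq [IsNoetherianRing A] (hA : ∀ n : ℕ, n ≠ 0 → IsUnit (n : A))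
    (hE : ∃ E : Submodule A K, E.FG ∧ ∀ i a, δ i (algebraMap A K a) ∈ E)
    (I : Ideal A) {Q : Submodule A K} (hQ : Q.FG) :
    ∃ n₀, ∀ n, gaussF δ (I ^ (n₀ + n) • Q) = (I ^ (r + 1)) ^ n • gaussF δ (I ^ n₀ • Q) := by
  obtain ⟨X, hX, hFX⟩ := exists_gaussF_le_pow_smul δ hE I hQ
  have : Module.Finite A X := Module.Finite.iff_fg.2 hX
  have hsub : ∀ n, gaussF δ (I ^ (n + 1) • Q) ≤ X := fun n =>
    (hFX n).trans Submodule.smul_le_right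
  let F : (I ^ (r + 1)).Filtration X :=
    { N := fun n => (gaussF δ (I ^ (n + 1) • Q)).comap X.subtype
      mono := fun n => Submodule.comap_mono (gaussF_mono δ
        (Submodule.smul_mono_left (Ideal.pow_le_pow_right (Nat.le_succ _))))
      smul_le := fun n => by
        rw [Submodule.smul_le]
        intro a ha x hx
        rw [Submodule.mem_comap] at hx ⊢
        have h1 := pow_mul_gaussF_le δ hA (Submodule.map (Algebra.linearMap A K) I)
          (I ^ (n + 1) • Q)
        rw [← map_linearMap_pow, ← ideal_smul_eq_map_mul, ← ideal_smul_eq_map_mul, ← mul_smul,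
          ← pow_succ'] at h1
        exact h1 (Submodule.smul_mem_smul ha hx) }
  have hF : F.Stable := by
    refine Ideal.Filtration.Stable.of_le (F := (I ^ (r + 1)).stableFiltration ⊤)
      (Ideal.stableFiltration_stable _ _) ?_
    intro n x hx
    have h1 : X.subtype x ∈ Submodule.map X.subtype ((I ^ (r + 1)) ^ n • ⊤) := by
      rw [Submodule.map_smul'', Submodule.map_top, Submodule.range_subtype]
      exact hFX n hx
    obtain ⟨y, hy, hyx⟩ := h1
    rwa [← Subtype.ext hyx]
  obtain ⟨n₀, hn₀⟩ := hF.exists_pow_smul_eq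
  refine ⟨n₀ + 1, fun n => ?_⟩
  have h1 := congrArg (Submodule.map X.subtype) (hn₀ n)
  rw [Submodule.map_smul''] at h1
  change Submodule.map X.subtype (Submodule.comap X.subtype _) =
    _ • Submodule.map X.subtype (Submodule.comap X.subtype _) at h1
  rw [Submodule.map_comap_subtype, Submodule.map_comap_subtype, inf_eq_right.2 (hsub _),
    inf_eq_right.2 (hsub _)] at h1
  rw [add_right_comm]
  exact h1

lemma sup_pow_le {P Q T : Ideal A} (hP : P ≤ T) (hQ : Q ≤ T) (n m : ℕ) :
    (P ⊔ Q) ^ (n + m) ≤ P ^ n * T ^ m ⊔ Q ^ m * T ^ n := by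
  rw [← Ideal.add_eq_sup, add_pow, Ideal.sum_eq_sup, Finset.sup_le_iff]
  intro i hi
  refine Ideal.mul_le_left.trans ?_
  rw [Finset.mem_range] at hi
  rcases le_total n i with h | h
  · refine le_trans ?_ le_sup_left
    calc P ^ i * Q ^ (n + m - i) = P ^ n * (P ^ (i - n) * Q ^ (n + m - i)) := by
          rw [← mul_assoc, ← pow_add, Nat.add_sub_cancel' h]
      _ ≤ P ^ n * (T ^ (i - n) * T ^ (n + m - i)) :=
          Ideal.mul_mono_right (Ideal.mul_mono (Ideal.pow_right_mono hP _)
            (Ideal.pow_right_mono hQ _))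
      _ = P ^ n * T ^ m := by rw [← pow_add]; congr 2; omega
  · refine le_trans ?_ le_sup_right
    calc P ^ i * Q ^ (n + m - i) = Q ^ m * (P ^ i * Q ^ (n - i)) := by
          rw [mul_left_comm, ← pow_add]; congr 2; omega
      _ ≤ Q ^ m * (T ^ i * T ^ (n - i)) :=
          Ideal.mul_mono_right (Ideal.mul_mono (Ideal.pow_right_mono hP _)
            (Ideal.pow_right_mono hQ _))
      _ = Q ^ m * T ^ n := by rw [← pow_add, Nat.add_sub_cancel' h]

/-- If a finitely generated module `X` is contained in `Y` after extension to every chart of the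
blowup of `I`, then `I^m X ≤ I^m Y` for some `m`. -/
lemma exists_pow_smul_le {I : Ideal A} (hI : I.FG) {X Y : Submodule A K} (hX : X.FG)
    (H : ∀ f ∈ I, ∀ x ∈ X, ∃ n, f ^ n • x ∈ I ^ n • Y) : ∃ m, I ^ m • X ≤ I ^ m • Y := by
  have step : ∀ x ∈ X, ∃ m, I ^ m • Submodule.span A {x} ≤ I ^ m • Y := by
    intro x hx
    obtain ⟨S, hS⟩ := hI
    suffices H' : ∀ T : Finset A, (T : Set A) ⊆ I →
        ∃ m, Ideal.span (T : Set A) ^ m • Submodule.span A {x} ≤ I ^ m • Y by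
      have := H' S (by rw [← hS]; exact Submodule.subset_span)
      rwa [show Ideal.span (S : Set A) = I from hS] at this
    intro T
    induction T using Finset.cons_induction with
    | empty =>
      intro _
      exact ⟨1, by simp⟩
    | cons f T hf ih =>
      intro hT
      rw [Finset.coe_cons, Set.insert_subset_iff] at hT
      obtain ⟨m, hm⟩ := ih hT.2
      obtain ⟨n, hn⟩ := H f hT.1 x hx
      refine ⟨n + m, ?_⟩
      rw [Finset.coe_cons, Ideal.span_insert]
      have h1 : Ideal.span {f} ^ n • Submodule.span A {x} ≤ I ^ n • Y := by
        rw [Ideal.span_singleton_pow, Submodule.ideal_span_singleton_smul]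
        rintro _ ⟨y, hy, rfl⟩
        obtain ⟨a, rfl⟩ := Submodule.mem_span_singleton.1 hy
        change f ^ n • a • x ∈ _
        rw [smul_comm]
        exact Submodule.smul_mem _ _ hn
      refine (Submodule.smul_mono_left (sup_pow_le ((Ideal.span_singleton_le_iff_mem _).2 hT.1)
        (Ideal.span_le.2 hT.2) n m)).trans ?_
      rw [Submodule.sup_smul]
      refine sup_le ?_ ?_
      · rw [mul_comm, mul_smul, add_comm, pow_add, mul_smul]
        exact Submodule.smul_mono le_rfl h1
      · rw [mul_comm, mul_smul, pow_add, mul_smul]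
        exact Submodule.smul_mono le_rfl hm
  obtain ⟨S, rfl⟩ := hX
  suffices H' : ∀ T : Finset K, T ⊆ S → ∃ m, I ^ m • Submodule.span A (T : Set K) ≤ I ^ m • Y from
    H' S subset_rfl
  intro T
  induction T using Finset.cons_induction with
  | empty => exact fun _ => ⟨0, by simp⟩
  | cons x T hx ih =>
    intro hT
    obtain ⟨m, hm⟩ := ih fun y hy => hT (by simp [hy])
    obtain ⟨n, hn⟩ := step x (Submodule.subset_span (hT (by simp)))
    refine ⟨n + m, ?_⟩
    rw [Finset.coe_cons, Submodule.span_insert, Submodule.smul_sup]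
    refine sup_le ?_ ?_
    · rw [add_comm, pow_add, mul_smul, mul_smul]
      exact Submodule.smul_mono le_rfl hn
    · rw [pow_add, mul_smul, mul_smul]
      exact Submodule.smul_mono le_rfl hm

/-- If the equation holds for all powers of `I` on the blowup of `I`, then it holds downstairs for
all large powers of `I`. -/
lemma exists_forall_ge_gaussEquation [IsNoetherianRing A] (hA : ∀ n : ℕ, n ≠ 0 → IsUnit (n : A))
    (hE : ∃ E : Submodule A K, E.FG ∧ ∀ i a, δ i (algebraMap A K a) ∈ E) (I : Ideal A)
    (H : ∀ n ≠ 0, ∀ f ∈ I, ∀ x ∈ gaussF δ (I ^ n • gaussF δ (I ^ n • (1 : Submodule A K))),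
      ∃ m, f ^ m • x ∈ I ^ m • gaussF δ (I ^ n • (1 : Submodule A K)) ^ (r + 2)) :
    ∃ n₀, ∀ n ≥ n₀, gaussF δ (I ^ n • gaussF δ (I ^ n • (1 : Submodule A K))) =
      gaussF δ (I ^ n • (1 : Submodule A K)) ^ (r + 2) := by
  have h1fg : (1 : Submodule A K).FG := by
    rw [Submodule.one_eq_span]; exact Submodule.fg_span_singleton _
  have hIfg : ∀ n, (I ^ n).FG := fun n => IsNoetherian.noetherian _
  have hFfg : ∀ {Q : Submodule A K}, Q.FG → (gaussF δ (I • Q)).FG := by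
    intro Q hQ
    obtain ⟨X, hX, hFX⟩ := exists_gaussF_le_pow_smul δ hE I hQ
    have := hFX 0
    rw [pow_zero, one_smul, zero_add, pow_one] at this
    have hn := isNoetherian_of_fg_of_noetherian X hX
    exact Submodule.FG.of_le hX this
  obtain ⟨a, ha⟩ := exists_gaussF_pow_smul_eq δ hA hE I (h1fg.smul (hIfg 1))
  replace ha : ∀ n, gaussF δ (I ^ (a + 1 + n) • (1 : Submodule A K)) =
      I ^ ((r + 1) * n) • gaussF δ (I ^ (a + 1) • (1 : Submodule A K)) := by
    intro n
    have := ha n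
    rw [← mul_smul, ← mul_smul, ← pow_add, ← pow_add, ← pow_mul] at this
    rw [add_right_comm]
    exact this
  set Q := gaussF δ (I ^ (a + 1) • (1 : Submodule A K)) with hQ
  have hQfg : Q.FG := by
    rw [hQ, pow_succ', mul_smul]
    exact hFfg (h1fg.smul (hIfg a))
  obtain ⟨c, hc⟩ := exists_gaussF_pow_smul_eq δ hA hE I (hQfg.smul (hIfg (a + 1)))
  -- the exponent from which both sides are multiplied by `I^{(r+1)(r+2)}` in each step
  set e := a + 1 + c with he
  have hY : ∀ j, gaussF δ (I ^ (e + j) • (1 : Submodule A K)) ^ (r + 2) =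
      I ^ ((r + 1) * (r + 2) * j) • gaussF δ (I ^ e • (1 : Submodule A K)) ^ (r + 2) := by
    intro j
    rw [he, add_assoc, ha, ha, ideal_smul_pow, ideal_smul_pow, ← mul_smul, ← pow_mul, ← pow_mul,
      ← pow_add]
    congr 2
    ring
  have hX : ∀ j, gaussF δ (I ^ (e + j) • gaussF δ (I ^ (e + j) • (1 : Submodule A K))) =
      I ^ ((r + 1) * (r + 2) * j) • gaussF δ (I ^ e • gaussF δ (I ^ e • (1 : Submodule A K))) := by
    obtain ⟨Z, h1⟩ : ∃ Z, ∀ j, gaussF δ (I ^ (e + j) • gaussF δ (I ^ (e + j) •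
        (1 : Submodule A K))) = (I ^ (r + 1)) ^ ((r + 1) * c + (r + 2) * j) • Z := by
      refine ⟨gaussF δ (I ^ c • I ^ (a + 1) • Q), fun j => ?_⟩
      rw [← hc, he, add_assoc (a + 1) c j, ha, ← mul_smul, ← mul_smul, ← pow_add, ← pow_add]
      congr 3
      ring
    intro j
    have h0 := h1 0
    rw [add_zero] at h0
    rw [h1, h0, ← mul_smul, ← pow_mul, ← pow_mul, ← pow_add]
    congr 2
    ring
  have hle : ∀ n, gaussF δ (I ^ n • (1 : Submodule A K)) ^ (r + 2) ≤
      gaussF δ (I ^ n • gaussF δ (I ^ n • (1 : Submodule A K))) := by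
    intro n
    have h1 := pow_mul_gaussF_le δ hA (gaussF δ (I ^ n • (1 : Submodule A K)))
      (I ^ n • (1 : Submodule A K))
    rw [← pow_succ, mul_comm, ideal_smul_eq_map_mul (I ^ n) 1, mul_one,
      ← ideal_smul_eq_map_mul] at h1
    rwa [ideal_smul_eq_map_mul (I ^ n) 1, mul_one]
  have hXfg : (gaussF δ (I ^ e • gaussF δ (I ^ e • (1 : Submodule A K)))).FG := by
    have h1 : e = (a + c) + 1 := by omega
    rw [h1, pow_succ', mul_smul]
    refine hFfg (Submodule.FG.smul (hIfg _) ?_)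
    rw [mul_smul]
    exact hFfg (h1fg.smul (hIfg _))
  obtain ⟨m, hm⟩ := exists_pow_smul_le (by simpa using hIfg 1) hXfg
    (H e (by omega))
  refine ⟨e + m, fun n hn => le_antisymm ?_ (hle n)⟩
  obtain ⟨j, rfl⟩ := Nat.exists_eq_add_of_le hn
  rw [add_assoc, hX, hY]
  obtain ⟨l, hl⟩ := Nat.exists_eq_add_of_le
    ((Nat.le_add_right m j).trans (Nat.le_mul_of_pos_left (m + j)
      (by positivity : 0 < (r + 1) * (r + 2))))
  rw [hl, add_comm, pow_add, mul_smul, mul_smul]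
  exact Submodule.smul_mono le_rfl hm

end Stability

/-! ### Gluing spectra of subrings of a field -/

section Gluing

variable {K : Type u} [Field K]

/-- `B'` is the localization of the subring `B` away from one nonzero element. -/
def IsAway (B' B : Subring K) : Prop :=
  ∃ s ∈ B, s ≠ 0 ∧ B ≤ B' ∧ s⁻¹ ∈ B' ∧ ∀ x ∈ B', ∃ n : ℕ, s ^ n * x ∈ B

lemma IsAway.le {B' B : Subring K} (h : IsAway B' B) : B ≤ B' := h.choose_spec.2.2.1

lemma IsAway.refl (B : Subring K) : IsAway B B :=
  ⟨1, B.one_mem, one_ne_zero, le_rfl, by simp, fun x hx => ⟨0, by simpa using hx⟩⟩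

lemma IsAway.trans {B B' B'' : Subring K} (h' : IsAway B'' B') (h : IsAway B' B) :
    IsAway B'' B := by
  obtain ⟨s, hs, hs0, hB, hsi, hs'⟩ := h
  obtain ⟨t, ht, ht0, hB', hti, ht'⟩ := h'
  obtain ⟨n, hn⟩ := hs' t ht
  refine ⟨s ^ (n + 1) * t, ?_, mul_ne_zero (pow_ne_zero _ hs0) ht0, hB.trans hB', ?_, ?_⟩
  · rw [pow_succ', mul_assoc]; exact B.mul_mem hs hn
  · rw [mul_inv, ← inv_pow]
    exact B''.mul_mem (B''.pow_mem (hB' hsi) _) hti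
  · intro x hx
    obtain ⟨m, hm⟩ := ht' x hx
    obtain ⟨k, hk⟩ := hs' _ hm
    refine ⟨m + k, ?_⟩
    have : (s ^ (n + 1) * t) ^ (m + k) * x =
        s ^ (n * m + m) * (s ^ n * t) ^ k * (s ^ k * (t ^ m * x)) := by ring
    rw [this]
    exact B.mul_mem (B.mul_mem (B.pow_mem hs _) (B.pow_mem hn _)) hk

/-- The localization of a subring of a field away from an element. -/
def away (B : Subring K) (s : B) : Subring K where
  carrier := {x | ∃ n : ℕ, (s : K) ^ n * x ∈ B}
  mul_mem' := by
    rintro x y ⟨n, hn⟩ ⟨m, hm⟩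
    refine ⟨n + m, ?_⟩
    have : (s : K) ^ (n + m) * (x * y) = (s ^ n * x) * (s ^ m * y) := by ring
    rw [this]; exact B.mul_mem hn hm
  one_mem' := ⟨0, by simp⟩
  add_mem' := by
    rintro x y ⟨n, hn⟩ ⟨m, hm⟩
    refine ⟨n + m, ?_⟩
    have : (s : K) ^ (n + m) * (x + y) = s ^ m * (s ^ n * x) + s ^ n * (s ^ m * y) := by ring
    rw [this]
    exact B.add_mem (B.mul_mem (B.pow_mem s.2 _) hn) (B.mul_mem (B.pow_mem s.2 _) hm)
  zero_mem' := ⟨0, by simp⟩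
  neg_mem' := by
    rintro x ⟨n, hn⟩
    exact ⟨n, by rw [mul_neg]; exact B.neg_mem hn⟩

lemma le_away (B : Subring K) (s : B) : B ≤ away B s := fun x hx => ⟨0, by simpa using hx⟩

lemma inv_mem_away (B : Subring K) (s : B) (hs : (s : K) ≠ 0) : (s : K)⁻¹ ∈ away B s :=
  ⟨1, by rw [pow_one, mul_inv_cancel₀ hs]; exact B.one_mem⟩

lemma isAway_away (B : Subring K) (s : B) (hs : (s : K) ≠ 0) : IsAway (away B s) B :=
  ⟨s, s.2, hs, le_away B s, inv_mem_away B s hs, fun _ hx => hx⟩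

lemma away_le {B B' : Subring K} (s : B) (hs : (s : K) ≠ 0) (h : B ≤ B') (hi : (s : K)⁻¹ ∈ B') :
    away B s ≤ B' := by
  rintro x ⟨n, hn⟩
  have : x = (s : K)⁻¹ ^ n * (s ^ n * x) := by
    rw [← mul_assoc, ← mul_pow, inv_mul_cancel₀ hs, one_pow, one_mul]
  rw [this]
  exact B'.mul_mem (B'.pow_mem hi _) (h hn)

lemma isAway_away_mul {A B : Subring K} (s t : A) (hs0 : (s : K) ≠ 0) (ht0 : (t : K) ≠ 0)
    (hB : A ≤ B) (hsi : (s : K)⁻¹ ∈ B) (h : ∀ x ∈ B, ∃ n : ℕ, (s : K) ^ n * x ∈ A) :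
    IsAway (away A (s * t)) B := by
  have hst0 : ((s * t : A) : K) ≠ 0 := mul_ne_zero hs0 ht0
  set D := away A (s * t)
  have hAD : A ≤ D := le_away A (s * t)
  have hi : ((s * t : A) : K)⁻¹ ∈ D := inv_mem_away A (s * t) hst0
  have hsD : (s : K)⁻¹ ∈ D := by
    have := D.mul_mem hi (hAD t.2)
    rwa [Subring.coe_mul, mul_inv, mul_assoc, inv_mul_cancel₀ ht0, mul_one] at this
  have htD : (t : K)⁻¹ ∈ D := by
    have := D.mul_mem hi (hAD s.2)
    rwa [Subring.coe_mul, mul_inv, mul_comm (s : K)⁻¹, mul_assoc, inv_mul_cancel₀ hs0,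
      mul_one] at this
  refine ⟨t, hB t.2, ht0, fun x hx => ?_, htD, ?_⟩
  · obtain ⟨n, hn⟩ := h x hx
    have : x = (s : K)⁻¹ ^ n * (s ^ n * x) := by
      rw [← mul_assoc, ← mul_pow, inv_mul_cancel₀ hs0, one_pow, one_mul]
    rw [this]
    exact D.mul_mem (D.pow_mem hsD _) (hAD hn)
  · rintro x ⟨n, hn⟩
    refine ⟨n, ?_⟩
    have : (t : K) ^ n * x = (s : K)⁻¹ ^ n * (((s * t : A) : K) ^ n * x) := by
      rw [Subring.coe_mul, mul_pow, ← mul_assoc, ← mul_assoc, ← mul_pow, inv_mul_cancel₀ hs0,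
        one_pow, one_mul]
    rw [this]
    exact B.mul_mem (B.pow_mem hsi _) (hB hn)

lemma IsAway.exists_common {A B C : Subring K} (hB : IsAway B A) (hC : IsAway C A) :
    ∃ D, IsAway D B ∧ IsAway D C := by
  obtain ⟨s, hs, hs0, hB, hsi, hs'⟩ := hB
  obtain ⟨t, ht, ht0, hC, hti, ht'⟩ := hC
  refine ⟨_, isAway_away_mul ⟨s, hs⟩ ⟨t, ht⟩ hs0 ht0 hB hsi hs', ?_⟩
  rw [mul_comm]
  exact isAway_away_mul ⟨t, ht⟩ ⟨s, hs⟩ ht0 hs0 hC hti ht'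

lemma isLocalization_of_isAway {B B' : Subring K} (s : B) (hs0 : (s : K) ≠ 0) (hB : B ≤ B')
    (hsi : (s : K)⁻¹ ∈ B') (h : ∀ x ∈ B', ∃ n : ℕ, (s : K) ^ n * x ∈ B) :
    @IsLocalization.Away B _ s B' _ (Subring.inclusion hB).toAlgebra := by
  let _ := (Subring.inclusion hB).toAlgebra
  refine ⟨?_, ?_, ?_⟩
  · rintro ⟨_, n, rfl⟩
    rw [map_pow]
    refine IsUnit.pow n (IsUnit.of_mul_eq_one ⟨_, hsi⟩ ?_)
    exact Subtype.ext (mul_inv_cancel₀ hs0)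
  · rintro ⟨x, hx⟩
    obtain ⟨n, hn⟩ := h x hx
    exact ⟨(⟨_, hn⟩, ⟨_, n, rfl⟩), Subtype.ext (mul_comm _ _)⟩
  · intro x y hxy
    refine ⟨1, ?_⟩
    rw [show x = y from Subtype.ext (congrArg (fun z : B' => (z : K)) hxy)]

/-- The morphism of spectra given by an inclusion of subrings. -/
def specInclusion {B B' : Subring K} (h : B ≤ B') : Spec (.of B') ⟶ Spec (.of B) :=
  Spec.map (CommRingCat.ofHom (Subring.inclusion h))

/-- The generic point of the spectrum of a subring of `K`, as a `K`-valued point. -/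
def specSubtype (B : Subring K) : Spec (.of K) ⟶ Spec (.of B) :=
  Spec.map (CommRingCat.ofHom B.subtype)

lemma specSubtype_specInclusion {B B' : Subring K} (h : B ≤ B') :
    specSubtype B' ≫ specInclusion h = specSubtype B := by
  rw [specSubtype, specInclusion, ← Spec.map_comp]; rfl

lemma specInclusion_comp {B B' B'' : Subring K} (h : B ≤ B') (h' : B' ≤ B'') :
    specInclusion h' ≫ specInclusion h = specInclusion (h.trans h') := by
  rw [specInclusion, specInclusion, ← Spec.map_comp]; rfl

lemma specInclusion_apply {B B' B'' : Subring K} (h : B ≤ B') (h' : B' ≤ B'')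
    (z : Spec (.of B'')) : specInclusion h (specInclusion h' z) = specInclusion (h.trans h') z := by
  rw [← specInclusion_comp h h', Scheme.Hom.comp_apply]

lemma specInclusion_refl (B : Subring K) : specInclusion (le_refl B) = 𝟙 _ := by
  rw [specInclusion]; exact Spec.map_id _

lemma isOpenImmersion_specInclusion {B B' : Subring K} (h : IsAway B' B) :
    IsOpenImmersion (specInclusion h.le) := by
  obtain ⟨s, hs, hs0, hB, hsi, hs'⟩ := h
  let _ := (Subring.inclusion hB).toAlgebra
  have := isLocalization_of_isAway ⟨s, hs⟩ hs0 hB hsi hs'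
  exact IsOpenImmersion.of_isLocalization (S := B') (⟨s, hs⟩ : B)

lemma specInclusion_injective {B B' : Subring K} (h : IsAway B' B) :
    Function.Injective (specInclusion h.le) :=
  have := isOpenImmersion_specInclusion h
  (specInclusion h.le).isOpenEmbedding.injective

lemma mem_range_specInclusion {B B' : Subring K} (s : B) (hs0 : (s : K) ≠ 0) (hB : B ≤ B')
    (hsi : (s : K)⁻¹ ∈ B') (h : ∀ x ∈ B', ∃ n : ℕ, (s : K) ^ n * x ∈ B) (p : Spec (.of B)) :
    p ∈ Set.range (specInclusion hB) ↔ s ∉ p.asIdeal := by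
  let _ := (Subring.inclusion hB).toAlgebra
  have := isLocalization_of_isAway s hs0 hB hsi h
  have h1 := PrimeSpectrum.localization_away_comap_range B' s
  exact iff_of_eq (congrArg (p ∈ ·) h1)

/-- A subring belonging to a given family. -/
structure SubringOf (𝓑 : Set (Subring K)) where
  /-- The underlying subring. -/
  ring : Subring K
  mem : ring ∈ 𝓑

variable {𝓑 : Set (Subring K)}

/-- A localization is smaller: its spectrum is an open subscheme. -/
instance : Preorder (SubringOf 𝓑) where
  le B B' := IsAway B.ring B'.ring
  le_refl B := IsAway.refl B.ring
  le_trans _ _ _ h h' := h.trans h'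

variable (𝓑) in
/-- The diagram of the spectra of the members of a family of subrings, with the open immersions
given by localizations. -/
def specFunctor : SubringOf 𝓑 ⥤ Scheme.{u} where
  obj B := Spec (.of B.ring)
  map f := specInclusion (IsAway.le f.le)
  map_id B := specInclusion_refl B.ring
  map_comp _ _ := (specInclusion_comp _ _).symm

instance {B B' : SubringOf 𝓑} (f : B ⟶ B') : IsOpenImmersion ((specFunctor 𝓑).map f) :=
  isOpenImmersion_specInclusion f.le

/-- If two localizations of `B` have spectra that meet in a point of `Spec B`, then this point lies on
the spectrum of a third localization, contained in both. -/
lemma isLocallyDirected_specFunctor (h𝓑 : ∀ B ∈ 𝓑, ∀ B', IsAway B' B → B' ∈ 𝓑) :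
    (specFunctor 𝓑 ⋙ Scheme.forget).IsLocallyDirected := by
  constructor
  intro i j k fi fj xi xj hx
  obtain ⟨s, hs, hs0, hB, hsi, hs'⟩ := id fi.le
  obtain ⟨t, ht, ht0, hC, hti, ht'⟩ := id fj.le
  have hst0 : ((⟨s * t, k.ring.mul_mem hs ht⟩ : k.ring) : K) ≠ 0 := mul_ne_zero hs0 ht0
  have hD := isAway_away k.ring ⟨s * t, k.ring.mul_mem hs ht⟩ hst0
  have hiD := isAway_away_mul ⟨s, hs⟩ ⟨t, ht⟩ hs0 ht0 hB hsi hs'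
  have hjD := isAway_away_mul ⟨t, ht⟩ ⟨s, hs⟩ ht0 hs0 hC hti ht'
  rw [mul_comm] at hjD
  set D := away k.ring ⟨s * t, k.ring.mul_mem hs ht⟩ with hDdef
  let l : SubringOf 𝓑 := ⟨D, h𝓑 _ k.mem _ hD⟩
  let fli : l ⟶ i := homOfLE hiD
  let flj : l ⟶ j := homOfLE hjD
  set y : Spec (.of k.ring) := (specFunctor 𝓑).map fi xi with hy
  have hsy : (⟨s, hs⟩ : k.ring) ∉ y.asIdeal :=
    (mem_range_specInclusion ⟨s, hs⟩ hs0 hB hsi hs' y).1 ⟨xi, rfl⟩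
  have hty : (⟨t, ht⟩ : k.ring) ∉ y.asIdeal :=
    (mem_range_specInclusion ⟨t, ht⟩ ht0 hC hti ht' y).1 ⟨xj, hx.symm⟩
  obtain ⟨z, hz⟩ := (mem_range_specInclusion ⟨s * t, k.ring.mul_mem hs ht⟩ hst0 hD.le
    (inv_mem_away _ _ hst0) (fun _ h => h) y).2 fun h => by
      rcases y.isPrime.mem_or_mem (x := ⟨s, hs⟩) (y := ⟨t, ht⟩) h with h | h
      exacts [hsy h, hty h]
  refine ⟨l, fli, flj, z, ?_, ?_⟩
  · refine specInclusion_injective fi.le ?_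
    exact (specInclusion_apply hB hiD.le z).trans hz
  · refine specInclusion_injective fj.le ?_
    exact ((specInclusion_apply hC hjD.le z).trans hz).trans hx

instance isDominant_specSubtype (B : Subring K) : IsDominant (specSubtype B) := by
  constructor
  have : (specSubtype B) (⊥ : PrimeSpectrum K) = (⊥ : PrimeSpectrum B) := by
    refine PrimeSpectrum.ext ?_
    ext x
    change B.subtype x ∈ (⊥ : Ideal K) ↔ x ∈ (⊥ : Ideal B)
    simp
  refine Dense.mono (Set.singleton_subset_iff.2 ⟨_, this⟩) ?_
  have h2 : closure {(⊥ : PrimeSpectrum B)} = Set.univ := by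
    rw [PrimeSpectrum.closure_singleton]
    exact PrimeSpectrum.zeroLocus_singleton_zero
  exact dense_iff_closure_eq.2 h2

/-- The result of gluing the spectra of a family of subrings of `K` along localizations. -/
structure SubringModel (𝓑 : Set (Subring K)) (V : Scheme.{u}) (η : Spec (.of K) ⟶ V) where
  /-- The glued scheme. -/
  W : Scheme.{u}
  /-- The structure morphism. -/
  π : W ⟶ V
  /-- The charts. -/
  ι : ∀ B ∈ 𝓑, Spec (.of B) ⟶ W
  isOpenImmersion : ∀ B hB, IsOpenImmersion (ι B hB)
  exists_eq : ∀ w : W, ∃ B hB p, ι B hB p = w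
  comp : ∀ B hB B' hB' (h : IsAway B' B), specInclusion h.le ≫ ι B hB = ι B' hB'
  generic : ∀ B hB, specSubtype B ≫ ι B hB ≫ π = η

attribute [instance] SubringModel.isOpenImmersion

/-- The spectra of a family of subrings, stable under localization away from an element, glue to a
scheme over `V`, if they have centers on the separated scheme `V`. -/
lemma nonempty_subringModel (h𝓑 : ∀ B ∈ 𝓑, ∀ B', IsAway B' B → B' ∈ 𝓑) {V : Scheme.{u}}
    [V.IsSeparated] (η : Spec (.of K) ⟶ V)
    (hη : ∀ B ∈ 𝓑, ∃ m : Spec (.of B) ⟶ V, specSubtype B ≫ m = η) :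
    Nonempty (SubringModel 𝓑 V η) := by
  have := isLocallyDirected_specFunctor h𝓑
  choose m hm using hη
  let c : Limits.Cocone (specFunctor 𝓑) :=
    { pt := V
      ι :=
        { app := fun B => m B.ring B.mem
          naturality := fun B B' f => by
            have h1 : specInclusion (IsAway.le f.le) ≫ m B'.ring B'.mem = m B.ring B.mem := by
              refine ext_of_isDominant (specSubtype B.ring) ?_
              rw [← Category.assoc, specSubtype_specInclusion, hm, hm]
            exact h1.trans (Category.comp_id _).symm } }
  exact ⟨{
    W := Limits.colimit (specFunctor 𝓑)
    π := Limits.colimit.desc _ c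
    ι := fun B hB => Limits.colimit.ι (specFunctor 𝓑) ⟨B, hB⟩
    isOpenImmersion := fun B hB =>
      inferInstanceAs (IsOpenImmersion (Limits.colimit.ι (specFunctor 𝓑) ⟨B, hB⟩))
    exists_eq := fun w => by
      obtain ⟨i, x, hx⟩ := Scheme.IsLocallyDirected.ι_jointly_surjective (specFunctor 𝓑) w
      exact ⟨i.ring, i.mem, x, hx⟩
    comp := fun B hB B' hB' h =>
      let f : (⟨B', hB'⟩ : SubringOf 𝓑) ⟶ ⟨B, hB⟩ := homOfLE h
      Limits.colimit.w (specFunctor 𝓑) f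
    generic := fun B hB =>
      (congrArg (specSubtype B ≫ ·) (Limits.colimit.ι_desc c ⟨B, hB⟩)).trans (hm B hB) }⟩

namespace SubringModel

variable {V : Scheme.{u}} {η : Spec (.of K) ⟶ V} (X : SubringModel 𝓑 V η)

/-- The charts share their generic point, so that the gluing is irreducible. -/
lemma isIntegral (hne : 𝓑.Nonempty)
    (hdir : ∀ B ∈ 𝓑, ∀ B' ∈ 𝓑, ∃ D ∈ 𝓑, IsAway D B ∧ IsAway D B') : IsIntegral X.W := by
  have hgen : ∀ B hB B' hB', specSubtype B ≫ X.ι B hB = specSubtype B' ≫ X.ι B' hB' := by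
    intro B hB B' hB'
    obtain ⟨D, hD, h, h'⟩ := hdir B hB B' hB'
    rw [← specSubtype_specInclusion h.le, ← specSubtype_specInclusion h'.le, Category.assoc,
      Category.assoc, X.comp B hB D hD h, X.comp B' hB' D hD h']
  obtain ⟨B₀, hB₀⟩ := hne
  have hred : IsReduced X.W := by
    have : ∀ w : X.W, _root_.IsReduced (X.W.presheaf.stalk w) := by
      intro w
      obtain ⟨B, hB, p, rfl⟩ := X.exists_eq w
      have : IsIso ((X.ι B hB).stalkMap p) := inferInstance
      exact isReduced_of_injective ((X.ι B hB).stalkMap p).hom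
        (ConcreteCategory.bijective_of_isIso ((X.ι B hB).stalkMap p)).1
    exact isReduced_of_isReduced_stalk X.W
  have hirr : IrreducibleSpace X.W := by
    let g : X.W := (specSubtype B₀ ≫ X.ι B₀ hB₀) (⊥ : PrimeSpectrum K)
    have hg : closure {g} = Set.univ := by
      refine Set.eq_univ_of_forall fun w => ?_
      obtain ⟨B, hB, p, rfl⟩ := X.exists_eq w
      have h1 : g ∈ Set.range (specSubtype B ≫ X.ι B hB) := by
        rw [hgen B hB B₀ hB₀]; exact ⟨_, rfl⟩
      obtain ⟨q, hq⟩ := h1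
      have h2 : p ∈ closure (Set.range (specSubtype B)) :=
        (isDominant_specSubtype B).1.closure_range ▸ Set.mem_univ p
      have h3 := image_closure_subset_closure_image (X.ι B hB).continuous ⟨p, h2, rfl⟩
      refine closure_mono ?_ h3
      rintro _ ⟨_, ⟨q', rfl⟩, rfl⟩
      have : Subsingleton (PrimeSpectrum K) := inferInstance
      rw [Set.mem_singleton_iff, ← hq, Scheme.Hom.comp_apply,
        show q' = q from Subsingleton.elim (α := PrimeSpectrum K) _ _]
    have h4 : IsIrreducible (Set.univ : Set X.W) := hg ▸ isIrreducible_singleton.closure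
    exact { isPreirreducible_univ := h4.2, toNonempty := ⟨g⟩ }
  exact isIntegral_of_irreducibleSpace_of_isReduced X.W

end SubringModel

end Gluing

/-! ### Function fields -/

section FunctionField

variable {V W T : Scheme.{u}} [IsIntegral V] [IsIntegral W] [IsIntegral T]

lemma functionFieldMap_algebraMap (π : W ⟶ V) [IsDominant π] (w : W)
    (a : V.presheaf.stalk (π w)) :
    functionFieldMap π (algebraMap _ V.functionField a) =
      algebraMap _ W.functionField (π.stalkMap w a) := by
  have h := Scheme.Hom.stalkSpecializes_stalkMap_apply π (genericPoint W) w
    ((genericPoint_spec W).specializes trivial) a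
  refine Eq.trans ?_ h
  change π.stalkMap (genericPoint W) ((V.presheaf.stalkSpecializes _ ≫
    V.presheaf.stalkSpecializes _) a) = _
  rw [TopCat.Presheaf.stalkSpecializes_comp]

lemma functionFieldMap_congr {π π' : W ⟶ V} [IsDominant π] [IsDominant π'] (h : π = π') :
    functionFieldMap π = functionFieldMap π' := by subst h; rfl

lemma functionFieldMap_comp (h : T ⟶ W) [IsDominant h] (π : W ⟶ V) [IsDominant π] :
    functionFieldMap (h ≫ π) = (functionFieldMap h).comp (functionFieldMap π) := by
  have key : ∀ a : V.presheaf.stalk ((h ≫ π) (genericPoint T)),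
      functionFieldMap (h ≫ π) (algebraMap _ V.functionField a) =
        functionFieldMap h (functionFieldMap π (algebraMap _ V.functionField a)) := by
    intro a
    rw [functionFieldMap_algebraMap]
    refine Eq.trans ?_ (congrArg _ (functionFieldMap_algebraMap π (h (genericPoint T)) a).symm)
    rw [functionFieldMap_algebraMap, Scheme.Hom.stalkMap_comp]
    rfl
  ext x
  obtain ⟨a, b, hb, rfl⟩ := IsFractionRing.div_surjective
    (A := V.presheaf.stalk ((h ≫ π) (genericPoint T))) x
  rw [RingHom.comp_apply, map_div₀, map_div₀, map_div₀, key, key]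

lemma functionFieldMap_germ (π : W ⟶ V) [IsDominant π] (U : V.Opens) [Nonempty U]
    (U' : W.Opens) [Nonempty U'] (e : U' ≤ π ⁻¹ᵁ U) (a : Γ(V, U)) :
    functionFieldMap π (algebraMap _ V.functionField a) =
      algebraMap _ W.functionField (π.appLE U U' e a) := by
  obtain ⟨w, hw⟩ := (inferInstance : Nonempty U')
  have h1 : algebraMap _ V.functionField a =
      algebraMap _ V.functionField (V.presheaf.germ U (π w) (e hw) a) :=
    (Scheme.algebraMap_germ_eq_germToFunctionField V (e hw) a).symm
  have h2 : algebraMap _ W.functionField (π.appLE U U' e a) =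
      algebraMap _ W.functionField (W.presheaf.germ U' w hw (π.appLE U U' e a)) :=
    (Scheme.algebraMap_germ_eq_germToFunctionField W hw _).symm
  rw [h1, h2, functionFieldMap_algebraMap]
  refine congrArg _ ((Scheme.Hom.germ_stalkMap_apply π U w (e hw) a).trans ?_)
  rw [Scheme.Hom.appLE]
  exact (W.presheaf.germ_res_apply (homOfLE e) w hw _).symm

lemma functionFieldMap_bijective_of_stalkMap (π : W ⟶ V) [IsDominant π] (w : W)
    (h : Function.Surjective (π.stalkMap w)) : Function.Bijective (functionFieldMap π) := by
  refine ⟨(functionFieldMap π).injective, fun x => ?_⟩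
  obtain ⟨a, b, hb, rfl⟩ := IsFractionRing.div_surjective (A := W.presheaf.stalk w) x
  obtain ⟨a, rfl⟩ := h a
  obtain ⟨b, rfl⟩ := h b
  exact ⟨algebraMap _ _ a / algebraMap _ _ b, by
    rw [map_div₀, functionFieldMap_algebraMap, functionFieldMap_algebraMap]⟩

lemma isDominant_of_isOpenImmersion (j : W ⟶ V) [IsOpenImmersion j] : IsDominant j := by
  refine ⟨?_⟩
  have h1 := (IsOpen.dense (X := V) j.isOpenEmbedding.isOpen_range
    ⟨_, ⟨genericPoint W, rfl⟩⟩)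
  exact h1

lemma functionFieldMap_bijective_of_isOpenImmersion (j : W ⟶ V) [IsOpenImmersion j]
    [IsDominant j] : Function.Bijective (functionFieldMap j) :=
  functionFieldMap_bijective_of_stalkMap j (genericPoint W)
    (ConcreteCategory.bijective_of_isIso (j.stalkMap (genericPoint W))).2

/-- The local ring of `W` at `w`, as a subring of the function field of `V`. -/
def locRing (π : W ⟶ V) [IsDominant π] (w : W) : Subring V.functionField :=
  (algebraMap (W.presheaf.stalk w) W.functionField).range.comap (functionFieldMap π)

lemma locRing_le_comp (h : T ⟶ W) [IsDominant h] (π : W ⟶ V) [IsDominant π] (t : T) :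
    locRing π (h t) ≤ locRing (h ≫ π) t := by
  rintro x ⟨a, ha⟩
  refine ⟨h.stalkMap t a, ?_⟩
  rw [← functionFieldMap_algebraMap, ha, functionFieldMap_comp]
  rfl

lemma locRing_isOpenImmersion (h : T ⟶ W) [IsDominant h] [IsOpenImmersion h] (π : W ⟶ V)
    [IsDominant π] (t : T) : locRing (h ≫ π) t = locRing π (h t) := by
  refine le_antisymm ?_ (locRing_le_comp h π t)
  rintro x ⟨a, ha⟩
  obtain ⟨b, rfl⟩ := (ConcreteCategory.bijective_of_isIso (h.stalkMap t)).2 a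
  refine ⟨b, (functionFieldMap h).injective ?_⟩
  rw [functionFieldMap_algebraMap, ha, functionFieldMap_comp]
  rfl

lemma stalkMap_range_le_locRing (π : W ⟶ V) [IsDominant π] (w : W) (a : V.presheaf.stalk (π w)) :
    algebraMap _ V.functionField a ∈ locRing π w :=
  ⟨π.stalkMap w a, (functionFieldMap_algebraMap π w a).symm⟩

lemma algebraMap_mem_locRing (π : W ⟶ V) [IsDominant π] (w : W) (U : V.Opens) [Nonempty U]
    (hU : π w ∈ U) (a : Γ(V, U)) : algebraMap _ V.functionField a ∈ locRing π w := by
  have : algebraMap _ V.functionField a =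
      algebraMap _ V.functionField (V.presheaf.germ U (π w) hU a) :=
    (Scheme.algebraMap_germ_eq_germToFunctionField V hU a).symm
  rw [this]
  exact stalkMap_range_le_locRing π w _

instance nonempty_top_opens (X : Scheme.{u}) [h : IrreducibleSpace X] :
    Nonempty (⊤ : X.Opens) :=
  h.toNonempty.map fun x => ⟨x, trivial⟩

/-- The inclusion of a domain in the function field of its spectrum. -/
def specFF (C : CommRingCat.{u}) [IsDomain C] : C →+* (Spec C).functionField :=
  (algebraMap Γ(Spec C, ⊤) (Spec C).functionField).comp (Scheme.ΓSpecIso C).inv.hom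

lemma specFF_apply (C : CommRingCat.{u}) [IsDomain C] (p : Spec C) (c : C) :
    specFF C c = algebraMap ((Spec C).presheaf.stalk p) (Spec C).functionField
      ((Spec C).presheaf.germ ⊤ p trivial ((Scheme.ΓSpecIso C).inv c)) :=
  (Scheme.algebraMap_germ_eq_germToFunctionField (Spec C) (U := ⊤) (x := p) trivial _).symm

lemma functionFieldMap_SpecMap {C D : CommRingCat.{u}} [IsDomain C] [IsDomain D] (f : C ⟶ D)
    [IsDominant (Spec.map f)] (c : C) :
    functionFieldMap (Spec.map f) (specFF C c) = specFF D (f c) := by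
  refine (functionFieldMap_germ (Spec.map f) ⊤ ⊤ le_top _).trans ?_
  refine congrArg (algebraMap Γ(Spec D, ⊤) (Spec D).functionField) ?_
  have h := congrArg (fun g => g.hom c) (Scheme.ΓSpecIso_inv_naturality f)
  simp only [CommRingCat.hom_comp, RingHom.comp_apply] at h
  rw [h, Scheme.Hom.appTop, Scheme.Hom.app_eq_appLE]
  rfl

lemma exists_stalk_Spec (C : CommRingCat.{u}) (p : PrimeSpectrum C) (y : (Spec C).presheaf.stalk p) :
    ∃ a s : C, s ∉ p.asIdeal ∧ y * (Spec C).presheaf.germ ⊤ p trivial ((Scheme.ΓSpecIso C).inv s) =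
      (Spec C).presheaf.germ ⊤ p trivial ((Scheme.ΓSpecIso C).inv a) := by
  obtain ⟨⟨a, s⟩, h⟩ := IsLocalization.surj (M := p.asIdeal.primeCompl)
    (S := (Spec.structureSheaf C).presheaf.stalk p) y
  exact ⟨a, s, s.2, h⟩

lemma isUnit_germ_Spec (C : CommRingCat.{u}) (p : PrimeSpectrum C) (s : C) (hs : s ∉ p.asIdeal) :
    IsUnit ((Spec C).presheaf.germ ⊤ p trivial ((Scheme.ΓSpecIso C).inv s)) :=
  IsLocalization.map_units (M := p.asIdeal.primeCompl)
    ((Spec.structureSheaf C).presheaf.stalk p) ⟨s, hs⟩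

lemma specFF_injective (C : CommRingCat.{u}) [IsDomain C] : Function.Injective (specFF C) := by
  refine Function.Injective.comp (g := algebraMap Γ(Spec C, ⊤) (Spec C).functionField) ?_ ?_
  · exact Scheme.germToFunctionField_injective (Spec C) ⊤
  · exact (ConcreteCategory.bijective_of_isIso (Scheme.ΓSpecIso C).inv).1

lemma mem_range_stalk_Spec (C : CommRingCat.{u}) [IsDomain C] (p : Spec C)
    (x : (Spec C).functionField) :
    x ∈ (algebraMap ((Spec C).presheaf.stalk p) (Spec C).functionField).range ↔
      ∃ a s : C, s ∉ p.asIdeal ∧ x * specFF C s = specFF C a := by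
  constructor
  · rintro ⟨y, rfl⟩
    obtain ⟨a, s, hs, h⟩ := exists_stalk_Spec C p y
    exact ⟨a, s, hs, by rw [specFF_apply C p, specFF_apply C p, ← h, map_mul]⟩
  · rintro ⟨a, s, hs, h⟩
    obtain ⟨u, hu⟩ := isUnit_germ_Spec C p s hs
    have hs0 : specFF C s ≠ 0 := fun h0 => hs (by
      rw [(map_eq_zero_iff _ (specFF_injective C)).1 h0]; exact p.asIdeal.zero_mem)
    refine ⟨↑u⁻¹ * (Spec C).presheaf.germ ⊤ p trivial ((Scheme.ΓSpecIso C).inv a), ?_⟩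
    refine mul_right_cancel₀ hs0 ?_
    rw [h, specFF_apply C p s, ← hu, ← map_mul, mul_comm, ← mul_assoc, Units.mul_inv, one_mul,
      specFF_apply C p a]

/-- The canonical morphism from the spectrum of the function field. -/
def genericMap (V : Scheme.{u}) [IsIntegral V] : Spec (.of V.functionField) ⟶ V :=
  V.fromSpecStalk (genericPoint V)

instance : IsDominant (genericMap V) := by
  constructor
  have h : genericPoint V ∈ Set.range (genericMap V) := by
    have : genericPoint V ∈ Set.range (V.fromSpecStalk (genericPoint V)) := by
      rw [Scheme.range_fromSpecStalk]; exact specializes_rfl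
    exact this
  refine Dense.mono (Set.singleton_subset_iff.2 h) ?_
  exact dense_iff_closure_eq.2 (genericPoint_closure (α := V))

lemma functionFieldMap_genericMap (x : V.functionField) :
    functionFieldMap (genericMap V) x = specFF (.of V.functionField) x := by
  obtain ⟨U, hU, a, rfl⟩ := V.presheaf.exists_germ_eq x
  have : Nonempty U := ⟨⟨_, hU⟩⟩
  have hle : (⊤ : (Spec (.of V.functionField)).Opens) ≤ genericMap V ⁻¹ᵁ U := by
    intro y _
    have : (genericMap V) y ∈ Set.range (V.fromSpecStalk (genericPoint V)) := ⟨y, rfl⟩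
    rw [Scheme.range_fromSpecStalk] at this
    exact this.mem_open U.2 hU
  refine (functionFieldMap_germ (genericMap V) U ⊤ hle a).trans ?_
  refine congrArg (algebraMap Γ(Spec (.of V.functionField), ⊤)
    (Spec (.of V.functionField)).functionField) ?_
  have hle' : (⊤ : (Spec (V.presheaf.stalk (genericPoint V))).Opens) ≤
    V.fromSpecStalk (genericPoint V) ⁻¹ᵁ U := hle
  have h : (V.fromSpecStalk (genericPoint V)).appLE U ⊤ hle' =
      V.presheaf.germ U (genericPoint V) hU ≫ (Scheme.ΓSpecIso _).inv := by
    rw [Scheme.Hom.appLE, Scheme.fromSpecStalk_app hU, Category.assoc, Category.assoc,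
      ← Functor.map_comp]
    have h2 : ((homOfLE le_top).op ≫ (homOfLE hle').op : Opposite.op (⊤ : (Spec (V.presheaf.stalk
      (genericPoint V))).Opens) ⟶ Opposite.op ⊤) = 𝟙 _ := Subsingleton.elim _ _
    rw [h2, CategoryTheory.Functor.map_id, Category.comp_id]
  exact congrArg (fun f => f.hom a) h

/-- For a subring `B` of the function field, on a chart compatible with the generic point. -/
lemma functionFieldMap_chart (B : Subring V.functionField) (m : Spec (.of B) ⟶ V) [IsDominant m]
    (hm : specSubtype B ≫ m = genericMap V) (b : B) :
    functionFieldMap m b = specFF (.of B) b := by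
  refine (functionFieldMap (specSubtype B)).injective ?_
  have h1 := functionFieldMap_congr hm
  rw [functionFieldMap_comp] at h1
  have h2 := congrArg (fun f => f (b : V.functionField)) h1
  refine h2.trans ?_
  rw [functionFieldMap_genericMap]
  have : IsDominant (Spec.map (CommRingCat.ofHom B.subtype)) := isDominant_specSubtype B
  exact (functionFieldMap_SpecMap (CommRingCat.ofHom B.subtype) b).symm

end FunctionField

/-! ### The charts of the blowup of a fractional ideal -/

section ChartRing

variable {A A' K : Type*} [CommRing A] [CommRing A'] [Field K] [Algebra A K] [Algebra A' K]

/-- The ring `A[M / f]` of the chart, given by `f`, of the blowup of the fractional ideal `M`. -/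
def chartRing (M : Submodule A K) (f : K) : Subring K :=
  (Algebra.adjoin A ((fun m => m / f) '' (M : Set K))).toSubring

lemma chartRing_le_iff {M : Submodule A K} {f : K} {R : Subring K} :
    chartRing M f ≤ R ↔ (algebraMap A K).range ≤ R ∧ ∀ m ∈ M, m / f ∈ R := by
  constructor
  · intro h
    refine ⟨?_, fun m hm => h (Algebra.subset_adjoin ⟨m, hm, rfl⟩)⟩
    rintro _ ⟨a, rfl⟩
    exact h ((Algebra.adjoin A _).algebraMap_mem a)
  · rintro ⟨h1, h2⟩ x (hx : x ∈ Algebra.adjoin A _)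
    induction hx using Algebra.adjoin_induction with
    | mem x hx => obtain ⟨m, hm, rfl⟩ := hx; exact h2 m hm
    | algebraMap a => exact h1 ⟨a, rfl⟩
    | add x y _ _ hx hy => exact R.add_mem hx hy
    | mul x y _ _ hx hy => exact R.mul_mem hx hy

lemma range_le_chartRing (M : Submodule A K) (f : K) : (algebraMap A K).range ≤ chartRing M f :=
  (chartRing_le_iff.1 le_rfl).1

lemma div_mem_chartRing {M : Submodule A K} (f : K) {m : K} (hm : m ∈ M) :
    m / f ∈ chartRing M f := (chartRing_le_iff.1 le_rfl).2 m hm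

lemma div_mem_of_mem_span {R : Subring K} {M : Submodule A K} {f : K} (h : ∀ m ∈ M, m / f ∈ R)
    (h' : (algebraMap A' K).range ≤ R) {m : K} (hm : m ∈ Submodule.span A' (M : Set K)) :
    m / f ∈ R := by
  induction hm using Submodule.span_induction with
  | mem x hx => exact h x hx
  | zero => rw [zero_div]; exact R.zero_mem
  | add x y _ _ hx hy => rw [add_div]; exact R.add_mem hx hy
  | smul a x _ hx =>
    rw [Algebra.smul_def, mul_div_assoc]
    exact R.mul_mem (h' ⟨a, rfl⟩) hx

lemma isAway_chartRing (h : IsAway (algebraMap A' K).range (algebraMap A K).range)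
    (M : Submodule A K) (f : K) :
    IsAway (chartRing (Submodule.span A' (M : Set K)) f) (chartRing M f) := by
  obtain ⟨s, hs, hs0, hB, hsi, hs'⟩ := h
  let s' : chartRing M f := ⟨s, range_le_chartRing M f hs⟩
  refine ⟨s, s'.2, hs0, ?_, range_le_chartRing _ f hsi, ?_⟩
  · exact chartRing_le_iff.2 ⟨hB.trans (range_le_chartRing _ f),
      fun m hm => div_mem_chartRing f (Submodule.subset_span hm)⟩
  · have h1 : (algebraMap A' K).range ≤ away (chartRing M f) s' := fun x hx =>
      (hs' x hx).imp fun n hn => range_le_chartRing M f hn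
    exact chartRing_le_iff (R := away (chartRing M f) s').2 ⟨h1, fun m hm => div_mem_of_mem_span
      (fun m hm => le_away _ s' (div_mem_chartRing f hm)) h1 hm⟩

/-- The overlap of two charts of a blowup. -/
lemma exists_isAway_chartRing {M : Submodule A K} {f f' : K} (hf : f ∈ M) (hf' : f' ∈ M)
    (hf0 : f ≠ 0) (hf'0 : f' ≠ 0) : ∃ D, IsAway D (chartRing M f) ∧ IsAway D (chartRing M f') ∧
      ∀ R, chartRing M f ≤ R → chartRing M f' ≤ R → D ≤ R := by
  let s : chartRing M f := ⟨f' / f, div_mem_chartRing f hf'⟩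
  let t : chartRing M f' := ⟨f / f', div_mem_chartRing f' hf⟩
  have hs0 : (s : K) ≠ 0 := div_ne_zero hf'0 hf0
  have ht0 : (t : K) ≠ 0 := div_ne_zero hf0 hf'0
  have hst : (s : K)⁻¹ = t := inv_div _ _
  have hts : (t : K)⁻¹ = s := inv_div _ _
  have key : ∀ {g g' : K} {R : Subring K}, g' ≠ 0 → chartRing M g' ≤ R → g' / g ∈ R →
      chartRing M g ≤ R := by
    intro g g' R hg' h1 h2
    refine chartRing_le_iff.2 ⟨(range_le_chartRing M g').trans h1, fun m hm => ?_⟩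
    have : m / g = m / g' * (g' / g) := by rw [div_mul_div_cancel₀ hg']
    rw [this]
    exact R.mul_mem (h1 (div_mem_chartRing g' hm)) h2
  have h1 : chartRing M f' ≤ away (chartRing M f) s :=
    key hf0 (le_away _ s) (by rw [← inv_div]; exact inv_mem_away _ s hs0)
  have h2 : chartRing M f ≤ away (chartRing M f') t :=
    key hf'0 (le_away _ t) (by rw [← inv_div]; exact inv_mem_away _ t ht0)
  refine ⟨away (chartRing M f) s, isAway_away _ s hs0, ⟨t, t.2, ht0, h1, ?_, ?_⟩, ?_⟩
  · rw [hts]; exact le_away _ s s.2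
  · exact away_le (B' := away (chartRing M f') t) s hs0 h2 (by rw [hst]; exact le_away _ t t.2)
  · intro R hR hR'
    exact away_le s hs0 hR (by rw [hst]; exact hR' t.2)

end ChartRing

/-! ### Fractional ideal sheaves and their blowups -/

section FracIdeal

variable {V : Scheme.{u}} [IsIntegral V]

lemma genericPoint_mem (U : V.Opens) [h : Nonempty U] : genericPoint V ∈ U :=
  ((genericPoint_spec V).mem_open_set_iff U.2).2 (by simpa [Set.univ_inter] using ⟨_, h.some.2⟩)

lemma range_algebraMap_le_of_le {U U' : V.Opens} [Nonempty U] [Nonempty U'] (h : U' ≤ U) :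
    (algebraMap Γ(V, U) V.functionField).range ≤ (algebraMap Γ(V, U') V.functionField).range := by
  rintro _ ⟨a, rfl⟩
  exact ⟨V.presheaf.map (homOfLE h).op a, V.presheaf.germ_res_apply (homOfLE h) _ _ a⟩

lemma isAway_range_basicOpen {U : V.Opens} (hU : IsAffineOpen U) [Nonempty U] (a : Γ(V, U))
    [Nonempty (V.basicOpen a)] :
    IsAway (algebraMap Γ(V, V.basicOpen a) V.functionField).range
      (algebraMap Γ(V, U) V.functionField).range := by
  have hle := V.basicOpen_le a
  have hres : ∀ x : Γ(V, U), algebraMap Γ(V, V.basicOpen a) V.functionField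
      (V.presheaf.map (homOfLE hle).op x) = algebraMap _ V.functionField x :=
    fun x => V.presheaf.germ_res_apply (homOfLE hle) _ _ x
  have hu : IsUnit (V.presheaf.map (homOfLE hle).op a) := V.toRingedSpace.isUnit_res_basicOpen a
  obtain ⟨v, hv⟩ := hu.exists_right_inv
  have hv' : algebraMap Γ(V, U) V.functionField a * algebraMap _ V.functionField v = 1 := by
    rw [← hres, ← map_mul, hv, map_one]
  refine ⟨algebraMap _ _ a, ⟨a, rfl⟩, left_ne_zero_of_mul_eq_one hv',
    range_algebraMap_le_of_le hle, ?_, ?_⟩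
  · rw [inv_eq_of_mul_eq_one_right hv']; exact ⟨v, rfl⟩
  · rintro _ ⟨x, rfl⟩
    have := hU.isLocalization_basicOpen a
    obtain ⟨n, y, hy⟩ := IsLocalization.Away.surj (S := Γ(V, V.basicOpen a)) a x
    refine ⟨n, y, ?_⟩
    have h3 : x * (V.presheaf.map (homOfLE hle).op a) ^ n = V.presheaf.map (homOfLE hle).op y := hy
    rw [← hres, ← h3, map_mul, map_pow, hres, mul_comm]

/-- A common point of two affine open sets has a neighbourhood that is basic in both of them. -/
lemma exists_isAway_range {U U' : V.affineOpens} [Nonempty U.1] [Nonempty U'.1] {x : V}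
    (h : x ∈ U.1) (h' : x ∈ U'.1) : ∃ (D : V.affineOpens) (_ : Nonempty D.1), x ∈ D.1 ∧
      D.1 ≤ U.1 ∧ D.1 ≤ U'.1 ∧
      IsAway (algebraMap Γ(V, D.1) V.functionField).range
        (algebraMap Γ(V, U.1) V.functionField).range ∧
      IsAway (algebraMap Γ(V, D.1) V.functionField).range
        (algebraMap Γ(V, U'.1) V.functionField).range := by
  obtain ⟨a, a', haa', hx⟩ := exists_basicOpen_le_affine_inter U.2 U'.2 x ⟨h, h'⟩
  have hne : Nonempty (V.basicOpen a) := ⟨⟨x, hx⟩⟩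
  have h1 := isAway_range_basicOpen U.2 a
  have hne' : Nonempty (V.basicOpen a') := ⟨⟨x, haa' ▸ hx⟩⟩
  have h2 := isAway_range_basicOpen U'.2 a'
  refine ⟨V.affineBasicOpen a, hne, hx, V.basicOpen_le a, haa'.le.trans (V.basicOpen_le a'), h1, ?_⟩
  have : ∀ (O O' : V.Opens) (_ : Nonempty O) (_ : Nonempty O'), O' = O → ∀ R,
      IsAway (algebraMap Γ(V, O) V.functionField).range R →
      IsAway (algebraMap Γ(V, O') V.functionField).range R := by
    rintro O _ _ _ rfl R h; exact h
  exact this _ _ hne' hne haa' _ h2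

variable (V) in
/-- A nonzero coherent fractional ideal sheaf, given by its sections on affine open sets. -/
structure FracIdeal where
  /-- The sections over an affine open set. -/
  sec (U : V.affineOpens) [Nonempty U.1] : Submodule Γ(V, U.1) V.functionField
  fg (U : V.affineOpens) [Nonempty U.1] : (sec U).FG
  ne_bot (U : V.affineOpens) [Nonempty U.1] : sec U ≠ ⊥
  span_eq (U U' : V.affineOpens) [Nonempty U.1] [Nonempty U'.1] (h : U'.1 ≤ U.1) :
    Submodule.span Γ(V, U'.1) (sec U : Set V.functionField) = sec U'

namespace FracIdeal

variable (M : FracIdeal V)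

lemma sec_le {U U' : V.affineOpens} [Nonempty U.1] [Nonempty U'.1] (h : U'.1 ≤ U.1)
    {m : V.functionField} (hm : m ∈ M.sec U) : m ∈ M.sec U' := by
  rw [← M.span_eq U U' h]; exact Submodule.subset_span hm

/-- The rings of the charts of the blowup of `M`, and their localizations. -/
def charts : Set (Subring V.functionField) :=
  {B | ∃ (U : V.affineOpens) (_ : Nonempty U.1), ∃ f ∈ M.sec U, f ≠ 0 ∧
    IsAway B (chartRing (M.sec U) f)}

variable {M}

lemma chartRing_mem_charts {U : V.affineOpens} [Nonempty U.1] {f : V.functionField}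
    (hf : f ∈ M.sec U) (hf0 : f ≠ 0) : chartRing (M.sec U) f ∈ M.charts :=
  ⟨U, inferInstance, f, hf, hf0, IsAway.refl _⟩

lemma mem_charts_of_isAway {B B' : Subring V.functionField} (hB : B ∈ M.charts)
    (h : IsAway B' B) : B' ∈ M.charts := by
  obtain ⟨U, hU, f, hf, hf0, hB⟩ := hB
  exact ⟨U, hU, f, hf, hf0, h.trans hB⟩

lemma isAway_chartRing_sec {U U' : V.affineOpens} [Nonempty U.1] [Nonempty U'.1]
    (h : U'.1 ≤ U.1) (ha : IsAway (algebraMap Γ(V, U'.1) V.functionField).range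
      (algebraMap Γ(V, U.1) V.functionField).range) (f : V.functionField) :
    IsAway (chartRing (M.sec U') f) (chartRing (M.sec U) f) := by
  rw [← M.span_eq U U' h]
  exact isAway_chartRing ha _ f

lemma exists_isAway_isAway {B B' : Subring V.functionField} (hB : B ∈ M.charts)
    (hB' : B' ∈ M.charts) : ∃ D ∈ M.charts, IsAway D B ∧ IsAway D B' := by
  obtain ⟨U, hU, f, hf, hf0, hB⟩ := hB
  obtain ⟨U', hU', f', hf', hf'0, hB'⟩ := hB'
  obtain ⟨D, hD, -, h1, h2, h3, h4⟩ :=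
    exists_isAway_range (genericPoint_mem U.1) (genericPoint_mem U'.1)
  obtain ⟨E, hE, hE', -⟩ := exists_isAway_chartRing (M.sec_le h1 hf) (M.sec_le h2 hf') hf0 hf'0
  obtain ⟨F, hF, hF'⟩ := hB.exists_common (hE.trans (isAway_chartRing_sec h1 h3 f))
  obtain ⟨F', hF1, hF1'⟩ := hB'.exists_common (hE'.trans (isAway_chartRing_sec h2 h4 f'))
  obtain ⟨G, hG, hG'⟩ := hF'.exists_common hF1'
  refine ⟨G, ?_, hG.trans hF, hG'.trans hF1⟩
  exact ⟨U, hU, f, hf, hf0, (hG.trans hF).trans hB⟩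

lemma nonempty_charts : M.charts.Nonempty := by
  obtain ⟨U, hU, h, -⟩ := exists_isAffineOpen_mem_and_subset (x := genericPoint V) (U := ⊤) trivial
  have : Nonempty U := ⟨⟨_, h⟩⟩
  obtain ⟨f, hf, hf0⟩ := Submodule.exists_mem_ne_zero_of_ne_bot (M.ne_bot ⟨U, hU⟩)
  exact ⟨_, chartRing_mem_charts hf hf0⟩

lemma specSubtype_fromSpec {U : V.affineOpens} [Nonempty U.1] {B : Subring V.functionField}
    (h : (algebraMap Γ(V, U.1) V.functionField).range ≤ B) :
    specSubtype B ≫ Spec.map (CommRingCat.ofHom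
      ((algebraMap Γ(V, U.1) V.functionField).codRestrict B fun a => h ⟨a, rfl⟩)) ≫
      U.2.fromSpec = genericMap V := by
  rw [genericMap, ← IsAffineOpen.fromSpecStalk_eq_fromSpecStalk U.2 (genericPoint_mem U.1),
    specSubtype,
    ← Category.assoc, ← Spec.map_comp]
  rfl

lemma exists_specSubtype_comp {B : Subring V.functionField} (hB : B ∈ M.charts) :
    ∃ m, specSubtype B ≫ m = genericMap V := by
  obtain ⟨U, hU, f, hf, hf0, hB⟩ := hB
  exact ⟨_, specSubtype_fromSpec ((range_le_chartRing _ f).trans hB.le)⟩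

variable (M) in
/-- A blowup of the fractional ideal sheaf `M`, glued from its charts. -/
abbrev Model := SubringModel M.charts V (genericMap V)

lemma nonempty_model [V.IsSeparated] : Nonempty M.Model :=
  nonempty_subringModel (fun _ hB _ => mem_charts_of_isAway hB) _ fun _ => exists_specSubtype_comp

instance (X : M.Model) : IsIntegral X.W :=
  X.isIntegral nonempty_charts fun _ hB _ hB' => exists_isAway_isAway hB hB'

end FracIdeal

end FracIdeal

/-! ### Points of the blowup of a fractional ideal -/

section Points

variable {V W : Scheme.{u}} [IsIntegral V] [IsIntegral W]

instance isLocalRing_locRing (π : W ⟶ V) [IsDominant π] (w : W) : IsLocalRing (locRing π w) := by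
  have key : ∀ (x : locRing π w) (α : W.presheaf.stalk w), IsUnit α →
      algebraMap _ W.functionField α = functionFieldMap π x → IsUnit x := by
    rintro x _ ⟨α, rfl⟩ hα
    have h1 : algebraMap _ W.functionField (↑α⁻¹ : W.presheaf.stalk w) *
      algebraMap _ W.functionField (α : W.presheaf.stalk w) = 1 := by rw [← map_mul, Units.inv_mul, map_one]
    have hx0 : (x : V.functionField) ≠ 0 := fun h => by
      rw [hα, h, map_zero, mul_zero] at h1; exact zero_ne_one h1
    refine IsUnit.of_mul_eq_one ⟨(x : V.functionField)⁻¹, ↑α⁻¹, ?_⟩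
      (Subtype.ext (mul_inv_cancel₀ hx0))
    rw [map_inv₀, ← hα]
    exact eq_inv_of_mul_eq_one_left h1
  refine ⟨fun {x y} hxy => ?_⟩
  obtain ⟨x, α, hα⟩ := x
  obtain ⟨y, β, hβ⟩ := y
  have h1 : α + β = 1 := by
    refine IsFractionRing.injective (W.presheaf.stalk w) W.functionField ?_
    rw [map_add, hα, hβ, ← map_add, map_one]
    rw [show x + y = 1 from congrArg Subtype.val hxy, map_one]
  rcases IsLocalRing.isUnit_or_isUnit_of_add_one h1 with h | h
  · exact Or.inl (key ⟨x, α, hα⟩ α h hα)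
  · exact Or.inr (key ⟨y, β, hβ⟩ β h hβ)

lemma range_le_locRing {π : W ⟶ V} [IsDominant π] {w : W} {U : V.affineOpens} [Nonempty U.1]
    (h : π w ∈ U.1) : (algebraMap Γ(V, U.1) V.functionField).range ≤ locRing π w := by
  rintro _ ⟨a, rfl⟩
  exact algebraMap_mem_locRing π w U.1 h a

namespace FracIdeal

variable {M : FracIdeal V} (X : M.Model)

instance (B : Subring V.functionField) (hB : B ∈ M.charts) : IsDominant (X.ι B hB) :=
  isDominant_of_isOpenImmersion _

instance : IsDominant X.π := by
  obtain ⟨B, hB⟩ := nonempty_charts (M := M)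
  have h := X.generic B hB
  rw [← Category.assoc] at h
  have : IsDominant ((specSubtype B ≫ X.ι B hB) ≫ X.π) := by rw [h]; infer_instance
  exact IsDominant.of_comp (specSubtype B ≫ X.ι B hB) X.π

variable {X} {B : Subring V.functionField} {hB : B ∈ M.charts}

lemma functionFieldMap_ι (b : B) :
    functionFieldMap (X.ι B hB ≫ X.π) b = specFF (.of B) b :=
  functionFieldMap_chart B _ (X.generic B hB) b

lemma mem_locRing_ι {p : Spec (.of B)} {x : V.functionField} :
    x ∈ locRing X.π (X.ι B hB p) ↔ ∃ a s : B, s ∉ p.asIdeal ∧ x * s = a := by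
  rw [← locRing_isOpenImmersion]
  refine (mem_range_stalk_Spec (.of B) p _).trans ?_
  refine exists_congr fun a => exists_congr fun s => and_congr_right fun _ => ?_
  rw [← functionFieldMap_ι (X := X) (hB := hB), ← functionFieldMap_ι (X := X) (hB := hB), ← map_mul]
  exact (functionFieldMap (X.ι B hB ≫ X.π)).injective.eq_iff

lemma functionFieldMap_bijective : Function.Bijective (functionFieldMap X.π) := by
  obtain ⟨B, hB⟩ := nonempty_charts (M := M)
  refine ⟨(functionFieldMap X.π).injective, fun x => ?_⟩
  obtain ⟨p⟩ : Nonempty (Spec (.of B)) := ⟨genericPoint _⟩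
  obtain ⟨u, v, -, huv⟩ := IsFractionRing.div_surjective
    (A := (Spec (.of B)).presheaf.stalk p) (functionFieldMap (X.ι B hB) x)
  have h1 : ∀ y : (Spec (.of B)).presheaf.stalk p, ∃ z, functionFieldMap (X.ι B hB ≫ X.π) z =
      algebraMap _ (Spec (.of B)).functionField y := by
    intro y
    obtain ⟨a, s, hs, h⟩ := (mem_range_stalk_Spec (.of B) p _).1 ⟨y, rfl⟩
    have hs0 : specFF (.of B) s ≠ 0 := fun h0 => hs (by
      rw [(map_eq_zero_iff _ (specFF_injective _)).1 h0]; exact p.asIdeal.zero_mem)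
    refine ⟨(a : B) / (s : B), ?_⟩
    rw [map_div₀, functionFieldMap_ι, functionFieldMap_ι, div_eq_iff hs0]
    exact h.symm
  obtain ⟨u', hu⟩ := h1 u
  obtain ⟨v', hv⟩ := h1 v
  refine ⟨u' / v', (functionFieldMap (X.ι B hB)).injective ?_⟩
  rw [← huv, ← hu, ← hv, ← map_div₀, functionFieldMap_comp, RingHom.comp_apply]

lemma le_locRing_ι (p : Spec (.of B)) : B ≤ locRing X.π (X.ι B hB p) := fun x hx =>
  mem_locRing_ι.2 ⟨⟨x, hx⟩, 1, (Ideal.ne_top_iff_one _).1 p.isPrime.ne_top, mul_one _⟩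

lemma locallyGenerates_locRing_ι (p : Spec (.of B)) :
    LocallyGenerates (B : Set V.functionField) (locRing X.π (X.ι B hB p)) := by
  refine ⟨le_locRing_ι p, fun R' h1 h2 h3 x hx => ?_⟩
  obtain ⟨a, s, hs, h⟩ := mem_locRing_ι.1 hx
  have hs0 : (s : V.functionField) ≠ 0 := fun h0 => hs (by
    rw [show s = 0 from Subtype.ext h0]; exact p.asIdeal.zero_mem)
  have h4 : (s : V.functionField)⁻¹ ∈ R' := h3 _ (h1 s.2)
    (mem_locRing_ι.2 ⟨1, s, hs, inv_mul_cancel₀ hs0⟩)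
  rw [(eq_mul_inv_iff_mul_eq₀ hs0).2 h]
  exact R'.mul_mem (h1 a.2) h4

lemma mem_range_ι_of_isAway {B' : Subring V.functionField} (h : IsAway B' B) {w : X.W}
    (hw : w ∈ Set.range (X.ι B' (mem_charts_of_isAway hB h))) : w ∈ Set.range (X.ι B hB) := by
  obtain ⟨p, rfl⟩ := hw
  refine ⟨specInclusion h.le p, ?_⟩
  rw [← Scheme.Hom.comp_apply, X.comp B hB B' _ h]

lemma mem_range_ι_of_le {B' : Subring V.functionField} (h : IsAway B' B) {w : X.W}
    (hw : w ∈ Set.range (X.ι B hB)) (hle : B' ≤ locRing X.π w) :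
    w ∈ Set.range (X.ι B' (mem_charts_of_isAway hB h)) := by
  obtain ⟨p, rfl⟩ := hw
  obtain ⟨s, hs, hs0, hBB', hsi, hs'⟩ := id h
  have hsp : (⟨s, hs⟩ : B) ∉ p.asIdeal := by
    obtain ⟨a, t, ht, hat⟩ := mem_locRing_ι.1 (hle hsi)
    intro hsp
    refine ht ?_
    have : t = a * ⟨s, hs⟩ := Subtype.ext (by
      rw [Subring.coe_mul, ← hat]; field_simp)
    rw [this]
    exact p.asIdeal.mul_mem_left _ hsp
  obtain ⟨q, rfl⟩ := (mem_range_specInclusion ⟨s, hs⟩ hs0 hBB' hsi hs' p).2 hsp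
  exact ⟨q, by rw [← X.comp B hB B' _ h]; rfl⟩

/-- Every point of the blowup lies on a chart `A[M / f]`, where `A` is the ring of an affine open
set. -/
lemma exists_chartRing (w : X.W) : ∃ (U : V.affineOpens) (_ : Nonempty U.1),
    ∃ f, ∃ hf : f ∈ M.sec U, ∃ hf0 : f ≠ 0,
      w ∈ Set.range (X.ι _ (chartRing_mem_charts hf hf0)) := by
  obtain ⟨B, hB, p, rfl⟩ := X.exists_eq w
  obtain ⟨U, hU, f, hf, hf0, h⟩ := id hB
  exact ⟨U, hU, f, hf, hf0, mem_range_ι_of_isAway h ⟨p, rfl⟩⟩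

lemma ι_π {U : V.affineOpens} [Nonempty U.1]
    (h : (algebraMap Γ(V, U.1) V.functionField).range ≤ B) [V.IsSeparated] :
    X.ι B hB ≫ X.π = Spec.map (CommRingCat.ofHom
      ((algebraMap Γ(V, U.1) V.functionField).codRestrict B fun a => h ⟨a, rfl⟩)) ≫
      U.2.fromSpec :=
  ext_of_isDominant (specSubtype B) ((X.generic B hB).trans (specSubtype_fromSpec h).symm)

variable [V.IsSeparated]

lemma π_ι_mem {U : V.affineOpens} [Nonempty U.1]
    (h : (algebraMap Γ(V, U.1) V.functionField).range ≤ B) (p : Spec (.of B)) :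
    X.π (X.ι B hB p) ∈ U.1 := by
  rw [← Scheme.Hom.comp_apply, ι_π h, Scheme.Hom.comp_apply]
  exact U.2.range_fromSpec.le ⟨_, rfl⟩

/-- A point of the blowup is on the chart `A[M / f]` if its local ring contains this ring. -/
lemma mem_range_ι_iff {w : X.W} {U : V.affineOpens} [Nonempty U.1] {f : V.functionField}
    (hf : f ∈ M.sec U) (hf0 : f ≠ 0) :
    w ∈ Set.range (X.ι _ (chartRing_mem_charts hf hf0)) ↔
      X.π w ∈ U.1 ∧ ∀ m ∈ M.sec U, m / f ∈ locRing X.π w := by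
  constructor
  · rintro ⟨p, rfl⟩
    exact ⟨π_ι_mem (range_le_chartRing _ f) p,
      fun m hm => le_locRing_ι p (div_mem_chartRing f hm)⟩
  · rintro ⟨hU, hm⟩
    obtain ⟨U₁, _, f₁, hf₁, hf₁0, p, rfl⟩ := exists_chartRing w
    have hU₁ := π_ι_mem (X := X) (hB := chartRing_mem_charts hf₁ hf₁0) (range_le_chartRing _ f₁) p
    obtain ⟨D, _, hD, h1, h2, h3, h4⟩ := exists_isAway_range hU hU₁
    obtain ⟨E, hE, hE', hEle⟩ :=
      exists_isAway_chartRing (M.sec_le h1 hf) (M.sec_le h2 hf₁) hf0 hf₁0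
    set w := X.ι _ (chartRing_mem_charts hf₁ hf₁0) p with hw
    have hDw : (algebraMap Γ(V, D.1) V.functionField).range ≤ locRing X.π w := range_le_locRing hD
    have hc : chartRing (M.sec D) f ≤ locRing X.π w := chartRing_le_iff.2 ⟨hDw, fun m hmD =>
      div_mem_of_mem_span hm hDw (by rw [M.span_eq U D h1]; exact hmD)⟩
    have hc₁ : chartRing (M.sec D) f₁ ≤ locRing X.π w := chartRing_le_iff.2 ⟨hDw, fun m hmD =>
      div_mem_of_mem_span (fun m hm => le_locRing_ι p (div_mem_chartRing f₁ hm)) hDw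
        (by rw [M.span_eq U₁ D h2]; exact hmD)⟩
    have hEU : IsAway E (chartRing (M.sec U) f) := hE.trans (isAway_chartRing_sec h1 h3 f)
    have hEU₁ : IsAway E (chartRing (M.sec U₁) f₁) := hE'.trans (isAway_chartRing_sec h2 h4 f₁)
    exact mem_range_ι_of_isAway hEU (mem_range_ι_of_le hEU₁ ⟨p, rfl⟩ (hEle _ hc hc₁))

end FracIdeal

/-- Over a local ring, an element which generates a module is associated to one of the given
generators. -/
lemma exists_generator_mem {R K : Type*} [CommRing R] [IsLocalRing R] [Field K] [Algebra R K]
    (hR : Function.Injective (algebraMap R K)) {S : Set K} {f : K}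
    (hf0 : f ≠ 0) (h : Submodule.span R S = Submodule.span R {f}) :
    ∃ g ∈ S, g ≠ 0 ∧ Submodule.span R S = Submodule.span R {g} := by
  by_contra! hcon
  have hS : ∀ g ∈ S, ∃ a : R, a • f = g := fun g hg =>
    Submodule.mem_span_singleton.1 (h ▸ Submodule.subset_span hg)
  have key : ∀ x ∈ Submodule.span R S, ∃ a ∈ IsLocalRing.maximalIdeal R, a • f = x := by
    intro x hx
    induction hx using Submodule.span_induction with
    | mem x hx =>
      obtain ⟨a, ha⟩ := hS x hx
      refine ⟨a, fun hu => ?_, ha⟩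
      obtain ⟨u, rfl⟩ := hu
      have hx0 : x ≠ 0 := by
        rw [← ha, Algebra.smul_def]
        exact mul_ne_zero ((map_ne_zero_iff _ hR).2 u.ne_zero) hf0
      refine hcon x hx hx0 (h.trans ?_)
      have : x = u • f := ha.symm
      rw [this, Submodule.span_singleton_group_smul_eq]
    | zero => exact ⟨0, Ideal.zero_mem _, zero_smul _ _⟩
    | add x y _ _ hx hy =>
      obtain ⟨a, ha, rfl⟩ := hx
      obtain ⟨b, hb, rfl⟩ := hy
      exact ⟨a + b, Ideal.add_mem _ ha hb, add_smul _ _ _⟩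
    | smul c x _ hx =>
      obtain ⟨a, ha, rfl⟩ := hx
      exact ⟨c * a, Ideal.mul_mem_left _ _ ha, mul_smul _ _ _⟩
  obtain ⟨a, ha, haf⟩ := key f (h ▸ Submodule.mem_span_singleton_self f)
  have : a = 1 := hR (mul_right_cancel₀ hf0 (by rw [← Algebra.smul_def, haf, map_one, one_mul]))
  exact (Ideal.ne_top_iff_one _).1 (IsLocalRing.maximalIdeal.isMaximal R).ne_top (this ▸ ha)

lemma div_mem_iff_span_eq {K : Type*} [Field K] {R : Subring K} {S : Set K} {f : K}
    (hf : f ∈ S) (hf0 : f ≠ 0) :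
    Submodule.span R S = Submodule.span R {f} ↔ ∀ m ∈ S, m / f ∈ R := by
  constructor
  · intro h m hm
    obtain ⟨a, ha⟩ := Submodule.mem_span_singleton.1 (h ▸ Submodule.subset_span (R := R) hm)
    have : m / f = a := by rw [← ha, Subring.smul_def, smul_eq_mul, mul_div_cancel_right₀ _ hf0]
    rw [this]; exact a.2
  · intro h
    refine le_antisymm (Submodule.span_le.2 fun m hm => Submodule.mem_span_singleton.2
      ⟨⟨_, h m hm⟩, div_mul_cancel₀ m hf0⟩) (Submodule.span_mono (Set.singleton_subset_iff.2 hf))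

namespace FracIdeal

/-- The fractional ideal sheaf `M` of `V` becomes principal in the local ring of `W` at `w`. -/
def IsPrincipalAt (M : FracIdeal V) (π : W ⟶ V) [IsDominant π] (w : W) : Prop :=
  ∀ (U : V.affineOpens) [Nonempty U.1], π w ∈ U.1 → ∃ f ∈ M.sec U, f ≠ 0 ∧
    ∀ m ∈ M.sec U, m / f ∈ locRing π w

/-- It is enough to find a generator, over one affine open set, which need not belong to `M`. -/
lemma isPrincipalAt_of_span_eq {M : FracIdeal V} {π : W ⟶ V} [IsDominant π] {w : W}
    {U : V.affineOpens} [Nonempty U.1] (hU : π w ∈ U.1) {f : V.functionField} (hf0 : f ≠ 0)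
    (h : Submodule.span (locRing π w) (M.sec U : Set V.functionField) =
      Submodule.span (locRing π w) {f}) : M.IsPrincipalAt π w := by
  intro U' _ hU'
  obtain ⟨D, _, hD, h1, h2, -, -⟩ := exists_isAway_range hU hU'
  have hDw : (algebraMap Γ(V, D.1) V.functionField).range ≤
      (algebraMap (locRing π w) V.functionField).range := by
    rintro _ ⟨a, rfl⟩
    exact ⟨⟨_, algebraMap_mem_locRing π w D.1 hD a⟩, rfl⟩
  rw [← span_span_of_range_le hDw, M.span_eq U D h1, ← M.span_eq U' D h2,
    span_span_of_range_le hDw] at h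
  obtain ⟨g, hg, hg0, h⟩ := exists_generator_mem Subtype.val_injective hf0 h
  exact ⟨g, hg, hg0, (div_mem_iff_span_eq hg hg0).1 h⟩

/-- The inverse image of `M` on its blowup is principal at each point. -/
lemma isPrincipalAt_π {M : FracIdeal V} [V.IsSeparated] (X : M.Model) (w : X.W) :
    M.IsPrincipalAt X.π w := by
  obtain ⟨U, _, f, hf, hf0, p, rfl⟩ := exists_chartRing w
  exact isPrincipalAt_of_span_eq (π_ι_mem (range_le_chartRing _ f) p) hf0
    ((div_mem_iff_span_eq hf hf0).2 fun m hm => le_locRing_ι p (div_mem_chartRing f hm))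

end FracIdeal

end Points

/-! ### Inverse images of ideals and their local generators -/

section Comap

variable {X Y T V : Scheme.{u}}

lemma ideal_comap_top [IsAffine X] [IsAffine Y] (I : Y.IdealSheafData) (f : X ⟶ Y) :
    (I.comap f).ideal ⟨⊤, isAffineOpen_top X⟩ =
      (I.ideal ⟨⊤, isAffineOpen_top Y⟩).map f.appTop.hom := by
  refine le_antisymm ?_ ?_
  · let J := Scheme.IdealSheafData.ofIdealTop
      ((I.ideal ⟨⊤, isAffineOpen_top Y⟩).map f.appTop.hom)
    have hJ : J.ideal ⟨⊤, isAffineOpen_top X⟩ =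
        (I.ideal ⟨⊤, isAffineOpen_top Y⟩).map f.appTop.hom :=
      Scheme.IdealSheafData.equivOfIsAffine.apply_symm_apply _
    rw [← hJ]
    have h : I.comap f ≤ J := by
      rw [← Scheme.IdealSheafData.le_map_iff_comap_le]
      refine Scheme.IdealSheafData.le_of_isAffine ?_
      rw [Scheme.IdealSheafData.ideal_map_of_isAffineHom, ← Ideal.map_le_iff_le_comap]
      exact hJ.ge
    exact h _
  · rw [Ideal.map_le_iff_le_comap]
    have h := I.le_map_comap f ⟨⊤, isAffineOpen_top Y⟩
    rw [Scheme.IdealSheafData.ideal_map_of_isAffineHom] at h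
    exact h

lemma ideal_comap_isOpenImmersion_top [IsAffine X] (I : Y.IdealSheafData) (f : X ⟶ Y)
    [IsOpenImmersion f] (U : Y.affineOpens) (h : (⊤ : X.Opens) ≤ f ⁻¹ᵁ U.1) :
    (I.comap f).ideal ⟨⊤, isAffineOpen_top X⟩ = (I.ideal U).map (f.appLE U.1 ⊤ h).hom := by
  rw [Scheme.IdealSheafData.ideal_comap_of_isOpenImmersion]
  have hle : f ''ᵁ ⊤ ≤ U.1 := by
    rintro _ ⟨x, hx, rfl⟩; exact h hx
  have h1 := I.map_ideal (U := ⟨f ''ᵁ ⊤, (isAffineOpen_top X).image_of_isOpenImmersion f⟩)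
    (V := U) hle
  rw [← h1]
  have h2 : ∀ K : Ideal Γ(Y, f ''ᵁ ⊤), K.comap (f.appIso ⊤).inv.hom = K.map (f.appIso ⊤).hom.hom :=
    fun K => (Ideal.map_comap_of_equiv (I := K) (f.appIso ⊤).commRingCatIsoToRingEquiv).symm
  rw [h2, Ideal.map_map, ← CommRingCat.hom_comp]
  congr 2
  rw [Scheme.Hom.appIso_hom', Scheme.Hom.map_appLE]

/-- The inverse image of an ideal sheaf, on affine open sets. -/
lemma ideal_comap (I : Y.IdealSheafData) (g : X ⟶ Y) (U : Y.affineOpens) (O : X.affineOpens)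
    (h : O.1 ≤ g ⁻¹ᵁ U.1) : (I.comap g).ideal O = (I.ideal U).map (g.appLE U.1 O.1 h).hom := by
  have : IsAffine O.1 := O.2
  have : IsAffine U.1 := U.2
  have e : (⊤ : Scheme.Opens O.1) ≤ O.1.ι ⁻¹ᵁ O.1 := by simp
  have e' : (⊤ : Scheme.Opens U.1) ≤ U.1.ι ⁻¹ᵁ U.1 := by simp
  have h1 := ideal_comap_isOpenImmersion_top (I.comap g) O.1.ι O e
  rw [← Scheme.IdealSheafData.comap_comp, ← g.resLE_comp_ι h, Scheme.IdealSheafData.comap_comp,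
    ideal_comap_top, ideal_comap_isOpenImmersion_top I U.1.ι U e', Ideal.map_map,
    ← CommRingCat.hom_comp] at h1
  have h2 : U.1.ι.appLE U.1 ⊤ e' ≫ (g.resLE U.1 O.1 h).appTop =
      g.appLE U.1 O.1 h ≫ O.1.ι.appLE O.1 ⊤ e := by
    have e₁ : (⊤ : Scheme.Opens O.1) ≤ g.resLE U.1 O.1 h ⁻¹ᵁ ⊤ := fun _ _ => trivial
    have h3 : (g.resLE U.1 O.1 h).appTop = (g.resLE U.1 O.1 h).appLE ⊤ ⊤ e₁ :=
      Scheme.Hom.app_eq_appLE _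
    rw [h3, Scheme.Hom.appLE_comp_appLE, Scheme.Hom.appLE_comp_appLE]
    simp only [Scheme.Hom.resLE_comp_ι]
  rw [h2, CommRingCat.hom_comp, ← Ideal.map_map] at h1
  have h3 : IsIso (O.1.ι.appLE O.1 ⊤ e) := by
    have h4 : O.1.ι.appLE O.1 ⊤ e = O.1.topIso.inv := by rw [Scheme.Opens.ι_appLE]; rfl
    rw [h4]; infer_instance
  have h4 : Function.Bijective (O.1.ι.appLE O.1 ⊤ e).hom := ConcreteCategory.bijective_of_isIso _
  have h5 := congrArg (Ideal.comap (O.1.ι.appLE O.1 ⊤ e).hom) h1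
  rwa [Ideal.comap_map_of_bijective _ h4, Ideal.comap_map_of_bijective _ h4, eq_comm] at h5

/-- Near the point `t` of `T`, the ideal `J` on `U` generates an invertible ideal. -/
def IsPrincipalNear (g : T ⟶ V) (U : V.Opens) (J : Ideal Γ(V, U)) (t : T) : Prop :=
  ∃ (O : T.Opens) (hO : O ≤ g ⁻¹ᵁ U) (a : Γ(T, O)), t ∈ O ∧
    (∀ (x : T) (hx : x ∈ O), T.presheaf.germ O x hx a ∈ nonZeroDivisors (T.presheaf.stalk x)) ∧
    J.map (g.appLE U O hO).hom = Ideal.span {a}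

lemma mem_nonZeroDivisors_of_germ {O : T.Opens} {a : Γ(T, O)}
    (h : ∀ (x : T) (hx : x ∈ O), T.presheaf.germ O x hx a ∈ nonZeroDivisors (T.presheaf.stalk x)) :
    a ∈ nonZeroDivisors Γ(T, O) := by
  refine mem_nonZeroDivisors_iff_right.2 fun b hb => ?_
  refine TopCat.Presheaf.section_ext T.sheaf O b 0 fun x hx => ?_
  have h1 := congrArg (T.presheaf.germ O x hx) hb
  rw [map_mul, map_zero] at h1
  exact ((mem_nonZeroDivisors_iff_right.1 (h x hx)) _ h1).trans (map_zero _).symm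

lemma germ_mem_nonZeroDivisors {O : T.affineOpens} {a : Γ(T, O.1)}
    (h : a ∈ nonZeroDivisors Γ(T, O.1)) (x : T) (hx : x ∈ O.1) :
    T.presheaf.germ O.1 x hx a ∈ nonZeroDivisors (T.presheaf.stalk x) := by
  let _ := (T.presheaf.germ O.1 x hx).hom.toAlgebra
  have := O.2.isLocalization_stalk ⟨x, hx⟩
  exact IsLocalization.map_nonZeroDivisors_le (O.2.primeIdealOf ⟨x, hx⟩).asIdeal.primeCompl
    (T.presheaf.stalk x) ⟨a, h, rfl⟩

lemma germ_map_mem_nonZeroDivisors {O O' : T.Opens} (hle : O' ≤ O) {a : Γ(T, O)}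
    (h : ∀ (x : T) (hx : x ∈ O), T.presheaf.germ O x hx a ∈ nonZeroDivisors (T.presheaf.stalk x))
    (x : T) (hx : x ∈ O') : T.presheaf.germ O' x hx (T.presheaf.map (homOfLE hle).op a) ∈
      nonZeroDivisors (T.presheaf.stalk x) := by
  rw [TopCat.Presheaf.germ_res_apply]; exact h x (hle hx)

lemma map_appLE_map {g : T ⟶ V} {U : V.Opens} {O O' : T.Opens} (hO : O ≤ g ⁻¹ᵁ U) (hle : O' ≤ O)
    {J : Ideal Γ(V, U)} {a : Γ(T, O)} (h : J.map (g.appLE U O hO).hom = Ideal.span {a}) :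
    J.map (g.appLE U O' (hle.trans hO)).hom = Ideal.span {T.presheaf.map (homOfLE hle).op a} := by
  rw [← Scheme.Hom.appLE_map g hO (homOfLE hle).op, CommRingCat.hom_comp, ← Ideal.map_map, h,
    Ideal.map_span, Set.image_singleton]

lemma IsInvertible.isPrincipalNear {I : V.IdealSheafData} {g : T ⟶ V}
    (h : IsInvertible (I.comap g)) (U : V.affineOpens) {t : T} (ht : g t ∈ U.1) :
    IsPrincipalNear g U.1 (I.ideal U) t := by
  obtain ⟨O, htO, a, ha, haO⟩ := h t
  obtain ⟨O', hO', htO', hle⟩ := exists_isAffineOpen_mem_and_subset (x := t)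
    (U := O.1 ⊓ g ⁻¹ᵁ U.1) ⟨htO, ht⟩
  have hle1 : O' ≤ O.1 := fun x hx => (hle hx).1
  have hle2 : O' ≤ g ⁻¹ᵁ U.1 := fun x hx => (hle hx).2
  refine ⟨O', hle2, T.presheaf.map (homOfLE hle1).op a, htO',
    germ_map_mem_nonZeroDivisors hle1 (germ_mem_nonZeroDivisors ha), ?_⟩
  rw [← ideal_comap I g U ⟨O', hO'⟩ hle2,
    ← (I.comap g).map_ideal (U := ⟨O', hO'⟩) (V := O) hle1, haO, Ideal.map_span,
    Set.image_singleton]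
  rfl

lemma isInvertible_comap_of_isPrincipalNear {I : V.IdealSheafData} {g : T ⟶ V}
    (h : ∀ t, ∃ U : V.affineOpens, IsPrincipalNear g U.1 (I.ideal U) t) :
    IsInvertible (I.comap g) := by
  intro t
  obtain ⟨U, O, hO, a, ht, ha, haJ⟩ := h t
  obtain ⟨O', hO', htO', hle⟩ := exists_isAffineOpen_mem_and_subset (x := t) (U := O) ht
  refine ⟨⟨O', hO'⟩, htO', T.presheaf.map (homOfLE hle).op a,
    mem_nonZeroDivisors_of_germ (germ_map_mem_nonZeroDivisors hle ha), ?_⟩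
  exact (ideal_comap I g U ⟨O', hO'⟩ (le_trans hle hO)).trans (map_appLE_map hO hle haJ)

lemma germ_app_mem_nonZeroDivisors (i : X ⟶ T) [IsOpenImmersion i] {O : T.Opens} {a : Γ(T, O)}
    (ha : ∀ (x : T) (hx : x ∈ O), T.presheaf.germ O x hx a ∈ nonZeroDivisors (T.presheaf.stalk x))
    (y : X) (hy : y ∈ i ⁻¹ᵁ O) : X.presheaf.germ (i ⁻¹ᵁ O) y hy (i.app O a) ∈
      nonZeroDivisors (X.presheaf.stalk y) := by
  have h1 := Scheme.Hom.germ_stalkMap_apply i O y hy a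
  rw [← h1]
  let e := (asIso (i.stalkMap y)).commRingCatIsoToRingEquiv
  refine mem_nonZeroDivisors_iff_right.2 fun b hb => ?_
  obtain ⟨b, rfl⟩ := e.surjective b
  have h2 : e (b * T.presheaf.germ O (i y) hy a) = 0 := (map_mul e _ _).trans hb
  rw [map_eq_zero_iff e e.injective] at h2
  rw [mem_nonZeroDivisors_iff_right.1 (ha _ hy) b h2, map_zero]

lemma IsPrincipalNear.comp {g : T ⟶ V} {U : V.Opens} {J : Ideal Γ(V, U)} (i : X ⟶ T)
    [IsOpenImmersion i] {x : X} (h : IsPrincipalNear g U J (i x)) :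
    IsPrincipalNear (i ≫ g) U J x := by
  obtain ⟨O, hO, a, ht, ha, haJ⟩ := h
  refine ⟨i ⁻¹ᵁ O, fun y hy => hO hy, i.app O a, ht, germ_app_mem_nonZeroDivisors i ha, ?_⟩
  have h3 := Scheme.Hom.appLE_comp_appLE i g U O (i ⁻¹ᵁ O) hO le_rfl
  rw [← h3, CommRingCat.hom_comp, ← Ideal.map_map, haJ, Ideal.map_span, Set.image_singleton,
    ← Scheme.Hom.app_eq_appLE]

lemma isPrincipalNear_map_ι {U : V.Opens} (e : (⊤ : Scheme.Opens U) ≤ U.ι ⁻¹ᵁ U)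
    {J : Ideal Γ(V, U)} {g : T ⟶ U.toScheme} {t : T} :
    IsPrincipalNear g ⊤ (J.map (U.ι.appLE U ⊤ e).hom) t ↔ IsPrincipalNear (g ≫ U.ι) U J t := by
  have key : ∀ (O : T.Opens) (h : O ≤ g ⁻¹ᵁ ⊤) (h' : O ≤ (g ≫ U.ι) ⁻¹ᵁ U),
      (J.map (U.ι.appLE U ⊤ e).hom).map (g.appLE ⊤ O h).hom =
        J.map ((g ≫ U.ι).appLE U O h').hom := by
    intro O h h'
    rw [Ideal.map_map, ← CommRingCat.hom_comp, Scheme.Hom.appLE_comp_appLE]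
  constructor
  · rintro ⟨O, hO, a, ht, ha, h⟩
    have h' : O ≤ (g ≫ U.ι) ⁻¹ᵁ U := fun x _ => e trivial
    exact ⟨O, h', a, ht, ha, (key O hO h').symm.trans h⟩
  · rintro ⟨O, hO, a, ht, ha, h⟩
    exact ⟨O, fun x _ => trivial, a, ht, ha, (key O _ hO).trans h⟩

end Comap

/-! ### Homomorphisms from the rings of the charts -/

section ChartHom

variable {A K C : Type*} [CommRing A] [Field K] [Algebra A K] [CommRing C]

/-- The ring homomorphism `φ` makes the ideal generated by a fractional ideal `N` invertible, with
generator `f`: for a nonzero multiple `d N` consisting of elements of `A`. -/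
def IsInvertedBy (φ : A →+* C) (N : Submodule A K) (f : K) : Prop :=
  ∃ (d : K) (e : A), d ≠ 0 ∧ algebraMap A K e = d * f ∧ φ e ∈ nonZeroDivisors C ∧
    ∀ m ∈ N, ∃ a, algebraMap A K a = d * m ∧ φ e ∣ φ a

variable {φ : A →+* C} {N : Submodule A K} {f : K}

/-- The graph of the homomorphism from `A[1 / e]` induced by `φ`. -/
def chartGraph (φ : A →+* C) (K : Type*) [Field K] [Algebra A K] (e : A) : Subring (K × C) where
  carrier := {x | ∃ (n : ℕ) (a : A), algebraMap A K e ^ n * x.1 = algebraMap A K a ∧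
    φ e ^ n * x.2 = φ a}
  mul_mem' := by
    rintro x y ⟨n, a, h1, h2⟩ ⟨m, b, h3, h4⟩
    refine ⟨n + m, a * b, ?_, ?_⟩
    · rw [map_mul, ← h1, ← h3, Prod.fst_mul]; ring
    · rw [map_mul, ← h2, ← h4, Prod.snd_mul]; ring
  one_mem' := ⟨0, 1, by simp, by simp⟩
  add_mem' := by
    rintro x y ⟨n, a, h1, h2⟩ ⟨m, b, h3, h4⟩
    refine ⟨n + m, e ^ m * a + e ^ n * b, ?_, ?_⟩
    · rw [map_add, map_mul, map_mul, ← h1, ← h3, Prod.fst_add, map_pow, map_pow]; ring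
    · rw [map_add, map_mul, map_mul, ← h2, ← h4, Prod.snd_add, map_pow, map_pow]; ring
  zero_mem' := ⟨0, 0, by simp, by simp⟩
  neg_mem' := by
    rintro x ⟨n, a, h1, h2⟩
    refine ⟨n, -a, ?_, ?_⟩
    · rw [map_neg, ← h1, Prod.fst_neg, mul_neg]
    · rw [map_neg, ← h2, Prod.snd_neg, mul_neg]

lemma chartGraph_unique (hA : Function.Injective (algebraMap A K)) {e : A}
    (he : φ e ∈ nonZeroDivisors C) {b : K} {c c' : C} (h : (b, c) ∈ chartGraph φ K e)
    (h' : (b, c') ∈ chartGraph φ K e) : c = c' := by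
  obtain ⟨n, a, h1, h2⟩ := h
  obtain ⟨m, a', h3, h4⟩ := h'
  have h5 : e ^ m * a = e ^ n * a' := hA (by
    rw [map_mul, map_mul, ← h1, ← h3, map_pow, map_pow]; ring)
  have h6 := congrArg φ h5
  rw [map_mul, map_mul, ← h2, ← h4, map_pow, map_pow] at h6
  refine (mul_cancel_left_mem_nonZeroDivisors (pow_mem he (n + m))).1 ?_
  calc φ e ^ (n + m) * c = φ e ^ m * (φ e ^ n * c) := by ring
    _ = φ e ^ n * (φ e ^ m * c') := h6
    _ = φ e ^ (n + m) * c' := by ring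

lemma exists_mem_chartGraph {d : K} {e : A} (hd : d ≠ 0) (hf : f ≠ 0)
    (he : algebraMap A K e = d * f)
    (hN : ∀ m ∈ N, ∃ a, algebraMap A K a = d * m ∧ φ e ∣ φ a) {b : K} (hb : b ∈ chartRing N f) :
    ∃ c, (b, c) ∈ chartGraph φ K e := by
  have h : chartRing N f ≤ (chartGraph φ K e).map (RingHom.fst K C) := by
    refine chartRing_le_iff.2 ⟨?_, fun m hm => ?_⟩
    · rintro _ ⟨a, rfl⟩
      exact ⟨(algebraMap A K a, φ a), ⟨0, a, by simp, by simp⟩, rfl⟩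
    · obtain ⟨a, ha, q, hq⟩ := hN m hm
      refine ⟨(m / f, q), ⟨1, a, ?_, ?_⟩, rfl⟩
      · rw [he, ha]; field_simp
      · rw [pow_one, hq]
  obtain ⟨⟨b', c⟩, h1, rfl⟩ := h hb
  exact ⟨c, h1⟩

lemma IsInvertedBy.exists_hom (h : IsInvertedBy φ N f) (hf : f ≠ 0)
    (hA : Function.Injective (algebraMap A K)) :
    ∃ ψ : chartRing N f →+* C, ∀ a, ψ ⟨algebraMap A K a, range_le_chartRing N f ⟨a, rfl⟩⟩ = φ a := by
  obtain ⟨d, e, hd, he, heC, hN⟩ := h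
  choose c hc using fun b : chartRing N f => exists_mem_chartGraph hd hf he hN b.2
  have hu : ∀ (b : chartRing N f) c', ((b : K), c') ∈ chartGraph φ K e → c b = c' := fun b c' h =>
    chartGraph_unique hA heC (hc b) h
  exact ⟨{
    toFun := c
    map_one' := hu 1 1 (chartGraph φ K e).one_mem
    map_mul' := fun x y => hu (x * y) _ ((chartGraph φ K e).mul_mem (hc x) (hc y))
    map_zero' := hu 0 0 (chartGraph φ K e).zero_mem
    map_add' := fun x y => hu (x + y) _ ((chartGraph φ K e).add_mem (hc x) (hc y)) },
    fun a => hu _ _ ⟨0, a, by simp, by simp⟩⟩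

lemma IsInvertedBy.hom_ext (h : IsInvertedBy φ N f) (hf : f ≠ 0)
    {ψ ψ' : chartRing N f →+* C}
    (hψ : ∀ a, ψ ⟨algebraMap A K a, range_le_chartRing N f ⟨a, rfl⟩⟩ = φ a)
    (hψ' : ∀ a, ψ' ⟨algebraMap A K a, range_le_chartRing N f ⟨a, rfl⟩⟩ = φ a) : ψ = ψ' := by
  obtain ⟨d, e, hd, he, heC, hN⟩ := h
  ext b
  obtain ⟨c, n, a, h1, -⟩ := exists_mem_chartGraph hd hf he hN b.2
  have h2 : (⟨algebraMap A K e, range_le_chartRing N f ⟨e, rfl⟩⟩ : chartRing N f) ^ n * b =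
      ⟨algebraMap A K a, range_le_chartRing N f ⟨a, rfl⟩⟩ := Subtype.ext h1
  have key : ∀ χ : chartRing N f →+* C,
      (∀ a, χ ⟨algebraMap A K a, range_le_chartRing N f ⟨a, rfl⟩⟩ = φ a) → φ e ^ n * χ b = φ a := by
    intro χ hχ
    rw [← hχ a, ← h2, map_mul, map_pow, hχ]
  exact (mul_cancel_left_mem_nonZeroDivisors (pow_mem heC n)).1 ((key ψ hψ).trans (key ψ' hψ').symm)

end ChartHom

/-! ### The universal property of the blowup of a fractional ideal -/

section Universal

variable {T T' V : Scheme.{u}}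

lemma toSpecΓ_appLE_fromSpec (g : T ⟶ V) {U : V.Opens} (hU : IsAffineOpen U)
    (h : (⊤ : T.Opens) ≤ g ⁻¹ᵁ U) :
    T.toSpecΓ ≫ Spec.map (g.appLE U ⊤ h) ≫ hU.fromSpec = g := by
  have h1 := Scheme.Opens.toSpecΓ_SpecMap_appLE g U ⊤ h
  rw [Scheme.Opens.toSpecΓ_top] at h1
  have h2 := congrArg (· ≫ hU.fromSpec) h1
  simp only [Category.assoc, IsAffineOpen.toSpecΓ_fromSpec, Scheme.Hom.resLE_comp_ι] at h2
  have : IsIso (⊤ : T.Opens).ι := inferInstanceAs (IsIso T.topIso.hom)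
  exact (cancel_epi (⊤ : T.Opens).ι).1 h2

lemma comp_fromSpec_appLE {U : V.Opens} (hU : IsAffineOpen U) (m : T ⟶ Spec Γ(V, U))
    (h : (⊤ : T.Opens) ≤ (m ≫ hU.fromSpec) ⁻¹ᵁ U) :
    (m ≫ hU.fromSpec).appLE U ⊤ h = (Scheme.ΓSpecIso _).inv ≫ m.appTop := by
  have e : (⊤ : (Spec Γ(V, U)).Opens) ≤ hU.fromSpec ⁻¹ᵁ U := by
    rw [hU.fromSpec_preimage_self]
  have e' : (⊤ : T.Opens) ≤ m ⁻¹ᵁ ⊤ := le_rfl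
  have h1 : hU.fromSpec.appLE U ⊤ e = (Scheme.ΓSpecIso _).inv := by
    rw [Scheme.Hom.appLE, hU.fromSpec_app_self, Category.assoc, ← Functor.map_comp]
    have : (eqToHom hU.fromSpec_preimage_self).op ≫ (homOfLE e).op = 𝟙 _ := Subsingleton.elim _ _
    rw [this, CategoryTheory.Functor.map_id, Category.comp_id]
  have h2 : m.appTop = m.appLE ⊤ ⊤ e' := Scheme.Hom.app_eq_appLE _
  rw [h2, ← h1, Scheme.Hom.appLE_comp_appLE]

lemma germ_appLE (g : T ⟶ V) (U : V.Opens) (h : (⊤ : T.Opens) ≤ g ⁻¹ᵁ U) (t : T) (a : Γ(V, U)) :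
    T.presheaf.germ ⊤ t trivial (g.appLE U ⊤ h a) =
      g.stalkMap t (V.presheaf.germ U (g t) (h trivial) a) := by
  rw [Scheme.Hom.germ_stalkMap_apply g U t (h trivial) a, Scheme.Hom.appLE]
  exact T.presheaf.germ_res_apply (homOfLE h) t trivial _

/-- A morphism to the spectrum of `C` is given by a homomorphism from `C` to the global sections. -/
lemma toSpecΓ_SpecMap_appTop {C : CommRingCat.{u}} (m : T ⟶ Spec C) :
    T.toSpecΓ ≫ Spec.map ((Scheme.ΓSpecIso C).inv ≫ m.appTop) = m := by
  rw [Spec.map_comp, ← Scheme.toSpecΓ_naturality_assoc, toSpecΓ_SpecMap_ΓSpecIso_inv,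
    Category.comp_id]

namespace FracIdeal

variable [IsIntegral V] (M : FracIdeal V)

/-- The ideal `J` of sections over `U` is a nonzero multiple of the fractional ideal of sections of
`M`. -/
def IsMultiple (U : V.affineOpens) [Nonempty U.1] (J : Ideal Γ(V, U.1)) : Prop :=
  ∃ d : V.functionField, d ≠ 0 ∧ Submodule.map (Algebra.linearMap Γ(V, U.1) V.functionField) J =
    (M.sec U).map (LinearMap.mulLeft Γ(V, U.1) d)

lemma injective_algebraMap (U : V.affineOpens) [Nonempty U.1] :
    Function.Injective (algebraMap Γ(V, U.1) V.functionField) :=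
  Scheme.germToFunctionField_injective V U.1

/-- The inverse image of `M` on `T` is generated by `f`, which is not a zero divisor in any local
ring: more precisely, this holds for a nonzero multiple `d M`, given by elements of `Γ(V, U)`. -/
def Inverts (g : T ⟶ V) (U : V.affineOpens) [Nonempty U.1] (f : V.functionField) : Prop :=
  f ∈ M.sec U ∧ f ≠ 0 ∧ ∃ (h : (⊤ : T.Opens) ≤ g ⁻¹ᵁ U.1) (d : V.functionField) (e : Γ(V, U.1)),
    d ≠ 0 ∧ algebraMap _ V.functionField e = d * f ∧
    (∀ (t : T) (ht : t ∈ (⊤ : T.Opens)), T.presheaf.germ ⊤ t ht (g.appLE U.1 ⊤ h e) ∈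
      nonZeroDivisors (T.presheaf.stalk t)) ∧
    ∀ m ∈ M.sec U, ∃ a, algebraMap _ V.functionField a = d * m ∧
      g.appLE U.1 ⊤ h e ∣ g.appLE U.1 ⊤ h a

variable {M} {g : T ⟶ V} {U : V.affineOpens} [Nonempty U.1] {f : V.functionField}

lemma Inverts.comp (i : T' ⟶ T) [IsOpenImmersion i] (H : M.Inverts g U f) :
    M.Inverts (i ≫ g) U f := by
  obtain ⟨hf, hf0, h, d, e, hd, he, heT, hdvd⟩ := H
  have e1 : (⊤ : T'.Opens) ≤ i ⁻¹ᵁ ⊤ := le_rfl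
  have key : (i ≫ g).appLE U.1 ⊤ (fun x _ => h trivial) = g.appLE U.1 ⊤ h ≫ i.appLE ⊤ ⊤ e1 :=
    (Scheme.Hom.appLE_comp_appLE i g U.1 ⊤ ⊤ h e1).symm
  refine ⟨hf, hf0, fun x _ => h trivial, d, e, hd, he, fun t ht => ?_, fun m hm => ?_⟩
  · rw [key]
    have h1 := germ_app_mem_nonZeroDivisors i heT t ht
    rw [Scheme.Hom.app_eq_appLE] at h1
    exact h1
  · obtain ⟨a, ha, hea⟩ := hdvd m hm
    refine ⟨a, ha, ?_⟩
    rw [key]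
    exact map_dvd (i.appLE ⊤ ⊤ e1).hom hea

lemma Inverts.exists_isInvertedBy (H : M.Inverts g U f) :
    ∃ h : (⊤ : T.Opens) ≤ g ⁻¹ᵁ U.1, IsInvertedBy (g.appLE U.1 ⊤ h).hom (M.sec U) f := by
  obtain ⟨-, -, h, d, e, hd, he, heT, hdvd⟩ := H
  exact ⟨h, d, e, hd, he, mem_nonZeroDivisors_of_germ fun t ht => heT t ht, hdvd⟩

variable [V.IsSeparated] {X : M.Model}

/-- If the inverse image of `M` on `T` is generated by `f`, then morphisms from `T` to the blowup
factor through the chart `A[M / f]`. -/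
lemma Inverts.mem_range_ι {h : T ⟶ X.W} (H : M.Inverts (h ≫ X.π) U f) (t : T) :
    h t ∈ Set.range (X.ι _ (chartRing_mem_charts H.1 H.2.1)) := by
  obtain ⟨hf, hf0, hU, d, e, hd, he, heT, hdvd⟩ := id H
  have htU : X.π (h t) ∈ U.1 := hU (x := t) trivial
  obtain ⟨f₁, hf₁, hf₁0, hM⟩ := isPrincipalAt_π X (h t) U htU
  obtain ⟨e₁, he₁, b, hb⟩ := hdvd f₁ hf₁
  obtain ⟨ξ, hξ⟩ := hM f hf
  let β : Γ(V, U.1) →+* X.W.presheaf.stalk (h t) :=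
    (X.π.stalkMap (h t)).hom.comp (V.presheaf.germ U.1 (X.π (h t)) htU).hom
  have hβ : ∀ a, functionFieldMap X.π (algebraMap _ V.functionField a) =
      algebraMap _ X.W.functionField (β a) := by
    intro a
    refine Eq.trans (congrArg _ ?_) (functionFieldMap_algebraMap X.π (h t) _)
    exact (Scheme.algebraMap_germ_eq_germToFunctionField V htU a).symm
  have h1 : β e = ξ * β e₁ := by
    refine IsFractionRing.injective (X.W.presheaf.stalk (h t)) X.W.functionField ?_
    rw [map_mul, ← hβ, ← hβ, hξ, ← map_mul, he, he₁]
    congr 1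
    field_simp
  have hθ : ∀ a, h.stalkMap t (β a) =
      T.presheaf.germ ⊤ t trivial ((h ≫ X.π).appLE U.1 ⊤ hU a) := by
    intro a
    rw [germ_appLE, Scheme.Hom.stalkMap_comp]
    rfl
  -- On `T` the function `e` divides `e₁`, so that the quotient `ξ` of `f` by the generator `f₁` is a
  -- unit at the image of `t`.
  have h2 := congrArg (h.stalkMap t) h1
  rw [map_mul, hθ, hθ, hb, map_mul] at h2
  have h3 : h.stalkMap t ξ * T.presheaf.germ ⊤ t trivial b = 1 := by
    refine (mul_cancel_left_mem_nonZeroDivisors (heT t trivial)).1 ?_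
    rw [mul_one]
    refine Eq.trans ?_ h2.symm
    ring
  have h4 : IsUnit ξ := isUnit_of_map_unit (h.stalkMap t).hom ξ (IsUnit.of_mul_eq_one _ h3)
  obtain ⟨u, rfl⟩ := h4
  have h5 : (f / f₁)⁻¹ ∈ locRing X.π (h t) := by
    refine ⟨↑u⁻¹, ?_⟩
    rw [map_inv₀, ← hξ]
    refine eq_inv_of_mul_eq_one_left ?_
    rw [← map_mul, Units.inv_mul, map_one]
  refine (mem_range_ι_iff hf hf0).2 ⟨htU, fun m hm => ?_⟩
  have h6 : m / f = m / f₁ * (f / f₁)⁻¹ := by field_simp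
  rw [h6]
  exact (locRing X.π (h t)).mul_mem (hM m hm) h5

/-- The inclusion of the ring of an affine open set in the ring of a chart above it. -/
def toChartRing (U : V.affineOpens) [Nonempty U.1] (N : Submodule Γ(V, U.1) V.functionField)
    (f : V.functionField) : Γ(V, U.1) →+* chartRing N f :=
  (algebraMap Γ(V, U.1) V.functionField).codRestrict (chartRing N f) fun a =>
    range_le_chartRing N f ⟨a, rfl⟩

lemma ι_π_chartRing (hf : f ∈ M.sec U) (hf0 : f ≠ 0) :
    X.ι _ (chartRing_mem_charts hf hf0) ≫ X.π =
      Spec.map (CommRingCat.ofHom (toChartRing U (M.sec U) f)) ≫ U.2.fromSpec :=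
  ι_π (range_le_chartRing (M.sec U) f)

lemma Inverts.exists_lift (H : M.Inverts g U f) : ∃ h : T ⟶ X.W, h ≫ X.π = g := by
  obtain ⟨hf, hf0, -⟩ := id H
  obtain ⟨h, hI⟩ := H.exists_isInvertedBy
  obtain ⟨ψ, hψ⟩ := hI.exists_hom hf0 (injective_algebraMap U)
  refine ⟨T.toSpecΓ ≫ Spec.map (CommRingCat.ofHom ψ) ≫ X.ι _ (chartRing_mem_charts hf hf0), ?_⟩
  rw [Category.assoc, Category.assoc, ι_π_chartRing hf hf0, ← Spec.map_comp_assoc]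
  have : CommRingCat.ofHom (toChartRing U (M.sec U) f) ≫ CommRingCat.ofHom ψ =
      g.appLE U.1 ⊤ h := by
    ext a; exact hψ a
  rw [this]
  exact toSpecΓ_appLE_fromSpec g U.2 h

lemma Inverts.lift_unique {h h' : T ⟶ X.W} (hh : h ≫ X.π = h' ≫ X.π)
    (H : M.Inverts (h ≫ X.π) U f) : h = h' := by
  obtain ⟨hf, hf0, -⟩ := id H
  obtain ⟨hU, hI⟩ := H.exists_isInvertedBy
  have H' : M.Inverts (h' ≫ X.π) U f := hh ▸ H
  have hr : Set.range h ⊆ Set.range (X.ι _ (chartRing_mem_charts hf hf0)) := by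
    rintro _ ⟨t, rfl⟩; exact H.mem_range_ι t
  have hr' : Set.range h' ⊆ Set.range (X.ι _ (chartRing_mem_charts hf hf0)) := by
    rintro _ ⟨t, rfl⟩; exact H'.mem_range_ι t
  have key : ∀ k : T ⟶ Spec (.of (chartRing (M.sec U) f)),
      k ≫ X.ι _ (chartRing_mem_charts hf hf0) ≫ X.π = h ≫ X.π → ∀ a,
      ((Scheme.ΓSpecIso _).inv ≫ k.appTop).hom
        ⟨algebraMap _ V.functionField a, range_le_chartRing (M.sec U) f ⟨a, rfl⟩⟩ =
      (h ≫ X.π).appLE U.1 ⊤ hU a := by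
    intro k hk a
    rw [ι_π_chartRing hf hf0, ← Category.assoc] at hk
    have h1 := comp_fromSpec_appLE U.2
      (k ≫ Spec.map (CommRingCat.ofHom (toChartRing U (M.sec U) f))) (by rw [hk]; exact hU)
    simp only [hk] at h1
    rw [h1, Scheme.Hom.comp_appTop, ← Category.assoc, ← Scheme.ΓSpecIso_inv_naturality,
      Category.assoc]
    rfl
  rw [← IsOpenImmersion.lift_fac _ h hr, ← IsOpenImmersion.lift_fac _ h' hr']
  congr 1
  rw [← toSpecΓ_SpecMap_appTop (IsOpenImmersion.lift _ h hr),
    ← toSpecΓ_SpecMap_appTop (IsOpenImmersion.lift _ h' hr')]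
  congr 2
  ext1
  refine hI.hom_ext hf0 (key _ ?_) (key _ ?_)
  · rw [← Category.assoc, IsOpenImmersion.lift_fac]
  · rw [← Category.assoc, IsOpenImmersion.lift_fac, hh]

end FracIdeal

/-- An invertible ideal is locally generated by one of the given generators. -/
lemma IsPrincipalNear.exists_generator {g : T ⟶ V} {U : V.Opens} {J : Ideal Γ(V, U)} {t : T}
    (h : IsPrincipalNear g U J t) : ∃ (O : T.Opens) (hO : O ≤ g ⁻¹ᵁ U), t ∈ O ∧ ∃ e ∈ J,
      (∀ (x : T) (hx : x ∈ O), T.presheaf.germ O x hx (g.appLE U O hO e) ∈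
        nonZeroDivisors (T.presheaf.stalk x)) ∧ ∀ a ∈ J, g.appLE U O hO e ∣ g.appLE U O hO a := by
  obtain ⟨O, hO, a, ht, ha, haJ⟩ := h
  have haC := mem_nonZeroDivisors_of_germ ha
  set φ := (g.appLE U O hO).hom with hφ
  have h1 : ∀ j ∈ J, ∃ c, φ j = a * c := fun j hj =>
    Ideal.mem_span_singleton.1 (haJ ▸ Ideal.mem_map_of_mem φ hj)
  obtain ⟨e, he, c, hc, hcu⟩ : ∃ e ∈ J, ∃ c, φ e = a * c ∧ IsUnit (T.presheaf.germ O t ht c) := by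
    by_contra! hcon
    have key : ∀ x ∈ J.map φ, ∃ c, x = a * c ∧
        T.presheaf.germ O t ht c ∈ IsLocalRing.maximalIdeal (T.presheaf.stalk t) := by
      intro x hx
      induction hx using Submodule.span_induction with
      | mem x hx =>
        obtain ⟨j, hj, rfl⟩ := hx
        obtain ⟨c, hc⟩ := h1 j hj
        exact ⟨c, hc, hcon j hj c hc⟩
      | zero => exact ⟨0, by simp, by rw [map_zero]; exact Ideal.zero_mem _⟩
      | add x y _ _ hx hy =>
        obtain ⟨c, rfl, hc⟩ := hx
        obtain ⟨c', rfl, hc'⟩ := hy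
        exact ⟨c + c', by ring, by rw [map_add]; exact Ideal.add_mem _ hc hc'⟩
      | smul b x _ hx =>
        obtain ⟨c, rfl, hc⟩ := hx
        exact ⟨b * c, by rw [smul_eq_mul]; ring, by rw [map_mul]; exact Ideal.mul_mem_left _ _ hc⟩
    obtain ⟨c, hc, hcm⟩ := key a (haJ ▸ Ideal.mem_span_singleton_self a)
    have hc1 : c = 1 := (mul_cancel_left_mem_nonZeroDivisors haC).1 (by rw [← hc, mul_one])
    rw [hc1, map_one] at hcm
    exact (Ideal.ne_top_iff_one _).1 (IsLocalRing.maximalIdeal.isMaximal _).ne_top hcm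
  have hle := T.basicOpen_le c
  have hres : ∀ j, g.appLE U (T.basicOpen c) (hle.trans hO) j =
      T.presheaf.map (homOfLE hle).op (φ j) := by
    intro j
    rw [← Scheme.Hom.appLE_map g hO (homOfLE hle).op]
    rfl
  have hu : IsUnit (T.presheaf.map (homOfLE hle).op c) := T.toRingedSpace.isUnit_res_basicOpen c
  refine ⟨T.basicOpen c, hle.trans hO, (T.mem_basicOpen c t ht).2 hcu, e, he, fun x hx => ?_,
    fun j hj => ?_⟩
  · rw [hres, hc, map_mul, map_mul]
    exact mul_mem (germ_map_mem_nonZeroDivisors hle ha x hx) (hu.map _).mem_nonZeroDivisors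
  · obtain ⟨c', hc'⟩ := h1 j hj
    rw [hres, hres, hc, hc', map_mul, map_mul]
    exact mul_dvd_mul_left _ hu.dvd

namespace FracIdeal

variable [IsIntegral V] {M : FracIdeal V} {g : T ⟶ V}

lemma exists_inverts {U : V.affineOpens} [Nonempty U.1] {J : Ideal Γ(V, U.1)}
    (hJ : M.IsMultiple U J) {t : T} (h : IsPrincipalNear g U.1 J t) :
    ∃ (O : T.Opens) (f : V.functionField), t ∈ O ∧ M.Inverts (O.ι ≫ g) U f := by
  obtain ⟨O, hO, ht, e, he, heT, hdvd⟩ := h.exists_generator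
  obtain ⟨d, hd, hJd⟩ := hJ
  obtain ⟨f, hf, hdf⟩ : algebraMap _ V.functionField e ∈ (M.sec U).map (LinearMap.mulLeft _ d) :=
    hJd ▸ ⟨e, he, rfl⟩
  have hf0 : f ≠ 0 := by
    rintro rfl
    rw [map_zero, eq_comm, map_eq_zero_iff _ (injective_algebraMap U)] at hdf
    have := heT t ht
    rw [hdf, map_zero, map_zero] at this
    exact zero_notMem_nonZeroDivisors this
  have e1 : (⊤ : Scheme.Opens O) ≤ O.ι ⁻¹ᵁ O := by simp
  have key : (O.ι ≫ g).appLE U.1 ⊤ (fun x _ => hO (e1 trivial)) =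
      g.appLE U.1 O hO ≫ O.ι.appLE O ⊤ e1 := (Scheme.Hom.appLE_comp_appLE O.ι g _ _ _ hO e1).symm
  refine ⟨O, f, ht, hf, hf0, fun x _ => hO (e1 trivial), d, e, hd, hdf.symm, fun x hx => ?_,
    fun m hm => ?_⟩
  · rw [key]
    have h1 := germ_app_mem_nonZeroDivisors O.ι heT x (e1 trivial)
    rw [← TopCat.Presheaf.germ_res_apply _ (homOfLE e1) x trivial] at h1
    exact h1
  · obtain ⟨a, ha, hda⟩ : d * m ∈ Submodule.map (Algebra.linearMap Γ(V, U.1) V.functionField) J :=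
      hJd ▸ ⟨m, hm, rfl⟩
    refine ⟨a, hda, ?_⟩
    rw [key]
    exact map_dvd (O.ι.appLE O ⊤ e1).hom (hdvd a ha)

/-- The universal property of the blowup of a fractional ideal sheaf. -/
theorem existsUnique_lift [hV : V.IsSeparated] (X : M.Model) (g : T ⟶ V)
    (h : ∀ t, ∃ (U : V.affineOpens) (_ : Nonempty U.1) (J : Ideal Γ(V, U.1)),
      M.IsMultiple U J ∧ IsPrincipalNear g U.1 J t) : ∃! h : T ⟶ X.W, h ≫ X.π = g := by
  have h' : ∀ t, ∃ (O : T.Opens) (U : V.affineOpens) (_ : Nonempty U.1) (f : V.functionField),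
      t ∈ O ∧ M.Inverts (O.ι ≫ g) U f := by
    intro t
    obtain ⟨U, hU, J, hJ, ht⟩ := h t
    obtain ⟨O, f, hO, hf⟩ := exists_inverts hJ ht
    exact ⟨O, U, hU, f, hO, hf⟩
  choose O U hU f ht hO using h'
  choose l hl using fun t => (hO t).exists_lift (X := X)
  let 𝒰 : T.OpenCover :=
    { I₀ := T
      X := fun t => O t
      f := fun t => (O t).ι
      mem₀ := by
        rw [Scheme.presieve₀_mem_precoverage_iff]
        exact ⟨fun x => ⟨x, by simpa using ht x⟩, inferInstance⟩ }
  have hglue : ∀ x y, Limits.pullback.fst (𝒰.f x) (𝒰.f y) ≫ l x =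
      Limits.pullback.snd (𝒰.f x) (𝒰.f y) ≫ l y := by
    intro x y
    refine Inverts.lift_unique (U := U x) (f := f x) ?_ ?_
    · rw [Category.assoc, Category.assoc, hl, hl, ← Category.assoc, ← Category.assoc]
      exact congrArg (· ≫ g) Limits.pullback.condition
    · rw [Category.assoc, hl]
      exact (hO x).comp (Limits.pullback.fst (𝒰.f x) (𝒰.f y))
  refine ⟨𝒰.glueMorphisms l hglue, ?_, fun m hm => ?_⟩
  · refine 𝒰.hom_ext _ _ fun x => ?_
    rw [Scheme.Cover.ι_glueMorphisms_assoc]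
    exact hl x
  · refine 𝒰.hom_ext _ _ fun x => ?_
    rw [Scheme.Cover.ι_glueMorphisms]
    refine Inverts.lift_unique (U := U x) (f := f x) ?_ ?_
    · rw [hl, Category.assoc, hm]
    · rw [Category.assoc, hm]; exact hO x

end FracIdeal

end Universal

/-! ### Blowups of ideal sheaves as blowups of fractional ideal sheaves -/

section Blowup

variable {V T : Scheme.{u}} [IsIntegral V]

/-- The elements of a finitely generated submodule of the fraction field have a common denominator. -/
lemma exists_mul_mem_range {A K : Type*} [CommRing A] [Field K] [Algebra A K] [IsFractionRing A K]
    [IsDomain A] {N : Submodule A K} (h : N.FG) :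
    ∃ d : K, d ≠ 0 ∧ d ∈ (algebraMap A K).range ∧ ∀ m ∈ N, d * m ∈ (algebraMap A K).range := by
  obtain ⟨s, rfl⟩ := h
  obtain ⟨b, hb⟩ := IsLocalization.exist_integer_multiples_of_finset (nonZeroDivisors A) s
  refine ⟨algebraMap A K b, ?_, ⟨b, rfl⟩, fun m hm => ?_⟩
  · exact IsFractionRing.to_map_ne_zero_of_mem_nonZeroDivisors b.2
  · induction hm using Submodule.span_induction with
    | mem x hx =>
      obtain ⟨a, ha⟩ := hb x hx
      exact ⟨a, by rw [ha, Algebra.smul_def]⟩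
    | zero => rw [mul_zero]; exact Subring.zero_mem _
    | add x y _ _ hx hy => rw [mul_add]; exact Subring.add_mem _ hx hy
    | smul a x _ hx =>
      rw [Algebra.smul_def, mul_left_comm]
      exact Subring.mul_mem _ ⟨a, rfl⟩ hx

namespace FracIdeal

variable {M : FracIdeal V}

lemma exists_isMultiple (U : V.affineOpens) [Nonempty U.1] : ∃ J, M.IsMultiple U J := by
  have : IsFractionRing Γ(V, U.1) V.functionField :=
    functionField_isFractionRing_of_isAffineOpen V U.1 U.2
  obtain ⟨d, hd, -, h⟩ := exists_mul_mem_range (M.fg U)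
  refine ⟨Submodule.comap (Algebra.linearMap Γ(V, U.1) V.functionField)
    ((M.sec U).map (LinearMap.mulLeft Γ(V, U.1) d)), d, hd, ?_⟩
  rw [Submodule.map_comap_eq, inf_eq_right]
  rintro _ ⟨m, hm, rfl⟩
  exact h m hm

lemma IsMultiple.ne_bot {U : V.affineOpens} [Nonempty U.1] {J : Ideal Γ(V, U.1)}
    (h : M.IsMultiple U J) : J ≠ ⊥ := by
  rintro rfl
  obtain ⟨d, hd, h⟩ := h
  rw [Submodule.map_bot] at h
  refine M.ne_bot U ((Submodule.eq_bot_iff _).2 fun m hm => ?_)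
  have h1 : d * m ∈ (M.sec U).map (LinearMap.mulLeft Γ(V, U.1) d) := ⟨m, hm, rfl⟩
  rw [← h, Submodule.mem_bot] at h1
  exact (mul_eq_zero.1 h1).resolve_left hd

variable [IsIntegral T] {g : T ⟶ V} [IsDominant g]

/-- If the inverse image of `M` on an integral scheme is principal in the local ring at `t`, then it is
so in a neighbourhood of `t`. -/
lemma isPrincipalNear {t : T} (h : M.IsPrincipalAt g t) {U : V.affineOpens} [Nonempty U.1]
    (ht : g t ∈ U.1) {J : Ideal Γ(V, U.1)} (hJ : M.IsMultiple U J) :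
    IsPrincipalNear g U.1 J t := by
  obtain ⟨f, hf, hf0, hfM⟩ := h U ht
  obtain ⟨d, hd, hJd⟩ := hJ
  obtain ⟨e, he, hef⟩ : d * f ∈ Submodule.map (Algebra.linearMap Γ(V, U.1) V.functionField) J :=
    hJd ▸ ⟨f, hf, rfl⟩
  have hef' : algebraMap Γ(V, U.1) V.functionField e = d * f := hef
  obtain ⟨s, hs⟩ := M.fg U
  -- The quotients `m / f` extend to a common neighbourhood of `t`, as `M` is finitely generated.
  have hext : ∀ s' ⊆ s, ∃ O ≤ g ⁻¹ᵁ U.1, ∃ (_ : t ∈ O), ∀ (_ : Nonempty O), ∀ m ∈ s',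
      ∃ b : Γ(T, O), algebraMap _ T.functionField b = functionFieldMap g (m / f) := by
    classical
    intro s'
    induction s' using Finset.induction_on with
    | empty => exact fun _ => ⟨g ⁻¹ᵁ U.1, le_rfl, ht, fun _ m hm => by simp at hm⟩
    | insert m s' _ ih =>
      intro hss
      obtain ⟨O, hO, htO, ih⟩ := ih ((Finset.subset_insert _ _).trans hss)
      have hm : m ∈ M.sec U := hs ▸ Submodule.subset_span (hss (Finset.mem_insert_self _ _))
      obtain ⟨α, hα⟩ := hfM m hm
      obtain ⟨O₁, ht₁, b₁, rfl⟩ := T.presheaf.exists_germ_eq α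
      refine ⟨O ⊓ O₁, inf_le_left.trans hO, ⟨htO, ht₁⟩, fun _ m' hm' => ?_⟩
      have : Nonempty O := ⟨⟨t, htO⟩⟩
      have : Nonempty O₁ := ⟨⟨t, ht₁⟩⟩
      rcases Finset.mem_insert.1 hm' with rfl | hm'
      · obtain ⟨b, hb⟩ := range_algebraMap_le_of_le (U := O₁) (U' := O ⊓ O₁) inf_le_right ⟨b₁, rfl⟩
        refine ⟨b, hb.trans (Eq.trans ?_ hα)⟩
        exact (Scheme.algebraMap_germ_eq_germToFunctionField T ht₁ b₁).symm
      · obtain ⟨b, hb⟩ := ih inferInstance m' hm'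
        obtain ⟨b', hb'⟩ := range_algebraMap_le_of_le (U := O) (U' := O ⊓ O₁) inf_le_left ⟨b, rfl⟩
        exact ⟨b', hb'.trans hb⟩
  obtain ⟨O, hO, htO, hext⟩ := hext s subset_rfl
  have : Nonempty O := ⟨⟨t, htO⟩⟩
  have hφ : ∀ a, algebraMap _ T.functionField (g.appLE U.1 O hO a) =
      functionFieldMap g (algebraMap _ V.functionField a) := fun a =>
    (functionFieldMap_germ g U.1 O hO a).symm
  have hall : ∀ m ∈ M.sec U,
      ∃ b : Γ(T, O), algebraMap _ T.functionField b = functionFieldMap g (m / f) := by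
    intro m hm
    rw [← hs] at hm
    induction hm using Submodule.span_induction with
    | mem x hx => exact hext inferInstance x hx
    | zero => exact ⟨0, by rw [zero_div, map_zero, map_zero]⟩
    | add x y _ _ hx hy =>
      obtain ⟨b, hb⟩ := hx
      obtain ⟨b', hb'⟩ := hy
      exact ⟨b + b', by rw [add_div, map_add, map_add, hb, hb']⟩
    | smul c x _ hx =>
      obtain ⟨b, hb⟩ := hx
      exact ⟨g.appLE U.1 O hO c * b, by
        rw [Algebra.smul_def, mul_div_assoc, map_mul, map_mul, hb, hφ]⟩
  have hinj : Function.Injective (algebraMap Γ(T, O) T.functionField) :=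
    Scheme.germToFunctionField_injective T O
  refine ⟨O, hO, g.appLE U.1 O hO e, htO, fun x hx => mem_nonZeroDivisors_of_ne_zero ?_, ?_⟩
  · intro h0
    have h1 := Scheme.algebraMap_germ_eq_germToFunctionField T hx (g.appLE U.1 O hO e)
    rw [h0, map_zero] at h1
    have h2 := hφ e
    rw [hef', show algebraMap Γ(T, O) T.functionField (g.appLE U.1 O hO e) = 0 from h1.symm,
      eq_comm, map_eq_zero] at h2
    exact mul_ne_zero hd hf0 h2
  · refine le_antisymm (Ideal.map_le_iff_le_comap.2 fun a ha => ?_)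
      ((Ideal.span_singleton_le_iff_mem _).2 (Ideal.mem_map_of_mem _ he))
    obtain ⟨m, hm, hdm⟩ : algebraMap _ V.functionField a ∈
      (M.sec U).map (LinearMap.mulLeft Γ(V, U.1) d) := hJd ▸ ⟨a, ha, rfl⟩
    obtain ⟨b, hb⟩ := hall m hm
    refine Ideal.mem_span_singleton.2 ⟨b, hinj ?_⟩
    have hdm' : algebraMap _ V.functionField a = d * m := hdm.symm
    refine (hφ a).trans ?_
    rw [map_mul, hφ, hef', hb, ← map_mul, hdm']
    congr 1
    field_simp

lemma existsUnique_lift_of_isPrincipalAt [V.IsSeparated] (X : M.Model)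
    (h : ∀ t, M.IsPrincipalAt g t) : ∃! h : T ⟶ X.W, h ≫ X.π = g := by
  refine existsUnique_lift X g fun t => ?_
  obtain ⟨U, hU, ht, -⟩ := exists_isAffineOpen_mem_and_subset (x := g t) (U := ⊤) trivial
  have : Nonempty U := ⟨⟨_, ht⟩⟩
  obtain ⟨J, hJ⟩ := exists_isMultiple (M := M) ⟨U, hU⟩
  exact ⟨⟨U, hU⟩, inferInstance, J, hJ, isPrincipalNear (h t) (U := ⟨U, hU⟩) ht hJ⟩

end FracIdeal

lemma ideal_ne_bot {I : V.IdealSheafData} (hI : I ≠ ⊥) (U : V.affineOpens) [Nonempty U.1] :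
    I.ideal U ≠ ⊥ := by
  intro h
  refine hI (Scheme.IdealSheafData.ext (funext fun U' => ?_))
  rw [Scheme.IdealSheafData.ideal_bot, Pi.bot_apply]
  by_cases hU' : Nonempty U'.1
  · obtain ⟨D, _, -, h1, h2, -, -⟩ := exists_isAway_range (genericPoint_mem U.1)
      (genericPoint_mem U'.1)
    refine (Submodule.eq_bot_iff _).2 fun a ha => ?_
    have h3 : V.presheaf.map (homOfLE h2).op a ∈ I.ideal D :=
      I.ideal_le_comap_ideal (U := D) (V := U') h2 ha
    rw [← I.map_ideal (U := D) (V := U) h1, h, Ideal.map_bot, Ideal.mem_bot] at h3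
    refine FracIdeal.injective_algebraMap U' ?_
    rw [map_zero, ← map_zero (algebraMap Γ(V, D.1) V.functionField), ← h3]
    exact (V.presheaf.germ_res_apply (homOfLE h2) _ _ a).symm
  · have : Subsingleton Γ(V, U'.1) := by
      have h4 : U'.1 = ⊥ := by
        ext x; exact ⟨fun hx => (hU' ⟨⟨x, hx⟩⟩).elim, fun hx => hx.elim⟩
      rw [h4]
      infer_instance
    exact Subsingleton.elim _ _

/-- A nonzero ideal sheaf as a fractional ideal sheaf. -/
def FracIdeal.ofIdeal [IsLocallyNoetherian V] (I : V.IdealSheafData) (hI : I ≠ ⊥) :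
    FracIdeal V where
  sec U _ := sections I U
  fg U _ := by
    have := IsLocallyNoetherian.component_noetherian U
    exact (IsNoetherian.noetherian (I.ideal U)).map _
  ne_bot U _ h := ideal_ne_bot hI U
    ((Submodule.map_injective_of_injective (f := Algebra.linearMap Γ(V, U.1) V.functionField)
      (FracIdeal.injective_algebraMap U)) (h.trans (Submodule.map_bot _).symm))
  span_eq U U' _ _ h := by
    have hres : ∀ a, algebraMap Γ(V, U'.1) V.functionField (V.presheaf.map (homOfLE h).op a) =
        algebraMap Γ(V, U.1) V.functionField a := fun a =>
      V.presheaf.germ_res_apply (homOfLE h) _ _ a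
    rw [sections, sections, ← I.map_ideal (U := U') (V := U) h]
    refine le_antisymm (Submodule.span_le.2 ?_) (Submodule.map_le_iff_le_comap.2 ?_)
    · rintro _ ⟨a, ha, rfl⟩
      exact ⟨_, Ideal.mem_map_of_mem _ ha, hres a⟩
    · refine Submodule.span_le.2 ?_
      rintro _ ⟨a, ha, rfl⟩
      exact Submodule.subset_span ⟨a, ha, (hres a).symm⟩

lemma FracIdeal.isMultiple_ofIdeal [IsLocallyNoetherian V] (I : V.IdealSheafData) (hI : I ≠ ⊥)
    (U : V.affineOpens) [Nonempty U.1] : (FracIdeal.ofIdeal I hI).IsMultiple U (I.ideal U) := by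
  refine ⟨1, one_ne_zero, ?_⟩
  rw [LinearMap.mulLeft_one, Submodule.map_id]
  rfl

lemma FracIdeal.isBlowup_ofIdeal [IsLocallyNoetherian V] [V.IsSeparated] {I : V.IdealSheafData}
    {hI : I ≠ ⊥} (X : (FracIdeal.ofIdeal I hI).Model) : IsBlowup I X.π := by
  constructor
  · refine isInvertible_comap_of_isPrincipalNear fun t => ?_
    obtain ⟨U, hU, ht, -⟩ := exists_isAffineOpen_mem_and_subset (x := X.π t) (U := ⊤) trivial
    have : Nonempty U := ⟨⟨_, ht⟩⟩
    exact ⟨⟨U, hU⟩, isPrincipalNear (isPrincipalAt_π X t) (U := ⟨U, hU⟩) ht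
      (isMultiple_ofIdeal I hI _)⟩
  · intro T g hg
    refine existsUnique_lift X g fun t => ?_
    obtain ⟨U, hU, ht, -⟩ := exists_isAffineOpen_mem_and_subset (x := g t) (U := ⊤) trivial
    have : Nonempty U := ⟨⟨_, ht⟩⟩
    exact ⟨⟨U, hU⟩, inferInstance, _, isMultiple_ofIdeal I hI _,
      hg.isPrincipalNear ⟨U, hU⟩ ht⟩

/-- The blowup of a fractional ideal sheaf is locally on the target the blowup of an ideal sheaf,
because a fractional ideal is locally a multiple of an ideal. -/
lemma FracIdeal.isLocallyBlowup_π {M : FracIdeal V} [V.IsSeparated] (X : M.Model) :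
    IsLocallyBlowup X.π := by
  intro x
  obtain ⟨U, hU, hx, -⟩ := exists_isAffineOpen_mem_and_subset (x := x) (U := ⊤) trivial
  have : Nonempty U := ⟨⟨_, hx⟩⟩
  have : IsAffine U := hU
  obtain ⟨J, hJ⟩ := exists_isMultiple (M := M) ⟨U, hU⟩
  have e : (⊤ : Scheme.Opens U) ≤ U.ι ⁻¹ᵁ U := by simp
  let J₀ : U.toScheme.IdealSheafData := Scheme.IdealSheafData.ofIdealTop
    (J.map (U.ι.appLE U ⊤ e).hom)
  have hJ₀ : J₀.ideal ⟨⊤, isAffineOpen_top _⟩ = J.map (U.ι.appLE U ⊤ e).hom :=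
    Scheme.IdealSheafData.equivOfIsAffine.apply_symm_apply _
  have he : IsIso (U.ι.appLE U ⊤ e) := by
    have h4 : U.ι.appLE U ⊤ e = U.topIso.inv := by rw [Scheme.Opens.ι_appLE]; rfl
    rw [h4]; infer_instance
  refine ⟨U, hx, J₀, fun h0 => hJ.ne_bot ?_, ?_, ?_⟩
  · rw [h0, Scheme.IdealSheafData.ideal_bot, Pi.bot_apply, eq_comm] at hJ₀
    exact (Ideal.map_eq_bot_iff_of_injective (ConcreteCategory.bijective_of_isIso _).1).1 hJ₀
  · refine isInvertible_comap_of_isPrincipalNear fun t => ⟨⟨⊤, isAffineOpen_top _⟩, ?_⟩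
    rw [hJ₀, isPrincipalNear_map_ι, morphismRestrict_ι]
    exact (isPrincipalNear (isPrincipalAt_π X _) (U := ⟨U, hU⟩) t.2 hJ).comp _
  · intro T g hg
    have h1 : ∃! h : T ⟶ X.W, h ≫ X.π = g ≫ U.ι := by
      refine existsUnique_lift X _ fun t => ⟨⟨U, hU⟩, inferInstance, J, hJ, ?_⟩
      rw [← isPrincipalNear_map_ι e, ← hJ₀]
      exact hg.isPrincipalNear ⟨⊤, isAffineOpen_top _⟩ trivial
    obtain ⟨h, hh, huniq⟩ := h1
    have hpb := (isPullback_morphismRestrict X.π U).flip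
    refine ⟨hpb.lift h g hh, hpb.lift_snd _ _ _, fun l hl => hpb.hom_ext ?_ ?_⟩
    · rw [hpb.lift_fst]
      refine huniq _ ?_
      dsimp only
      rw [Category.assoc, hpb.w, ← Category.assoc, hl]
    · rw [hpb.lift_snd, hl]

end Blowup

/-! ### A determinantal criterion for freeness -/

section Free

/-- A module that spans `K^r` is free over a local domain `R` with fraction field `K` iff the
determinants of `r`-tuples of generators are all multiples of a nonzero one; in that case this
`r`-tuple is a basis by Cramer's rule. -/
lemma free_span_iff {R K : Type*} [CommRing R] [IsDomain R] [IsLocalRing R] [Field K] [Algebra R K]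
    [IsFractionRing R K] {r : ℕ} {S : Set (Fin r → K)} (hS : Submodule.span K S = ⊤) :
    Module.Free R (Submodule.span R S) ↔ ∃ p : Fin r → Fin r → K, (∀ i, p i ∈ S) ∧
      (Matrix.of p).det ≠ 0 ∧ ∀ q : Fin r → Fin r → K, (∀ i, q i ∈ S) →
        ∃ a : R, algebraMap R K a * (Matrix.of p).det = (Matrix.of q).det := by
  constructor
  · intro hfree
    let β := Module.Free.chooseBasis R (Submodule.span R S)
    set ι := Module.Free.ChooseBasisIndex R (Submodule.span R S)
    let v : ι → Fin r → K := fun j => (β j : Fin r → K)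
    have hv : LinearIndependent K v := by
      rw [← LinearIndependent.iff_fractionRing R K]
      exact β.linearIndependent.map' (Submodule.subtype _) (Submodule.ker_subtype _)
    have hvS : Submodule.span R (Set.range v) = Submodule.span R S := by
      have h1 := congrArg (Submodule.map (Submodule.subtype _)) β.span_eq
      rw [Submodule.map_span, Submodule.map_subtype_top, ← Set.range_comp] at h1
      exact h1
    have hvtop : ⊤ ≤ Submodule.span K (Set.range v) := by
      rw [← hS, Submodule.span_le]
      intro x hx
      have : x ∈ Submodule.span R (Set.range v) := hvS ▸ Submodule.subset_span hx
      exact Submodule.span_le_restrictScalars R K _ this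
    let e := (Module.Basis.mk hv hvtop).indexEquiv (Pi.basisFun K (Fin r))
    let v' : Fin r → Fin r → K := fun i => v (e.symm i)
    have hv' : (Matrix.of v').det ≠ 0 := by
      have h1 : LinearIndependent K v' := hv.comp _ e.symm.injective
      have h2 : IsUnit (Matrix.of v') := Matrix.linearIndependent_rows_iff_isUnit.1 h1
      exact ((Matrix.isUnit_iff_isUnit_det _).1 h2).ne_zero
    have hrange : Submodule.span R (Set.range v') = Submodule.span R S := by
      rw [← hvS, show v' = v ∘ e.symm from rfl, Set.range_comp, e.symm.surjective.range_eq,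
        Set.image_univ]
    have hdet : ∀ q : Fin r → Fin r → K, (∀ i, q i ∈ Submodule.span R S) →
        ∃ a : R, algebraMap R K a * (Matrix.of v').det = (Matrix.of q).det := by
      intro q hq
      have h1 : ∀ i, ∃ a : Fin r → R, ∑ j, a j • v' j = q i := fun i => by
        have := hq i
        rw [← hrange] at this
        exact (Submodule.mem_span_range_iff_exists_fun R).1 this
      choose a ha using h1
      refine ⟨(Matrix.of a).det, ?_⟩
      rw [RingHom.map_det, ← Matrix.det_mul]
      congr 1
      ext i j
      rw [Matrix.mul_apply, Matrix.of_apply, ← ha, Finset.sum_apply]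
      simp [Algebra.smul_def]
    have hspan : Submodule.span R {d | ∃ p : Fin r → Fin r → K, (∀ i, p i ∈ S) ∧
        d = Matrix.det (Matrix.of p)} = Submodule.span R {(Matrix.of v').det} := by
      rw [← detSpan_span]
      refine le_antisymm (Submodule.span_le.2 ?_) (Submodule.span_le.2 ?_)
      · rintro _ ⟨q, hq, rfl⟩
        obtain ⟨a, ha⟩ := hdet q hq
        exact Submodule.mem_span_singleton.2 ⟨a, by rw [Algebra.smul_def, ha]⟩
      · rintro _ rfl
        exact Submodule.subset_span ⟨v', fun i => hrange ▸ Submodule.subset_span ⟨i, rfl⟩, rfl⟩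
    obtain ⟨_, ⟨p, hp, rfl⟩, hp0, hpspan⟩ :=
      exists_generator_mem (IsFractionRing.injective R K) hv' hspan
    refine ⟨p, hp, hp0, fun q hq => ?_⟩
    have hqS : (Matrix.of q).det ∈ Submodule.span R {d | ∃ p : Fin r → Fin r → K, (∀ i, p i ∈ S) ∧
        d = Matrix.det (Matrix.of p)} := Submodule.subset_span ⟨q, hq, rfl⟩
    obtain ⟨a, ha⟩ := Submodule.mem_span_singleton.1 (hpspan ▸ hqS)
    exact ⟨a, by rw [← ha, Algebra.smul_def]⟩
  · rintro ⟨p, hp, hp0, h⟩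
    -- Cramer's rule expresses all elements of `S` in terms of the rows of `p`.
    have hspan : Submodule.span R (Set.range p) = Submodule.span R S := by
      refine le_antisymm (Submodule.span_mono (by rintro _ ⟨i, rfl⟩; exact hp i))
        (Submodule.span_le.2 fun x hx => ?_)
      have h1 : ∀ i, ∃ a : R, algebraMap R K a * (Matrix.of p).det =
          (Matrix.of (Function.update p i x)).det := fun i => h _ fun j => by
        by_cases hj : j = i
        · rw [hj, Function.update_self]; exact hx
        · rw [Function.update_of_ne hj]; exact hp j
      choose a ha using h1
      refine (Submodule.mem_span_range_iff_exists_fun R).2 ⟨a, ?_⟩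
      have h2 := Matrix.mulVec_cramer (Matrix.of p).transpose x
      rw [Matrix.det_transpose] at h2
      refine smul_right_injective _ hp0 ?_
      dsimp only
      rw [← h2]
      ext j
      rw [Matrix.mulVec, dotProduct, Pi.smul_apply, Finset.sum_apply, Finset.smul_sum]
      refine Finset.sum_congr rfl fun i _ => ?_
      rw [Matrix.cramer_transpose_apply, Pi.smul_apply, smul_eq_mul, Algebra.smul_def,
        Matrix.transpose_apply, Matrix.of_apply, show (Matrix.of p).updateRow i x =
          Matrix.of (Function.update p i x) from rfl, ← ha]
      ring
    have hli : LinearIndependent R p := by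
      rw [LinearIndependent.iff_fractionRing R K]
      exact Matrix.linearIndependent_rows_iff_isUnit.2
        ((Matrix.isUnit_iff_isUnit_det _).2 (isUnit_iff_ne_zero.2 hp0))
    rw [← hspan]
    exact Module.Free.of_basis (Module.Basis.span hli)

variable {K : Type*} [Field K] {r : ℕ} (δ : Fin r → Derivation ℤ K K)

/-- The determinant of the derivatives of `x₁, …, xᵣ`. -/
def jacobian (x : Fin r → K) : K := (Matrix.of fun i j => δ j (x i)).det

/-- The derivatives of a set of generators of a field span the dual of the space of
derivations. -/
lemma span_derivatives_eq_top (hδ : LinearIndependent K δ) (B : Subring K)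
    (hB : ∀ x : K, ∃ u ∈ B, ∃ v ∈ B, v ≠ 0 ∧ x * v = u) :
    Submodule.span K ((fun x j => δ j x) '' (B : Set K)) = ⊤ := by
  by_contra hne
  obtain ⟨l, hl, hle⟩ := Submodule.exists_le_ker_of_lt_top _ (lt_top_iff_ne_top.2 hne)
  have hl' : ∀ v : Fin r → K, l v = ∑ i, v i * l (Pi.single i 1) := by
    intro v
    conv_lhs => rw [pi_eq_sum_univ' v]
    simp [map_sum, map_smul]
  let D : Derivation ℤ K K := ∑ i, l (Pi.single i 1) • δ i
  have hD : ∀ x, D x = l fun j => δ j x := by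
    intro x
    rw [hl']
    simp only [D, ← Derivation.coeFnAddMonoidHom_apply, map_sum, Finset.sum_apply]
    exact Finset.sum_congr rfl fun i _ => mul_comm _ _
  have hDB : ∀ x ∈ B, D x = 0 := fun x hx => by
    rw [hD]; exact hle (Submodule.subset_span ⟨x, hx, rfl⟩)
  have hD0 : D = 0 := by
    ext x
    obtain ⟨u, hu, v, hv, hv0, h⟩ := hB x
    have h1 := hDB u hu
    rw [← h, Derivation.leibniz, hDB v hv, smul_zero, zero_add, smul_eq_mul] at h1
    exact (mul_eq_zero.1 h1).resolve_left hv0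
  have h2 := Fintype.linearIndependent_iff.1 hδ _ hD0
  refine hl (LinearMap.ext fun v => ?_)
  rw [hl', LinearMap.zero_apply]
  exact Finset.sum_eq_zero fun i _ => by rw [h2 i, mul_zero]

/-- The fractional ideal `F(S)` of a ring `S` is generated by the jacobians. -/
lemma span_gaussF_one {R S : Subring K} (hSR : S ≤ R) :
    Submodule.span R (gaussF δ (1 : Submodule S K) : Set K) =
      Submodule.span R {d | ∃ x : Fin r → K, (∀ i, x i ∈ S) ∧ d = jacobian δ x} := by
  have hone : ∀ {x : K}, x ∈ (1 : Submodule S K) ↔ x ∈ S := fun {x} => by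
    rw [Submodule.mem_one]
    exact ⟨by rintro ⟨y, rfl⟩; exact y.2, fun hx => ⟨⟨x, hx⟩, rfl⟩⟩
  have hR : (algebraMap S K).range ≤ (algebraMap R K).range := by
    rw [algebraMap_range_subring, algebraMap_range_subring]; exact hSR
  rw [gaussF_eq_detSpan, principalParts, detSpan_span, span_span_of_range_le hR]
  refine le_antisymm (Submodule.span_le.2 ?_) (Submodule.span_mono ?_)
  · rintro _ ⟨p, hp, rfl⟩
    choose x hx hxp using hp
    rw [SetLike.mem_coe, Matrix.det_succ_column_zero]
    refine Submodule.sum_mem _ fun i _ => ?_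
    have h1 : (Matrix.of p) i 0 = x i := by rw [Matrix.of_apply, ← hxp]; rfl
    have h2 : ((Matrix.of p).submatrix i.succAbove Fin.succ).det =
        jacobian δ fun j => x (i.succAbove j) := by
      rw [jacobian]
      congr 1
      ext a b
      rw [Matrix.submatrix_apply, Matrix.of_apply, Matrix.of_apply, ← hxp]
      rfl
    rw [h1, h2]
    have h3 : (-1 : K) ^ (i : ℕ) * x i ∈ R :=
      R.mul_mem (R.pow_mem (R.neg_mem R.one_mem) _) (hSR (hone.1 (hx i)))
    exact Submodule.smul_mem _ (⟨_, h3⟩ : R) (Submodule.subset_span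
      ⟨fun j => x (i.succAbove j), fun j => hone.1 (hx _), rfl⟩)
  · rintro _ ⟨x, hx, rfl⟩
    refine ⟨fun i => row δ (Fin.cons (α := fun _ => K) 1 x i), fun i => ⟨_, hone.2 ?_, rfl⟩, ?_⟩
    · refine Fin.cases ?_ (fun j => ?_) i
      · exact S.one_mem
      · exact hx j
    · rw [Matrix.det_succ_row_zero, Fin.sum_univ_succ]
      have h0 : ∀ j : Fin r, (Matrix.of fun i => row δ (Fin.cons (α := fun _ => K) 1 x i)) 0
          j.succ = 0 := fun j => by simp [row]
      simp only [h0, mul_zero, zero_mul, Finset.sum_const_zero, add_zero]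
      simp only [Fin.val_zero, pow_zero, Matrix.of_apply, row, Fin.cons_zero, one_mul, jacobian]
      congr 1

/-- A ring `R` over which the fractional ideal generated by the jacobians of a subring `S` is
principal and nonzero. -/
def HasPrincipalJacobian (S R : Subring K) : Prop :=
  ∃ x : Fin r → K, (∀ i, x i ∈ S) ∧ jacobian δ x ≠ 0 ∧
    ∀ y : Fin r → K, (∀ i, y i ∈ S) → jacobian δ y / jacobian δ x ∈ R

lemma hasPrincipalJacobian_iff {R S : Subring K} [IsLocalRing R] (hSR : S ≤ R) :
    HasPrincipalJacobian δ S R ↔ ∃ y : K, y ≠ 0 ∧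
      Submodule.span R (gaussF δ (1 : Submodule S K) : Set K) = Submodule.span R {y} := by
  rw [span_gaussF_one δ hSR]
  constructor
  · rintro ⟨x, hx, hx0, h⟩
    have hxS : jacobian δ x ∈ {d | ∃ x : Fin r → K, (∀ i, x i ∈ S) ∧ d = jacobian δ x} :=
      ⟨x, hx, rfl⟩
    refine ⟨_, hx0, (div_mem_iff_span_eq hxS hx0).2 ?_⟩
    rintro _ ⟨y, hy, rfl⟩
    exact h y hy
  · rintro ⟨y, hy, h⟩
    obtain ⟨_, ⟨x, hx, rfl⟩, hx0, hxs⟩ := exists_generator_mem Subtype.val_injective hy h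
    have hxS : jacobian δ x ∈ {d | ∃ x : Fin r → K, (∀ i, x i ∈ S) ∧ d = jacobian δ x} :=
      ⟨x, hx, rfl⟩
    exact ⟨x, hx, hx0, fun y hy => (div_mem_iff_span_eq hxS hx0).1 hxs _ ⟨y, hy, rfl⟩⟩

end Free

/-! ### Foliations on birational modifications -/

section Frame

variable {k : Type u} [Field k] {K : Type u} [Field K] {r : ℕ} {Y Z : Scheme.{u}} [IsIntegral Y]
  [IsIntegral Z]

lemma constants_comp (π : Z ⟶ Y) [IsDominant π] (s : Y ⟶ Spec (.of k)) (c : k) :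
    constants (π ≫ s) c = functionFieldMap π (constants s c) := by
  refine Eq.trans ?_ (functionFieldMap_germ π ⊤ ⊤ le_top
    (s.appTop ((Scheme.ΓSpecIso (.of k)).inv c))).symm
  have h : (π ≫ s).appTop = s.appTop ≫ π.appLE ⊤ ⊤ le_top := by
    rw [Scheme.Hom.comp_appTop]
    exact congrArg _ (Scheme.Hom.app_eq_appLE _)
  change (algebraMap Γ(Z, ⊤) Z.functionField) ((π ≫ s).appTop _) = _
  rw [h]
  rfl

/-- An isomorphism of the field `K` with the function field of `Y` which carries the derivations
`δ₁, …, δᵣ` to a basis of the foliation. -/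
structure Frame {s : Y ⟶ Spec (.of k)} (L : Foliation s) (φ : K →+* Y.functionField)
    (δ : Fin r → Derivation ℤ K K) where
  bijective : Function.Bijective φ
  /-- The basis of the foliation. -/
  basis : Module.Basis (Fin r) Y.functionField L.carrier
  apply : ∀ i x, (basis i).1 (φ x) = φ (δ i x)

/-- The tautological frame. -/
def Frame.ofBasis {s : Y ⟶ Spec (.of k)} {L : Foliation s}
    (b : Module.Basis (Fin r) Y.functionField L.carrier) :
    Frame L (RingHom.id Y.functionField) fun i => (b i).1 where
  bijective := Function.bijective_id
  basis := b
  apply _ _ := rfl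

/-- A derivation carried over along an isomorphism of fields. -/
def transportDerivation {K K' : Type*} [Field K] [Field K'] (ψ : K ≃+* K') (D : Derivation ℤ K K) :
    Derivation ℤ K' K' :=
  Derivation.mk' ((ψ.toAddMonoidHom.comp ((D : K →ₗ[ℤ] K).toAddMonoidHom.comp
    ψ.symm.toAddMonoidHom)).toIntLinearMap) fun a b => by
      change ψ (D (ψ.symm (a * b))) = a • ψ (D (ψ.symm b)) + b • ψ (D (ψ.symm a))
      simp [Derivation.leibniz]

lemma transportDerivation_apply {K K' : Type*} [Field K] [Field K'] (ψ : K ≃+* K')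
    (D : Derivation ℤ K K) (x : K) : transportDerivation ψ D (ψ x) = ψ (D x) := by
  change ψ (D (ψ.symm (ψ x))) = _
  rw [ψ.symm_apply_apply]

/-- Lifting along a birational morphism carries bases of the foliation to bases of the lift. -/
lemma Frame.exists_basis_lift {s : Y ⟶ Spec (.of k)} (L : Foliation s)
    (b : Module.Basis (Fin r) Y.functionField L.carrier) (π : Z ⟶ Y)
    [IsDominant π] (hπ : Function.Bijective (functionFieldMap π)) :
    ∃ b' : Module.Basis (Fin r) Z.functionField (L.lift π).carrier,
      ∀ i x, (b' i).1 (functionFieldMap π x) = functionFieldMap π ((b i).1 x) := by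
  let ψ := RingEquiv.ofBijective _ hπ
  have hψ : ∀ x, ψ x = functionFieldMap π x := fun _ => rfl
  let e : Fin r → Derivation ℤ Z.functionField Z.functionField := fun i =>
    transportDerivation ψ (b i).1
  have he : ∀ i x, e i (functionFieldMap π x) = functionFieldMap π ((b i).1 x) :=
    fun i x => transportDerivation_apply ψ _ x
  have hmem : ∀ i, e i ∈ (L.lift π).carrier := fun i => Submodule.subset_span
    ⟨fun c => by rw [constants_comp, he, L.map_constants _ (b i).2, map_zero],
      _, (b i).2, he i⟩
  let v : Fin r → (L.lift π).carrier := fun i => ⟨e i, hmem i⟩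
  have hsum : ∀ (c : Fin r → Y.functionField) x,
      (∑ i, ψ (c i) • e i) (functionFieldMap π x) =
        functionFieldMap π ((∑ i, c i • (b i).1) x) := by
    intro c x
    simp only [← Derivation.coeFnAddMonoidHom_apply, map_sum, Finset.sum_apply]
    refine Finset.sum_congr rfl fun i _ => ?_
    simp only [Derivation.coeFnAddMonoidHom_apply, Derivation.smul_apply, smul_eq_mul, he, map_mul,
      hψ]
  have hli : LinearIndependent Z.functionField v := by
    rw [Fintype.linearIndependent_iff]
    intro c hc i
    have h1 : ∑ i, ψ (ψ.symm (c i)) • e i = 0 := by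
      have := congrArg Subtype.val hc
      simpa [v] using this
    have h2 : ∑ i, ψ.symm (c i) • b i = 0 := by
      refine Subtype.ext (Derivation.ext fun x => ?_)
      refine hπ.1 ?_
      have h3 := hsum (fun i => ψ.symm (c i)) x
      rw [h1] at h3
      rw [Submodule.coe_sum]
      exact h3.symm.trans (map_zero _).symm
    have h3 := Fintype.linearIndependent_iff.1 b.linearIndependent _ h2 i
    simpa using h3
  have hspan : ⊤ ≤ Submodule.span Z.functionField (Set.range v) := by
    rintro ⟨E, hE⟩ -
    suffices h : E ∈ Submodule.map (L.lift π).carrier.subtype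
        (Submodule.span Z.functionField (Set.range v)) by
      obtain ⟨E', hE', h⟩ := h
      rwa [show (⟨E, hE⟩ : (L.lift π).carrier) = E' from Subtype.ext h.symm]
    rw [Submodule.map_span, ← Set.range_comp]
    refine Submodule.span_le.2 ?_ hE
    rintro E' ⟨-, D, hD, hED⟩
    have h1 : E' = ∑ i, ψ (b.repr ⟨D, hD⟩ i) • e i := by
      ext y
      obtain ⟨x, rfl⟩ := hπ.2 y
      rw [hsum, hED]
      have h2 := congrArg Subtype.val (b.sum_repr ⟨D, hD⟩)
      rw [Submodule.coe_sum] at h2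
      exact congrArg (fun F : Derivation ℤ _ _ => functionFieldMap π (F x)) h2.symm
    rw [h1]
    exact Submodule.sum_mem _ fun i _ => Submodule.smul_mem _ _ (Submodule.subset_span ⟨i, rfl⟩)
  refine ⟨Module.Basis.mk hli hspan, fun i x => ?_⟩
  rw [Module.Basis.mk_apply]
  exact he i x

variable {s : Y ⟶ Spec (.of k)} {L : Foliation s} {φ : K →+* Y.functionField}
  {δ : Fin r → Derivation ℤ K K}

/-- The frame of the foliation lifted along a birational morphism. -/
def Frame.lift (F : Frame L φ δ) (π : Z ⟶ Y) [IsDominant π]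
    (hπ : Function.Bijective (functionFieldMap π)) :
    Frame (L.lift π) ((functionFieldMap π).comp φ) δ where
  bijective := hπ.comp F.bijective
  basis := (exists_basis_lift L F.basis π hπ).choose
  apply i x := by
    rw [RingHom.comp_apply, (exists_basis_lift L F.basis π hπ).choose_spec, F.apply]
    rfl

lemma Frame.linearIndependent (F : Frame L φ δ) : LinearIndependent K δ := by
  rw [Fintype.linearIndependent_iff]
  intro c hc i
  have h : ∑ i, φ (c i) • F.basis i = 0 := by
    refine Subtype.ext (Derivation.ext fun y => ?_)
    obtain ⟨x, rfl⟩ := F.bijective.2 y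
    have h1 := congrArg (fun D : Derivation ℤ K K => φ (D x)) hc
    simp only [← Derivation.coeFnAddMonoidHom_apply, map_sum, Finset.sum_apply] at h1
    rw [Submodule.coe_sum]
    simp only [← Derivation.coeFnAddMonoidHom_apply, map_sum, Finset.sum_apply]
    refine Eq.trans (Finset.sum_congr rfl fun i _ => ?_) (h1.trans (map_zero φ))
    simp [F.apply]
  have h2 := Fintype.linearIndependent_iff.1 F.basis.linearIndependent _ h i
  exact (map_eq_zero φ).1 h2

/-- A module generated by differentials of rational functions is free if and only if the jacobians
generate a principal ideal. -/
lemma Frame.free_iff (F : Frame L φ δ) {R B : Type u} [CommRing R] [IsDomain R] [IsLocalRing R]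
    [Algebra R Y.functionField] [IsFractionRing R Y.functionField] [CommRing B]
    (ρ : B →+* Y.functionField) (hρ : ∀ x, ∃ u v, ρ v ≠ 0 ∧ x * ρ v = ρ u) :
    Module.Free R (Submodule.span R {ω | ∃ f : B, ω = L.ev (ρ f)}) ↔
      HasPrincipalJacobian δ (ρ.range.comap φ) ((algebraMap R Y.functionField).range.comap φ) := by
  let c : (L.carrier →ₗ[Y.functionField] Y.functionField) →ₗ[R] (Fin r → Y.functionField) :=
    ((F.basis.constr Y.functionField (M' := Y.functionField)).symm.toLinearMap).restrictScalars R
  have hc : Function.Injective c :=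
    (F.basis.constr Y.functionField (M' := Y.functionField)).symm.injective
  have hcS : c '' {ω | ∃ f : B, ω = L.ev (ρ f)} =
      (fun x j => (F.basis j).1 x) '' (ρ.range : Set Y.functionField) := by
    ext v
    constructor
    · rintro ⟨_, ⟨f, rfl⟩, rfl⟩
      exact ⟨ρ f, ⟨f, rfl⟩, rfl⟩
    · rintro ⟨_, ⟨f, rfl⟩, rfl⟩
      exact ⟨_, ⟨f, rfl⟩, rfl⟩
  have hli : LinearIndependent Y.functionField fun j => (F.basis j).1 :=
    F.basis.linearIndependent.map' (Submodule.subtype _) (Submodule.ker_subtype _)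
  have htop := span_derivatives_eq_top _ hli ρ.range (fun x => by
    obtain ⟨u, v, hv, h⟩ := hρ x
    exact ⟨_, ⟨u, rfl⟩, _, ⟨v, rfl⟩, hv, h⟩)
  have hequiv := Submodule.equivMapOfInjective c hc
    (Submodule.span R {ω | ∃ f : B, ω = L.ev (ρ f)})
  rw [Submodule.map_span, hcS] at hequiv
  have hfree : Module.Free R (Submodule.span R {ω | ∃ f : B, ω = L.ev (ρ f)}) ↔
      Module.Free R (Submodule.span R ((fun x j => (F.basis j).1 x) ''
        (ρ.range : Set Y.functionField))) :=
    ⟨fun h => Module.Free.of_equiv hequiv, fun h => Module.Free.of_equiv hequiv.symm⟩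
  rw [hfree]
  rw [free_span_iff htop]
  have hjac : ∀ x : Fin r → K, φ (jacobian δ x) =
      (Matrix.of fun i j => (F.basis j).1 (φ (x i))).det := by
    intro x
    rw [jacobian, RingHom.map_det]
    congr 1
    ext i j
    exact (F.apply j _).symm
  have hφ : ∀ q : Fin r → Fin r → Y.functionField,
      (∀ i, q i ∈ (fun x j => (F.basis j).1 x) '' (ρ.range : Set Y.functionField)) →
      ∃ x : Fin r → K, (∀ i, x i ∈ ρ.range.comap φ) ∧ (Matrix.of q).det = φ (jacobian δ x) := by
    intro q hq
    choose y hy hyq using hq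
    choose x hx using fun i => F.bijective.2 (y i)
    refine ⟨x, fun i => ?_, ?_⟩
    · rw [Subring.mem_comap, hx]; exact hy i
    · rw [hjac]
      congr 1
      ext i j
      rw [Matrix.of_apply, ← hyq, Matrix.of_apply, hx]
  have hφ' : ∀ x : Fin r → K, (∀ i, x i ∈ ρ.range.comap φ) → ∀ i, (fun j => (F.basis j).1 (φ (x i)))
      ∈ (fun x j => (F.basis j).1 x) '' (ρ.range : Set Y.functionField) :=
    fun x hx i => ⟨_, hx i, rfl⟩
  constructor
  · rintro ⟨p, hp, hp0, h⟩
    obtain ⟨x, hx, hpx⟩ := hφ p hp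
    refine ⟨x, hx, fun h0 => hp0 (by rw [hpx, h0, map_zero]), fun y hy => ?_⟩
    obtain ⟨a, ha⟩ := h _ (hφ' y hy)
    refine ⟨a, ?_⟩
    rw [map_div₀, hjac y, ← ha, ← hpx, mul_div_cancel_right₀ _ hp0]
  · rintro ⟨x, hx, hx0, h⟩
    have hx0' : φ (jacobian δ x) ≠ 0 := (map_ne_zero φ).2 hx0
    refine ⟨_, hφ' x hx, by rwa [← hjac], fun q hq => ?_⟩
    obtain ⟨y, hy, hqy⟩ := hφ q hq
    obtain ⟨a, ha⟩ := h y hy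
    refine ⟨a, ?_⟩
    rw [ha, hqy, ← hjac, ← map_mul, div_mul_cancel₀ _ hx0]

lemma Frame.isNonsingular_iff (F : Frame L φ δ) : L.IsNonsingular ↔ ∀ y : Y,
    HasPrincipalJacobian δ ((algebraMap (Y.presheaf.stalk y) Y.functionField).range.comap φ)
      ((algebraMap (Y.presheaf.stalk y) Y.functionField).range.comap φ) := by
  refine forall_congr' fun y => F.free_iff (algebraMap (Y.presheaf.stalk y) _) fun x => ?_
  obtain ⟨u, v, hv, rfl⟩ := IsFractionRing.div_surjective (A := Y.presheaf.stalk y) x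
  have hv0 := IsFractionRing.to_map_ne_zero_of_mem_nonZeroDivisors (K := Y.functionField) hv
  exact ⟨u, v, hv0, div_mul_cancel₀ _ hv0⟩

lemma Frame.free_pullbackDifferentials_iff (F : Frame L φ δ) (π : Z ⟶ Y) [IsDominant π]
    (hπ : Function.Bijective (functionFieldMap π)) (z : Z) :
    Module.Free (Z.presheaf.stalk z) (L.pullbackDifferentials π z) ↔
    HasPrincipalJacobian δ
      ((algebraMap (Y.presheaf.stalk (π z)) Y.functionField).range.comap φ)
      ((algebraMap (Z.presheaf.stalk z) Z.functionField).range.comap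
        ((functionFieldMap π).comp φ)) := by
  refine ((F.lift π hπ).free_iff ((algebraMap (Z.presheaf.stalk z) Z.functionField).comp
    (π.stalkMap z).hom) fun x => ?_).trans ?_
  · obtain ⟨x, rfl⟩ := hπ.2 x
    obtain ⟨u, v, hv, rfl⟩ := IsFractionRing.div_surjective (A := Y.presheaf.stalk (π z)) x
    have hv0 := IsFractionRing.to_map_ne_zero_of_mem_nonZeroDivisors (K := Y.functionField) hv
    have h : ∀ a, algebraMap (Z.presheaf.stalk z) Z.functionField ((π.stalkMap z).hom a) =
      functionFieldMap π (algebraMap _ _ a) := fun a => (functionFieldMap_algebraMap π z a).symm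
    refine ⟨u, v, ?_, ?_⟩
    · rw [RingHom.comp_apply, h]; exact (map_ne_zero _).2 hv0
    · rw [RingHom.comp_apply, RingHom.comp_apply, h, h, ← map_mul, div_mul_cancel₀ _ hv0]
  · have h : (((algebraMap (Z.presheaf.stalk z) Z.functionField).comp
        (π.stalkMap z).hom).range.comap ((functionFieldMap π).comp φ)) =
        (algebraMap (Y.presheaf.stalk (π z)) Y.functionField).range.comap φ := by
      ext x
      refine exists_congr fun a => ?_
      rw [RingHom.comp_apply, RingHom.comp_apply]
      refine Eq.congr_left (functionFieldMap_algebraMap π z a).symm |>.trans ?_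
      exact hπ.1.eq_iff
    rw [h]

end Frame

/-! ### Passage to stalks -/

section Stalks

lemma mem_of_forall_prime {A E : Type*} [CommRing A] [AddCommGroup E] [Module A E]
    (N : Submodule A E) (x : E) (h : ∀ p : PrimeSpectrum A, ∃ s ∉ p.asIdeal, s • x ∈ N) :
    x ∈ N := by
  by_contra hx
  have hJ : N.comap (LinearMap.toSpanSingleton A E x) ≠ ⊤ := fun h1 => hx (by
    have : (1 : A) ∈ N.comap (LinearMap.toSpanSingleton A E x) := h1 ▸ Submodule.mem_top
    simpa using this)
  obtain ⟨p, hp, hle⟩ := Ideal.exists_le_maximal _ hJ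
  obtain ⟨s, hs, hsx⟩ := h ⟨p, hp.isPrime⟩
  exact hs (hle (by simpa using hsx))

variable {A K : Type*} [CommRing A] [Field K] [Algebra A K]

lemma exists_smul_mem_of_mem_span {R : Subring K} {p : Ideal A} [hp : p.IsPrime]
    (h : ∀ y ∈ R, ∃ s ∉ p, ∃ a, algebraMap A K s * y = algebraMap A K a) {N : Submodule A K} {x : K}
    (hx : x ∈ Submodule.span R (N : Set K)) : ∃ s ∉ p, s • x ∈ N := by
  induction hx using Submodule.span_induction with
  | mem x hx => exact ⟨1, (Ideal.ne_top_iff_one _).1 hp.ne_top, by rwa [one_smul]⟩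
  | zero => exact ⟨1, (Ideal.ne_top_iff_one _).1 hp.ne_top, by simp⟩
  | add x y _ _ hx hy =>
    obtain ⟨s, hs, hsx⟩ := hx
    obtain ⟨t, ht, hty⟩ := hy
    refine ⟨s * t, hp.mul_notMem hs ht, ?_⟩
    rw [smul_add, mul_smul, mul_smul, smul_comm s t x]
    exact N.add_mem (N.smul_mem _ hsx) (N.smul_mem _ hty)
  | smul c x _ hx =>
    obtain ⟨s, hs, hsx⟩ := hx
    obtain ⟨t, ht, a, ha⟩ := h c c.2
    refine ⟨t * s, hp.mul_notMem ht hs, ?_⟩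
    have : (t * s) • (c • x) = a • s • x := by
      simp only [Algebra.smul_def, map_mul, ← ha]
      change _ * _ * ((c : K) * x) = _
      ring
    rw [this]
    exact N.smul_mem _ hsx

/-- An inclusion of modules may be checked after extension to suitable local rings. -/
lemma le_of_forall_span_le {N N' : Submodule A K} (h : ∀ p : PrimeSpectrum A, ∃ R : Subring K,
    (∀ y ∈ R, ∃ s ∉ p.asIdeal, ∃ a, algebraMap A K s * y = algebraMap A K a) ∧
      Submodule.span R (N : Set K) ≤ Submodule.span R (N' : Set K)) : N ≤ N' := by
  refine fun x hx => mem_of_forall_prime _ _ fun p => ?_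
  obtain ⟨R, hR, hle⟩ := h p
  exact exists_smul_mem_of_mem_span hR (hle (Submodule.subset_span hx))

variable {V : Scheme.{u}}

lemma fromSpec_mem {U : V.Opens} (hU : IsAffineOpen U) (p : PrimeSpectrum Γ(V, U)) :
    hU.fromSpec p ∈ U :=
  hU.range_fromSpec.le ⟨p, rfl⟩

variable [IsIntegral V]

/-- The local ring of `V` at `x`, as a subring of the function field. -/
def stalkRing (x : V) : Subring V.functionField :=
  (algebraMap (V.presheaf.stalk x) V.functionField).range

lemma range_le_stalkRing {U : V.Opens} [Nonempty U] {x : V} (hx : x ∈ U) :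
    (algebraMap Γ(V, U) V.functionField).range ≤ stalkRing x := by
  rintro _ ⟨a, rfl⟩
  exact ⟨V.presheaf.germ U x hx a, V.presheaf.germ_stalkSpecializes_apply hx _ a⟩

lemma range_le_range_stalkRing {U : V.Opens} [Nonempty U] {x : V} (hx : x ∈ U) :
    (algebraMap Γ(V, U) V.functionField).range ≤
      (algebraMap (stalkRing x) V.functionField).range := by
  rw [algebraMap_range_subring]; exact range_le_stalkRing hx

lemma span_span_stalkRing {U : V.Opens} [Nonempty U] {x : V} (hx : x ∈ U)
    (S : Set V.functionField) :
    Submodule.span (stalkRing x) (Submodule.span Γ(V, U) S : Set V.functionField) =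
      Submodule.span (stalkRing x) S :=
  span_span_of_range_le (A := Γ(V, U)) (K := V.functionField) (range_le_range_stalkRing hx) S

lemma mem_stalkRing_fromSpec {U : V.Opens} (hU : IsAffineOpen U) [Nonempty U]
    (p : PrimeSpectrum Γ(V, U)) {y : V.functionField} :
    y ∈ stalkRing (hU.fromSpec p) ↔ ∃ s ∉ p.asIdeal, ∃ a,
      algebraMap Γ(V, U) V.functionField s * y = algebraMap Γ(V, U) V.functionField a := by
  have hx := fromSpec_mem hU p
  let _ : Algebra Γ(V, U) (V.presheaf.stalk (hU.fromSpec p)) :=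
    TopCat.Presheaf.algebra_section_stalk V.presheaf ⟨_, hx⟩
  have hloc : IsLocalization.AtPrime (V.presheaf.stalk (hU.fromSpec p)) p.asIdeal :=
    hU.isLocalization_stalk' p hx
  have hg : ∀ a : Γ(V, U), algebraMap (V.presheaf.stalk (hU.fromSpec p)) V.functionField
      (algebraMap Γ(V, U) (V.presheaf.stalk (hU.fromSpec p)) a) =
        algebraMap Γ(V, U) V.functionField a := fun a =>
    V.presheaf.germ_stalkSpecializes_apply hx _ a
  constructor
  · rintro ⟨z, rfl⟩
    obtain ⟨⟨a, s⟩, h⟩ := IsLocalization.surj p.asIdeal.primeCompl z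
    refine ⟨s, s.2, a, ?_⟩
    rw [← hg, ← hg, ← h, map_mul, mul_comm]
  · rintro ⟨s, hs, a, h⟩
    obtain ⟨t, ht⟩ := IsLocalization.map_units (V.presheaf.stalk (hU.fromSpec p))
      (⟨s, hs⟩ : p.asIdeal.primeCompl)
    refine ⟨algebraMap _ _ a * (t⁻¹ : (V.presheaf.stalk (hU.fromSpec p))ˣ), ?_⟩
    have h1 : algebraMap Γ(V, U) V.functionField s ≠ 0 := by
      rw [← hg]
      have := (t.isUnit.map (algebraMap _ V.functionField)).ne_zero
      rwa [ht] at this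
    refine mul_left_cancel₀ h1 ?_
    rw [h, ← hg s, ← map_mul, ← hg a]
    congr 1
    rw [← show (t : V.presheaf.stalk (hU.fromSpec p)) = algebraMap _ _ s from ht]
    rw [mul_comm, mul_assoc, Units.inv_mul, mul_one]

lemma locallyGenerates_stalkRing {U : V.Opens} (hU : IsAffineOpen U) [Nonempty U] {x : V}
    (hx : x ∈ U) : LocallyGenerates
      ((algebraMap Γ(V, U) V.functionField).range : Set V.functionField) (stalkRing x) := by
  refine ⟨range_le_stalkRing hx, fun R' h1 h2 h3 y hy => ?_⟩
  obtain ⟨p, rfl⟩ := hU.range_fromSpec.ge hx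
  obtain ⟨s, hs, a, h⟩ := (mem_stalkRing_fromSpec hU p).1 hy
  by_cases hs0 : algebraMap Γ(V, U) V.functionField s = 0
  · have : s = 0 := by
      have h4 := FracIdeal.injective_algebraMap (V := V) ⟨U, hU⟩
      exact h4 (hs0.trans (map_zero _).symm)
    exact absurd (this ▸ p.asIdeal.zero_mem) hs
  have hinv : (algebraMap Γ(V, U) V.functionField s)⁻¹ ∈ stalkRing (hU.fromSpec p) :=
    (mem_stalkRing_fromSpec hU p).2 ⟨s, hs, 1, by rw [mul_inv_cancel₀ hs0, map_one]⟩
  have : y = (algebraMap Γ(V, U) V.functionField s)⁻¹ * algebraMap Γ(V, U) V.functionField a := by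
    rw [← h, inv_mul_cancel_left₀ hs0]
  rw [this]
  exact R'.mul_mem (h3 _ (h1 ⟨s, rfl⟩) hinv) (h1 ⟨a, rfl⟩)

lemma le_of_forall_span_stalkRing_le {U : V.affineOpens} [Nonempty U.1]
    {N N' : Submodule Γ(V, U.1) V.functionField}
    (h : ∀ x ∈ U.1, Submodule.span (stalkRing x) (N : Set V.functionField) ≤
      Submodule.span (stalkRing x) (N' : Set V.functionField)) : N ≤ N' :=
  le_of_forall_span_le fun p =>
    ⟨_, fun _ hy => (mem_stalkRing_fromSpec U.2 p).1 hy, h _ (fromSpec_mem U.2 p)⟩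

lemma eq_of_forall_span_stalkRing_eq {U : V.affineOpens} [Nonempty U.1]
    {N N' : Submodule Γ(V, U.1) V.functionField}
    (h : ∀ x ∈ U.1, Submodule.span (stalkRing x) (N : Set V.functionField) =
      Submodule.span (stalkRing x) (N' : Set V.functionField)) : N = N' :=
  le_antisymm (le_of_forall_span_stalkRing_le fun x hx => (h x hx).le)
    (le_of_forall_span_stalkRing_le fun x hx => (h x hx).ge)

end Stalks

/-! ### Operations on fractional ideal sheaves -/

section Derived

variable {V : Scheme.{u}} [IsIntegral V] {r : ℕ}

lemma isFractionRing_section (U : V.affineOpens) [Nonempty U.1] :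
    IsFractionRing Γ(V, U.1) V.functionField :=
  functionField_isFractionRing_of_isAffineOpen V U.1 U.2

lemma exists_jacobian_ne_zero {K : Type*} [Field K] {δ : Fin r → Derivation ℤ K K}
    (hδ : LinearIndependent K δ) : ∃ x, jacobian δ x ≠ 0 := by
  have htop := span_derivatives_eq_top δ hδ ⊤ fun x =>
    ⟨x, trivial, 1, trivial, one_ne_zero, mul_one x⟩
  obtain ⟨p, hp, hp0, -⟩ := (free_span_iff (R := K) htop).1 inferInstance
  choose x hx hxp using hp
  refine ⟨x, ?_⟩
  rwa [jacobian, show (fun i j => δ j (x i)) = p from funext hxp]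

lemma gaussF_ne_bot {A K : Type*} [CommRing A] [Field K] [Algebra A K] [IsFractionRing A K]
    {δ : Fin r → Derivation ℤ K K} (hδ : LinearIndependent K δ) {M : Submodule A K} (hM : M ≠ ⊥) :
    gaussF δ M ≠ ⊥ := by
  obtain ⟨f, hf, hf0⟩ := (Submodule.ne_bot_iff _).1 hM
  obtain ⟨x, hx⟩ := exists_jacobian_ne_zero hδ
  have hgen : LocallyGenerates ((algebraMap A K).range ∪ (fun m => m / f) '' M) ⊤ := by
    refine ⟨fun _ _ => trivial, fun R' h1 _ h3 y _ => ?_⟩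
    obtain ⟨u, v, -, rfl⟩ := IsFractionRing.div_surjective (A := A) y
    rw [div_eq_mul_inv]
    exact R'.mul_mem (h1 (Or.inl ⟨u, rfl⟩)) (h3 _ (h1 (Or.inl ⟨v, rfl⟩)) trivial)
  have h := span_gaussF_eq δ hf hf0 hgen
  intro h0
  have hx1 : jacobian δ x ∈ gaussF δ (1 : Submodule (⊤ : Subring K) K) := by
    have := span_gaussF_one δ (le_refl (⊤ : Subring K))
    rw [Submodule.span_eq] at this
    rw [this]
    exact Submodule.subset_span ⟨x, fun _ => trivial, rfl⟩
  have h1 : f ^ (r + 1) * jacobian δ x ∈ Submodule.span (⊤ : Subring K) (gaussF δ M : Set K) := by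
    rw [h]; exact ⟨_, hx1, rfl⟩
  rw [h0, Submodule.bot_coe, Submodule.span_zero_singleton, Submodule.mem_bot] at h1
  exact mul_ne_zero (pow_ne_zero _ hf0) hx h1

namespace FracIdeal

lemma span_sec_eq (M : FracIdeal V) {U U' : V.affineOpens} [Nonempty U.1] [Nonempty U'.1] {x : V}
    (h : x ∈ U.1) (h' : x ∈ U'.1) {R : Subring V.functionField} (hR : stalkRing x ≤ R) :
    Submodule.span R (M.sec U : Set V.functionField) =
      Submodule.span R (M.sec U' : Set V.functionField) := by
  obtain ⟨D, _, hD, h1, h2, -, -⟩ := exists_isAway_range h h'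
  have hDR : (algebraMap Γ(V, D.1) V.functionField).range ≤
      (algebraMap R V.functionField).range := by
    rw [algebraMap_range_subring]; exact (range_le_stalkRing hD).trans hR
  rw [← span_span_of_range_le hDR, M.span_eq U D h1, ← M.span_eq U' D h2,
    span_span_of_range_le hDR]

/-- The product of fractional ideal sheaves. -/
def mul (M N : FracIdeal V) : FracIdeal V where
  sec U _ := M.sec U * N.sec U
  fg U _ := (M.fg U).mul (N.fg U)
  ne_bot U _ h := (mul_eq_zero.1 h).elim (M.ne_bot U) (N.ne_bot U)
  span_eq U U' _ _ h := by
    have hle := range_algebraMap_le_of_le h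
    rw [span_mul_of_range_le hle, M.span_eq U U' h, N.span_eq U U' h]

/-- The fractional ideal sheaf `F(M)`, for linearly independent derivations which map the sections
of the structure sheaf to those of a coherent module. -/
def gauss [IsLocallyNoetherian V] (M : FracIdeal V)
    (δ : Fin r → Derivation ℤ V.functionField V.functionField)
    (hδ : LinearIndependent V.functionField δ)
    (hE : ∀ (U : V.affineOpens) [Nonempty U.1], ∃ E : Submodule Γ(V, U.1) V.functionField, E.FG ∧
      ∀ i a, δ i (algebraMap Γ(V, U.1) V.functionField a) ∈ E) : FracIdeal V where
  sec U _ := gaussF δ (M.sec U)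
  fg U _ := by
    have := IsLocallyNoetherian.component_noetherian U
    obtain ⟨X, hX, h⟩ := exists_gaussF_le_pow_smul δ (hE U) ⊤ (M.fg U)
    have := isNoetherian_of_fg_of_noetherian _ hX
    refine Submodule.FG.of_le hX ?_
    simpa using h 0
  ne_bot U _ := by
    have := isFractionRing_section U
    exact gaussF_ne_bot hδ (M.ne_bot U)
  span_eq U U' _ _ h := by
    refine eq_of_forall_span_stalkRing_eq fun x hx => ?_
    rw [span_span_stalkRing hx,
      span_gaussF_of_localization δ (locallyGenerates_stalkRing U.2 (h hx)),
      span_gaussF_of_localization δ (locallyGenerates_stalkRing U'.2 hx),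
      M.span_sec_eq (h hx) hx le_rfl]

end FracIdeal

end Derived

/-! ### Blowups of fractional ideal sheaves -/

section IsModel

variable {V W T : Scheme.{u}}

lemma IsBlowup.iso_comp {I : V.IdealSheafData} {π : W ⟶ V} (H : IsBlowup I π) (h : T ⟶ W)
    [IsIso h] : IsBlowup I (h ≫ π) := by
  refine ⟨isInvertible_comap_of_isPrincipalNear fun t => ?_, fun S g hg => ?_⟩
  · obtain ⟨U, hU, htU, -⟩ := exists_isAffineOpen_mem_and_subset
      (U := ⊤) (x := (h ≫ π) t) trivial
    exact ⟨⟨U, hU⟩, IsPrincipalNear.comp h (H.isInvertible.isPrincipalNear ⟨U, hU⟩ htU)⟩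
  · obtain ⟨m, hm, hu⟩ := H.existsUnique_lift S g hg
    refine ⟨m ≫ inv h, by simpa using hm, fun m' hm' => ?_⟩
    have := hu (m' ≫ h) (by simpa using hm')
    rw [← this, Category.assoc, IsIso.hom_inv_id, Category.comp_id]

lemma IsLocallyBlowup.iso_comp {π : W ⟶ V} (H : IsLocallyBlowup π) (h : T ⟶ W)
    [IsIso h] : IsLocallyBlowup (h ≫ π) := by
  intro x
  obtain ⟨U, hx, J, hJ, hπ⟩ := H x
  refine ⟨U, hx, J, hJ, ?_⟩
  rw [morphismRestrict_comp]
  have := hπ.iso_comp (h ∣_ π ⁻¹ᵁ U)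
  exact this

lemma IsBlowup.exists_iso {I : V.IdealSheafData} {π : W ⟶ V} {π' : T ⟶ V} (H : IsBlowup I π)
    (H' : IsBlowup I π') : ∃ h : W ⟶ T, IsIso h ∧ h ≫ π' = π := by
  obtain ⟨h, hh, -⟩ := H'.existsUnique_lift W π H.isInvertible
  obtain ⟨h', hh', -⟩ := H.existsUnique_lift T π' H'.isInvertible
  refine ⟨h, ⟨h', ?_, ?_⟩, hh⟩
  · exact (H.existsUnique_lift W π H.isInvertible).unique (by simp [hh, hh']) (by simp)
  · exact (H'.existsUnique_lift T π' H'.isInvertible).unique (by simp [hh, hh']) (by simp)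

variable [IsIntegral V]

namespace FracIdeal

/-- `g` is a blowup of the fractional ideal sheaf `M`. -/
def IsModel (M : FracIdeal V) (g : W ⟶ V) : Prop :=
  ∃ (X : M.Model) (h : W ⟶ X.W), IsIso h ∧ h ≫ X.π = g

variable {M : FracIdeal V}

lemma isModel_π (X : M.Model) : M.IsModel X.π := ⟨X, 𝟙 _, inferInstance, Category.id_comp _⟩

lemma isModel_of_isBlowup [IsLocallyNoetherian V] [V.IsSeparated] {I : V.IdealSheafData}
    {hI : I ≠ ⊥} {g : W ⟶ V} (H : IsBlowup I g) : (ofIdeal I hI).IsModel g := by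
  obtain ⟨X⟩ := (ofIdeal I hI).nonempty_model
  obtain ⟨h, hiso, hh⟩ := H.exists_iso (isBlowup_ofIdeal X)
  exact ⟨X, h, hiso, hh⟩

lemma exists_eq_locRing [IsIntegral W] {X : M.Model} {h : W ⟶ X.W} [IsIso h] [IsDominant (h ≫ X.π)] (w : W) :
    locRing (h ≫ X.π) w = locRing X.π (h w) :=
  have : IsDominant h := isDominant_of_isOpenImmersion h
  locRing_isOpenImmersion h X.π w

variable {g : W ⟶ V}

lemma IsModel.existsUnique_lift [V.IsSeparated] [IsIntegral T] (H : M.IsModel g) {g' : T ⟶ V}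
    [IsDominant g'] (h : ∀ t, M.IsPrincipalAt g' t) : ∃! m : T ⟶ W, m ≫ g = g' := by
  obtain ⟨X, i, hiso, rfl⟩ := H
  obtain ⟨m, hm, hu⟩ := existsUnique_lift_of_isPrincipalAt X h
  refine ⟨m ≫ inv i, by simpa using hm, fun m' hm' => ?_⟩
  have := hu (m' ≫ i) (by simpa using hm')
  rw [← this, Category.assoc, IsIso.hom_inv_id, Category.comp_id]

lemma IsModel.isLocallyBlowup [V.IsSeparated] (H : M.IsModel g) : IsLocallyBlowup g := by
  obtain ⟨X, h, hiso, rfl⟩ := H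
  exact (isLocallyBlowup_π X).iso_comp h

variable [IsIntegral W] [IsDominant g]

lemma IsModel.bijective (H : M.IsModel g) : Function.Bijective (functionFieldMap g) := by
  obtain ⟨X, h, hiso, rfl⟩ := H
  have : IsDominant h := isDominant_of_isOpenImmersion h
  rw [functionFieldMap_comp, RingHom.coe_comp]
  exact (functionFieldMap_bijective_of_isOpenImmersion h).comp functionFieldMap_bijective

lemma eq_genericPoint_of_locRing_eq_top {X : M.Model} {w : X.W} (hw : locRing X.π w = ⊤) :
    w = genericPoint X.W := by
  obtain ⟨B, hB, p, rfl⟩ := X.exists_eq w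
  rw [← genericPoint_eq_of_isOpenImmersion (X.ι B hB)]
  congr 1
  rw [genericPoint_eq_bot_of_affine]
  refine PrimeSpectrum.ext ((Submodule.eq_bot_iff _).2 fun b hb => ?_)
  by_contra hb0
  have hb1 : (b : V.functionField) ≠ 0 := fun h => hb0 (Subtype.ext h)
  obtain ⟨a, s, hs, h⟩ := mem_locRing_ι.1
    (show (b : V.functionField)⁻¹ ∈ locRing X.π (X.ι B hB p) from hw ▸ trivial)
  have h2 : s = a * b := Subtype.ext (by
    rw [Subring.coe_mul, ← h, mul_assoc, mul_comm _ (b : V.functionField), ← mul_assoc,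
      inv_mul_cancel₀ hb1, one_mul])
  exact hs (h2 ▸ p.asIdeal.mul_mem_left a hb)

/-- A morphism to the blowup whose composite to `V` is dominant is dominant: the generic point of
the blowup is the only point above that of `V`. -/
lemma IsModel.isDominant_of_comp [IsIntegral T] (H : M.IsModel g) (f : T ⟶ W) [hd : IsDominant (f ≫ g)] :
    IsDominant f := by
  obtain ⟨X, h, hiso, rfl⟩ := H
  have hh : IsDominant h := isDominant_of_isOpenImmersion h
  have hgen : X.π (h (f (genericPoint T))) = genericPoint V := by
    have := hd
    have h1 : IsGenericPoint ((f ≫ h ≫ X.π) (genericPoint T)) ⊤ := by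
      have h2 := (genericPoint_spec T).image (f ≫ h ≫ X.π).continuous
      rwa [Set.image_univ, (f ≫ h ≫ X.π).denseRange.closure_range] at h2
    exact h1.eq (genericPoint_spec V)
  have htop : locRing X.π (h (f (genericPoint T))) = ⊤ := by
    refine top_le_iff.1 fun x _ => ?_
    have hx : x ∈ stalkRing (genericPoint V) := by
      refine ⟨x, ?_⟩
      change V.presheaf.stalkSpecializes _ x = x
      rw [TopCat.Presheaf.stalkSpecializes_refl]
      rfl
    rw [← hgen] at hx
    obtain ⟨a, rfl⟩ := hx
    exact stalkMap_range_le_locRing X.π _ a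
  have h1 := eq_genericPoint_of_locRing_eq_top htop
  rw [← genericPoint_eq_of_isOpenImmersion h] at h1
  have h2 : f (genericPoint T) = genericPoint W := h.isOpenEmbedding.injective h1
  refine ⟨?_⟩
  refine dense_iff_closure_eq.2 (Set.eq_univ_of_univ_subset ?_)
  rw [← (genericPoint_spec W).def, ← h2]
  exact closure_mono (Set.singleton_subset_iff.2 ⟨_, rfl⟩)

variable [V.IsSeparated]

lemma locallyGenerates_locRing_chart {X : M.Model}
    {U : V.affineOpens} [Nonempty U.1] {f : V.functionField} (hf : f ∈ M.sec U) (hf0 : f ≠ 0)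
    (p : Spec (.of (chartRing (M.sec U) f))) :
    LocallyGenerates ((algebraMap Γ(V, U.1) V.functionField).range ∪
      (fun m => m / f) '' (M.sec U : Set V.functionField))
      (locRing X.π (X.ι _ (chartRing_mem_charts hf hf0) p)) := by
  obtain ⟨hU, hdiv⟩ := (mem_range_ι_iff (X := X) hf hf0).1 ⟨p, rfl⟩
  have hgen := locallyGenerates_locRing_ι (X := X) (hB := chartRing_mem_charts hf hf0) p
  refine ⟨?_, fun R' h1 h2 h3 => hgen.2 R' ?_ h2 h3⟩
  · rintro _ (hx | ⟨m, hm, rfl⟩)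
    · exact range_le_locRing (π := X.π) hU hx
    · exact hdiv m hm
  · exact chartRing_le_iff.2 ⟨fun x hx => h1 (Or.inl hx), fun m hm => h1 (Or.inr ⟨m, hm, rfl⟩)⟩

/-- The local rings of the blowup are generated by quotients of sections of `M`. -/
lemma IsModel.exists_locallyGenerates (H : M.IsModel g) (w : W) (U : V.affineOpens) [Nonempty U.1]
    (hU : g w ∈ U.1) : ∃ f ∈ M.sec U, f ≠ 0 ∧
      LocallyGenerates ((algebraMap Γ(V, U.1) V.functionField).range ∪
        (fun m => m / f) '' (M.sec U : Set V.functionField)) (locRing g w) := by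
  obtain ⟨X, h, hiso, rfl⟩ := H
  rw [exists_eq_locRing]
  obtain ⟨f, hf, hf0, hdiv⟩ := isPrincipalAt_π X (h w) U hU
  refine ⟨f, hf, hf0, ?_⟩
  obtain ⟨p, hp⟩ := (mem_range_ι_iff hf hf0).2 ⟨hU, hdiv⟩
  have hgen := locallyGenerates_locRing_chart (X := X) hf hf0 p
  rwa [hp] at hgen

lemma IsModel.isPrincipalAt (H : M.IsModel g) (w : W) : M.IsPrincipalAt g w := by
  intro U _ hU
  obtain ⟨f, hf, hf0, h⟩ := H.exists_locallyGenerates w U hU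
  exact ⟨f, hf, hf0, fun m hm => h.1 (Or.inr ⟨m, hm, rfl⟩)⟩

end FracIdeal

end IsModel

/-! ### Principal modules over local rings -/

section Principal

variable {K : Type*} [Field K] {r : ℕ} {R : Subring K}

lemma map_mulLeft_span_singleton (f y : K) :
    (Submodule.span R {y}).map (LinearMap.mulLeft R f) = Submodule.span R {f * y} := by
  rw [Submodule.map_span, Set.image_singleton]
  rfl

lemma exists_map_mulLeft_eq_iff {N : Submodule R K} {f : K} (hf : f ≠ 0) :
    (∃ y ≠ 0, N.map (LinearMap.mulLeft R f) = Submodule.span R {y}) ↔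
      ∃ y ≠ 0, N = Submodule.span R {y} := by
  constructor
  · rintro ⟨y, hy, h⟩
    refine ⟨f⁻¹ * y, mul_ne_zero (inv_ne_zero hf) hy, ?_⟩
    refine Submodule.map_injective_of_injective (f := LinearMap.mulLeft R f)
      (mul_right_injective₀ hf) ?_
    rw [h, map_mulLeft_span_singleton, mul_inv_cancel_left₀ hf]
  · rintro ⟨y, hy, rfl⟩
    exact ⟨f * y, mul_ne_zero hf hy, map_mulLeft_span_singleton f y⟩

/-- Over a local ring, the factors of a principal fractional ideal are principal. -/
lemma exists_eq_span_of_mul [IsLocalRing R] {N N' : Submodule R K}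
    (h : ∃ y ≠ 0, N * N' = Submodule.span R {y}) :
    (∃ y ≠ 0, N = Submodule.span R {y}) ∧ ∃ y ≠ 0, N' = Submodule.span R {y} := by
  obtain ⟨y, hy, h⟩ := h
  rw [Submodule.mul_eq_span_mul_set] at h
  obtain ⟨_, ⟨a, ha, b, hb, rfl⟩, hab0, hab⟩ := exists_generator_mem Subtype.val_injective hy h
  rw [div_mem_iff_span_eq (Set.mul_mem_mul ha hb) hab0] at hab
  have ha0 : a ≠ 0 := left_ne_zero_of_mul hab0
  have hb0 : b ≠ 0 := right_ne_zero_of_mul hab0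
  refine ⟨⟨a, ha0, ?_⟩, b, hb0, ?_⟩
  · rw [← Submodule.span_eq N, div_mem_iff_span_eq ha ha0]
    intro m hm
    have := hab _ (Set.mul_mem_mul hm hb)
    rwa [mul_div_mul_right _ _ hb0] at this
  · rw [← Submodule.span_eq N', div_mem_iff_span_eq hb hb0]
    intro m hm
    have := hab _ (Set.mul_mem_mul ha hm)
    rwa [mul_div_mul_left _ _ ha0] at this

variable {A : Type*} [CommRing A] [Algebra A K] (δ : Fin r → Derivation ℤ K K)

/-- On a blowup of `M`, the fractional ideal `F(M)` and the jacobian ideal agree up to a rational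
function. -/
lemma hasPrincipalJacobian_iff_gaussF [IsLocalRing R] {S : Subring K} (hSR : S ≤ R)
    {M : Submodule A K} {f : K} (hf : f ∈ M) (hf0 : f ≠ 0)
    (h : LocallyGenerates ((algebraMap A K).range ∪ (fun m => m / f) '' M) S) :
    HasPrincipalJacobian δ S R ↔
      ∃ y ≠ 0, Submodule.span R (gaussF δ M : Set K) = Submodule.span R {y} := by
  have hSR' : (algebraMap S K).range ≤ (algebraMap R K).range := by
    rwa [algebraMap_range_subring, algebraMap_range_subring]
  have key : Submodule.span R (gaussF δ M : Set K) =
      (Submodule.span R (gaussF δ (1 : Submodule S K) : Set K)).map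
        (LinearMap.mulLeft R (f ^ (r + 1))) := by
    refine (span_span_of_range_le hSR' _).symm.trans ?_
    rw [span_gaussF_eq δ hf hf0 h, Submodule.map_span]
    rfl
  rw [hasPrincipalJacobian_iff δ hSR, key, exists_map_mulLeft_eq_iff (pow_ne_zero _ hf0)]

/-- If `F(M F(M)) = F(M) ^ {r + 2}`, then the jacobians generate a principal ideal in the local
rings of the blowup of `M F(M)`: this blowup makes `F(M)` principal, hence also
`F(M F(M))`. -/
lemma hasPrincipalJacobian_of_gaussEquation [IsLocalRing R] {M : Submodule A K}
    (heq : gaussF δ (M * gaussF δ M) = gaussF δ M ^ (r + 2)) {h : K} (hh : h ∈ M * gaussF δ M)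
    (hh0 : h ≠ 0) (hgen : LocallyGenerates ((algebraMap A K).range ∪
      (fun m => m / h) '' (M * gaussF δ M : Submodule A K)) R) : HasPrincipalJacobian δ R R := by
  have hAR := range_le_of_locallyGenerates hgen
  have hspan := (div_mem_iff_span_eq (S := ((M * gaussF δ M : Submodule A K) : Set K)) hh hh0).2
    fun m hm => hgen.1 (Or.inr ⟨m, hm, rfl⟩)
  rw [span_mul_of_range_le hAR] at hspan
  obtain ⟨y, hy, h⟩ := (exists_eq_span_of_mul ⟨h, hh0, hspan⟩).2
  rw [hasPrincipalJacobian_iff_gaussF δ le_rfl hh hh0 hgen, heq, span_pow_of_range_le hAR, h,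
    Submodule.span_pow, Set.singleton_pow]
  exact ⟨_, pow_ne_zero _ hy, rfl⟩

end Principal

/-! ### The Gauss blowup -/

section GaussBlowup

variable {k : Type u} [Field k] {V W T : Scheme.{u}}

lemma exists_affineOpens_mem (x : V) : ∃ (U : V.affineOpens) (_ : Nonempty U.1), x ∈ U.1 := by
  obtain ⟨U, hU, hx, -⟩ := exists_isAffineOpen_mem_and_subset (U := ⊤) (x := x) trivial
  exact ⟨⟨U, hU⟩, ⟨⟨x, hx⟩⟩, hx⟩

variable [IsIntegral V] [IsIntegral W] [IsIntegral T]

lemma FracIdeal.IsPrincipalAt.of_mul {M N : FracIdeal V} {g : T ⟶ V} [IsDominant g] {t : T}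
    (h : (M.mul N).IsPrincipalAt g t) : M.IsPrincipalAt g t := by
  obtain ⟨U, _, hU⟩ := exists_affineOpens_mem (g t)
  have hAR : (algebraMap Γ(V, U.1) V.functionField).range ≤
      (algebraMap (locRing g t) V.functionField).range := by
    rw [algebraMap_range_subring]; exact range_le_locRing hU
  obtain ⟨y, hy, hy0, h⟩ := h U hU
  have h1 : Submodule.span (locRing g t) (M.sec U : Set V.functionField) *
      Submodule.span (locRing g t) (N.sec U : Set V.functionField) =
        Submodule.span (locRing g t) {y} :=
    (span_mul_of_range_le hAR _ _).symm.trans ((div_mem_iff_span_eq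
      (S := ((M.mul N).sec U : Set V.functionField)) hy hy0).2 h)
  obtain ⟨z, hz, h2⟩ := (exists_eq_span_of_mul ⟨y, hy0, h1⟩).1
  exact isPrincipalAt_of_span_eq hU hz h2

variable {s : V ⟶ Spec (.of k)} {L : Foliation s} {r : ℕ}
  {δ : Fin r → Derivation ℤ V.functionField V.functionField}

lemma Frame.lift_isNonsingular_iff (F : Frame L (RingHom.id _) δ) {g : W ⟶ V} [IsDominant g]
    (hg : Function.Bijective (functionFieldMap g)) :
    (L.lift g).IsNonsingular ↔ ∀ w, HasPrincipalJacobian δ (locRing g w) (locRing g w) :=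
  (F.lift g hg).isNonsingular_iff

lemma Frame.lift_lift_isNonsingular_iff (F : Frame L (RingHom.id _) δ) {p : W ⟶ V} [IsDominant p]
    (hp : Function.Bijective (functionFieldMap p)) {q : T ⟶ W} [IsDominant q]
    (hq : Function.Bijective (functionFieldMap q)) : ((L.lift p).lift q).IsNonsingular ↔
      ∀ t, HasPrincipalJacobian δ (locRing (q ≫ p) t) (locRing (q ≫ p) t) := by
  have h : ∀ t, locRing (q ≫ p) t = (algebraMap (T.presheaf.stalk t) T.functionField).range.comap
      ((functionFieldMap q).comp ((functionFieldMap p).comp (RingHom.id _))) := fun t => by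
    rw [locRing, functionFieldMap_comp]; rfl
  simp only [h]
  exact ((F.lift p hp).lift q hq).isNonsingular_iff

variable [IsLocallyNoetherian V] [V.IsSeparated]
  {hδ : LinearIndependent V.functionField δ}
  {hE : ∀ (U : V.affineOpens) [Nonempty U.1], ∃ E : Submodule Γ(V, U.1) V.functionField, E.FG ∧
      ∀ i a, δ i (algebraMap Γ(V, U.1) V.functionField a) ∈ E}
  {M : FracIdeal V}

/-- On a blowup of `M`, the pull-back of the sheaf of differentials modulo torsion is locally free
at a point if and only if `M F(M)` is principal there. -/
lemma FracIdeal.IsModel.free_pullbackDifferentials_iff {p : W ⟶ V} [IsDominant p] (H : M.IsModel p)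
    (F : Frame L (RingHom.id _) δ) (g : T ⟶ W) [IsDominant g]
    (hg : Function.Bijective (functionFieldMap g)) (t : T) :
    Module.Free (T.presheaf.stalk t) ((L.lift p).pullbackDifferentials g t) ↔
      (M.mul (M.gauss δ hδ hE)).IsPrincipalAt (g ≫ p) t := by
  obtain ⟨U, _, hU⟩ := exists_affineOpens_mem ((g ≫ p) t)
  obtain ⟨f, hf, hf0, hgen⟩ := H.exists_locallyGenerates (g t) U hU
  have hR : (algebraMap (T.presheaf.stalk t) T.functionField).range.comap
      ((functionFieldMap g).comp ((functionFieldMap p).comp (RingHom.id _))) =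
        locRing (g ≫ p) t := by
    rw [locRing, functionFieldMap_comp]; rfl
  have hSR : locRing p (g t) ≤ locRing (g ≫ p) t := locRing_le_comp g p t
  have hAR : (algebraMap Γ(V, U.1) V.functionField).range ≤
      (algebraMap (locRing (g ≫ p) t) V.functionField).range := by
    rw [algebraMap_range_subring]; exact range_le_locRing (π := g ≫ p) (w := t) hU
  have hM : Submodule.span (locRing (g ≫ p) t) (M.sec U : Set V.functionField) =
      Submodule.span (locRing (g ≫ p) t) {f} :=
    (div_mem_iff_span_eq hf hf0).2 fun m hm => hSR (hgen.1 (Or.inr ⟨m, hm, rfl⟩))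
  have hprod : Submodule.span (locRing (g ≫ p) t)
      ((M.mul (M.gauss δ hδ hE)).sec U : Set V.functionField) =
        Submodule.span (locRing (g ≫ p) t) (M.sec U : Set V.functionField) *
          Submodule.span (locRing (g ≫ p) t) (gaussF δ (M.sec U) : Set V.functionField) :=
    span_mul_of_range_le hAR _ _
  refine ((F.lift p H.bijective).free_pullbackDifferentials_iff g hg t).trans ?_
  rw [hR]
  refine (hasPrincipalJacobian_iff_gaussF δ hSR hf hf0 hgen).trans ⟨?_, fun h => ?_⟩
  · rintro ⟨y, hy, h⟩
    refine isPrincipalAt_of_span_eq hU (mul_ne_zero hf0 hy) ?_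
    rw [hprod, hM, h, Submodule.span_mul_span, Set.singleton_mul_singleton]
  · obtain ⟨y, hy, hy0, h⟩ := h U hU
    have h1 := (div_mem_iff_span_eq
      (S := ((M.mul (M.gauss δ hδ hE)).sec U : Set V.functionField)) hy hy0).2 h
    rw [hprod] at h1
    exact (exists_eq_span_of_mul ⟨y, hy0, h1⟩).2

lemma FracIdeal.IsModel.extendsGaussMap_iff {p : W ⟶ V} [IsDominant p] (H : M.IsModel p)
    (F : Frame L (RingHom.id _) δ) (g : T ⟶ W) [IsDominant g] :
    (L.lift p).ExtendsGaussMap g ↔ Function.Bijective (functionFieldMap g) ∧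
      ∀ t, (M.mul (M.gauss δ hδ hE)).IsPrincipalAt (g ≫ p) t :=
  ⟨fun h => ⟨h.birational, fun t =>
    (H.free_pullbackDifferentials_iff F g h.birational t).1 (h.free t)⟩,
    fun h => ⟨h.1, fun t => (H.free_pullbackDifferentials_iff F g h.1 t).2 (h.2 t)⟩⟩

/-- The blowup of `M F(M)` is the Gauss blowup of the blowup of `M`. -/
lemma FracIdeal.IsModel.exists_isGaussBlowup {p : W ⟶ V} [IsDominant p] (H : M.IsModel p)
    (F : Frame L (RingHom.id _) δ) {π : T ⟶ V} [IsDominant π]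
    (Hπ : (M.mul (M.gauss δ hδ hE)).IsModel π) :
    ∃ (q : T ⟶ W) (_ : IsDominant q), q ≫ p = π ∧ (L.lift p).IsGaussBlowup q := by
  obtain ⟨q, hq, -⟩ := H.existsUnique_lift fun t => (Hπ.isPrincipalAt t).of_mul
  have : IsDominant (q ≫ p) := hq ▸ ‹IsDominant π›
  have hqd : IsDominant q := H.isDominant_of_comp q
  subst hq
  refine ⟨q, hqd, rfl, (H.extendsGaussMap_iff F q).2 ⟨?_, Hπ.isPrincipalAt⟩, ?_⟩
  · have h := Hπ.bijective
    rw [functionFieldMap_comp, RingHom.coe_comp] at h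
    exact (Function.Bijective.of_comp_iff _ H.bijective).1 h
  · intro T' _ g _ hg
    have hg1 : ∀ t, (M.mul (M.gauss δ hδ hE)).IsPrincipalAt (g ≫ p) t :=
      ((H.extendsGaussMap_iff F g).1 hg).2
    obtain ⟨h, hh, hu⟩ := Hπ.existsUnique_lift hg1
    have hlift := H.existsUnique_lift fun t => (hg1 t).of_mul
    refine ⟨h, hlift.unique (by simpa using hh) rfl, fun h' hh' => hu h' ?_⟩
    simp only [← hh', Category.assoc]

lemma FracIdeal.IsModel.isModel_of_isGaussBlowup {p : W ⟶ V} [IsDominant p] (H : M.IsModel p)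
    (F : Frame L (RingHom.id _) δ) {q : T ⟶ W} [IsDominant q]
    (hq : (L.lift p).IsGaussBlowup q) : (M.mul (M.gauss δ hδ hE)).IsModel (q ≫ p) := by
  obtain ⟨X⟩ := (M.mul (M.gauss δ hδ hE)).nonempty_model
  obtain ⟨q', hq'd, hq', hG⟩ := H.exists_isGaussBlowup F (isModel_π X)
  obtain ⟨h, hh, -⟩ := hG.existsUnique_lift T q hq.extendsGaussMap
  obtain ⟨h', hh', -⟩ := hq.existsUnique_lift X.W q' hG.extendsGaussMap
  refine ⟨X, h, ⟨h', ?_, ?_⟩, by rw [← hq', ← Category.assoc, hh]⟩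
  · exact (hq.existsUnique_lift T q hq.extendsGaussMap).unique (by simp [hh, hh']) (by simp)
  · exact (hG.existsUnique_lift X.W q' hG.extendsGaussMap).unique (by simp [hh, hh']) (by simp)

end GaussBlowup

/-! ### Derivations over schemes of finite type -/

section FiniteType

/-- The values on a finitely generated algebra of finitely many derivations over the ground field
generate a finitely generated module. -/
lemma exists_fg_derivation_mem {k A K : Type*} [Field k] [CommRing A] [Field K] [Algebra A K] {r : ℕ}
    (δ : Fin r → Derivation ℤ K K) (φ : k →+* A) (hφ : φ.FiniteType)
    (hδ : ∀ i c, δ i (algebraMap A K (φ c)) = 0) :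
    ∃ E : Submodule A K, E.FG ∧ ∀ i a, δ i (algebraMap A K a) ∈ E := by
  classical
  let _ : Algebra k A := φ.toAlgebra
  obtain ⟨S, hS⟩ := hφ.1
  refine ⟨Submodule.span A (⋃ i, (fun a => δ i (algebraMap A K a)) '' S),
    Submodule.fg_span (Set.finite_iUnion fun i => S.finite_toSet.image _), fun i a => ?_⟩
  have ha : a ∈ Algebra.adjoin k (S : Set A) := hS ▸ trivial
  induction ha using Algebra.adjoin_induction with
  | mem x hx => exact Submodule.subset_span (Set.mem_iUnion.2 ⟨i, x, hx, rfl⟩)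
  | algebraMap c =>
    change δ i (algebraMap A K (φ c)) ∈ _
    rw [hδ]; exact Submodule.zero_mem _
  | add x y _ _ hx hy => rw [map_add, map_add]; exact Submodule.add_mem _ hx hy
  | mul x y _ _ hx hy =>
    rw [map_mul, Derivation.leibniz, algebraMap_smul, algebraMap_smul]
    exact Submodule.add_mem _ (Submodule.smul_mem _ _ hy) (Submodule.smul_mem _ _ hx)

variable {k : Type u} [Field k] {V : Scheme.{u}}

/-- The inclusion of the ground field in a ring of sections. -/
def sectionConstants (s : V ⟶ Spec (.of k)) (U : V.Opens) : k →+* Γ(V, U) :=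
  (s.appLE ⊤ U le_top).hom.comp (Scheme.ΓSpecIso (.of k)).inv.hom

lemma finiteType_sectionConstants (s : V ⟶ Spec (.of k)) [LocallyOfFiniteType s]
    (U : V.affineOpens) :
    (sectionConstants s U.1).FiniteType :=
  RingHom.FiniteType.comp
    (s.finiteType_appLE (isAffineOpen_top _) U.2 le_top)
    (RingHom.FiniteType.of_surjective _
      (Scheme.ΓSpecIso (.of k)).symm.commRingCatIsoToRingEquiv.surjective)

lemma isUnit_natCast_section (s : V ⟶ Spec (.of k)) [CharZero k]
    (U : V.Opens) {n : ℕ} (hn : n ≠ 0) :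
    IsUnit (n : Γ(V, U)) := by
  have h : IsUnit (n : k) := (Nat.cast_ne_zero.2 hn).isUnit
  simpa using h.map (sectionConstants s U)

variable (s : V ⟶ Spec (.of k))

lemma algebraMap_sectionConstants [IsIntegral V] (U : V.Opens) [Nonempty U] (c : k) :
    algebraMap Γ(V, U) V.functionField (sectionConstants s U c) = constants s c := by
  have h : s.appTop ≫ V.presheaf.map (homOfLE le_top).op = s.appLE ⊤ U le_top :=
    rfl
  have h2 : ∀ a : Γ(V, ⊤), algebraMap Γ(V, U) V.functionField
      (V.presheaf.map (homOfLE (le_top : U ≤ ⊤)).op a) =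
        V.presheaf.germ ⊤ (genericPoint V) trivial a := fun a =>
    V.presheaf.germ_res_apply (homOfLE le_top) _ _ a
  refine Eq.trans ?_ (h2 _)
  rw [sectionConstants, ← h]
  rfl

lemma Foliation.exists_fg_derivation_mem [IsIntegral V] [LocallyOfFiniteType s] (L : Foliation s)
    {r : ℕ} (b : Module.Basis (Fin r) V.functionField L.carrier) (U : V.affineOpens)
    [Nonempty U.1] : ∃ E : Submodule Γ(V, U.1) V.functionField, E.FG ∧
      ∀ i a, (b i).1 (algebraMap Γ(V, U.1) V.functionField a) ∈ E :=
  FoliatedVariety.exists_fg_derivation_mem _ (sectionConstants s U.1)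
    (finiteType_sectionConstants s U) fun i c => by
      rw [algebraMap_sectionConstants]
      exact L.map_constants _ (b i).2 c

lemma isLocallyNoetherian_of_field [LocallyOfFiniteType s] : IsLocallyNoetherian V :=
  LocallyOfFiniteType.isLocallyNoetherian s

lemma isSeparated_of_field [IsSeparated s] : V.IsSeparated := by
  rw [Scheme.isSeparated_iff, ← Limits.terminal.comp_from s]
  infer_instance

lemma compactSpace_of_field [QuasiCompact s] : CompactSpace V :=
  QuasiCompact.compactSpace_of_compactSpace s

end FiniteType

/-! ### Ideal sheaves from fractional ideal sheaves -/

section ToIdeal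

variable {V : Scheme.{u}}

lemma subsingleton_section (U : V.Opens) (h : ¬ Nonempty U) : Subsingleton Γ(V, U) := by
  have : U = ⊥ := le_bot_iff.1 fun x hx => (h ⟨⟨x, hx⟩⟩).elim
  subst this
  infer_instance

lemma exists_notMem_forall_smul_mem {A E : Type*} [CommRing A] [AddCommGroup E] [Module A E]
    (N : Submodule A E) (p : Ideal A) [hp : p.IsPrime] (T : Finset E)
    (h : ∀ m ∈ T, ∃ s ∉ p, s • m ∈ N) : ∃ s ∉ p, ∀ m ∈ T, s • m ∈ N := by
  classical
  induction T using Finset.induction_on with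
  | empty => exact ⟨1, (Ideal.ne_top_iff_one _).1 hp.ne_top, by simp⟩
  | insert m T _ ih =>
    obtain ⟨s, hs, hsT⟩ := ih fun m hm => h m (Finset.mem_insert_of_mem hm)
    obtain ⟨t, ht, htm⟩ := h m (Finset.mem_insert_self _ _)
    refine ⟨s * t, hp.mul_notMem hs ht, fun m' hm' => ?_⟩
    obtain rfl | hm' := Finset.mem_insert.1 hm'
    · rw [mul_smul]; exact N.smul_mem _ htm
    · rw [mul_comm, mul_smul]; exact N.smul_mem _ (hsT m' hm')

section Denominators

variable {A K : Type*} [CommRing A] [Field K] [Algebra A K]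

/-- The ideal of denominators of `N`, consisting of the `a ∈ A` with `a N ⊆ A`. -/
def denominatorIdeal (N : Submodule A K) : Submodule A K := 1 / N ⊓ 1

lemma mem_denominatorIdeal {N : Submodule A K} {y : K} : y ∈ denominatorIdeal N ↔
    (∀ m ∈ N, y * m ∈ (algebraMap A K).range) ∧ y ∈ (algebraMap A K).range := by
  rw [denominatorIdeal, Submodule.mem_inf, Submodule.mem_div_iff_forall_mul_mem]
  simp only [Submodule.mem_one, RingHom.mem_range]

lemma denominatorIdeal_le_one (N : Submodule A K) : denominatorIdeal N ≤ 1 := inf_le_right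

lemma denominatorIdeal_mul_le_one (N : Submodule A K) : denominatorIdeal N * N ≤ 1 :=
  Submodule.mul_le.2 fun _ hy m hm => Submodule.mem_one.2 ((mem_denominatorIdeal.1 hy).1 m hm)

lemma fg_denominatorIdeal [IsNoetherianRing A] (N : Submodule A K) : (denominatorIdeal N).FG := by
  have h1 : (1 : Submodule A K).FG :=
    Submodule.one_eq_span (R := A) (A := K) ▸ Submodule.fg_span_singleton _
  have := isNoetherian_of_fg_of_noetherian _ h1
  exact Submodule.FG.of_le h1 (denominatorIdeal_le_one N)

lemma denominatorIdeal_ne_bot [IsDomain A] [IsFractionRing A K] {N : Submodule A K} (hN : N.FG) :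
    denominatorIdeal N ≠ ⊥ := by
  obtain ⟨d, hd, hd1, h⟩ := exists_mul_mem_range hN
  exact (Submodule.ne_bot_iff _).2 ⟨d, mem_denominatorIdeal.2 ⟨h, hd1⟩, hd⟩

/-- Denominators over a larger ring `A'`. -/
lemma mem_denominatorIdeal_span {A' : Type*} [CommRing A'] [Algebra A' K]
    (h : (algebraMap A K).range ≤ (algebraMap A' K).range) {N : Submodule A K} {y : K}
    (hy : y ∈ denominatorIdeal N) :
    y ∈ denominatorIdeal (Submodule.span A' (N : Set K)) := by
  obtain ⟨hy1, hy2⟩ := mem_denominatorIdeal.1 hy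
  refine mem_denominatorIdeal.2 ⟨fun m hm => ?_, h hy2⟩
  induction hm using Submodule.span_induction with
  | mem m hm => exact h (hy1 m hm)
  | zero => rw [mul_zero]; exact Subring.zero_mem _
  | add m m' _ _ hm hm' => rw [mul_add]; exact Subring.add_mem _ hm hm'
  | smul a m _ hm =>
    rw [mul_smul_comm, Algebra.smul_def]
    exact Subring.mul_mem _ ⟨a, rfl⟩ hm

/-- Denominators in a local ring `R` of `A` become denominators over `A` after multiplication by
an element which is invertible in `R`. -/
lemma exists_smul_mem_denominatorIdeal {N : Submodule A K} (hN : N.FG) {p : Ideal A} [p.IsPrime]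
    {R : Subring K} (hR : ∀ y ∈ R, ∃ s ∉ p, ∃ a, algebraMap A K s * y = algebraMap A K a) {y : K}
    (hy : y ∈ R) (hyN : ∀ m ∈ N, y * m ∈ R) : ∃ s ∉ p, s • y ∈ denominatorIdeal N := by
  classical
  obtain ⟨T, rfl⟩ := hN
  obtain ⟨s, hs, hsT⟩ := exists_notMem_forall_smul_mem (1 : Submodule A K) p
    (insert y (T.image fun m => y * m)) fun z hz => by
      have hz : z ∈ R := by
        obtain rfl | hz := Finset.mem_insert.1 hz
        · exact hy
        · obtain ⟨m, hm, rfl⟩ := Finset.mem_image.1 hz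
          exact hyN m (Submodule.subset_span hm)
      obtain ⟨s, hs, a, ha⟩ := hR z hz
      exact ⟨s, hs, Submodule.mem_one.2 ⟨a, by rw [← ha, Algebra.smul_def]⟩⟩
  refine ⟨s, hs, Submodule.mem_div_iff_forall_mul_mem.2 fun m hm => ?_,
    hsT _ (Finset.mem_insert_self _ _)⟩
  induction hm using Submodule.span_induction with
  | mem m hm =>
    rw [smul_mul_assoc]
    exact hsT _ (Finset.mem_insert_of_mem (Finset.mem_image_of_mem _ hm))
  | zero => rw [mul_zero]; exact Submodule.zero_mem _
  | add m m' _ _ hm hm' => rw [mul_add]; exact Submodule.add_mem _ hm hm'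
  | smul a m _ hm => rw [mul_smul_comm]; exact Submodule.smul_mem _ _ hm

end Denominators

variable [IsIntegral V]

namespace FracIdeal

lemma algebraMap_res {U U' : V.Opens} [Nonempty U] [Nonempty U'] (h : U' ≤ U) (a : Γ(V, U)) :
    algebraMap Γ(V, U') V.functionField (V.presheaf.map (homOfLE h).op a) =
      algebraMap Γ(V, U) V.functionField a :=
  V.presheaf.germ_res_apply (homOfLE h) _ _ a

lemma map_comap_sec (N : FracIdeal V) (hN : ∀ (U : V.affineOpens) [Nonempty U.1], N.sec U ≤ 1)
    {U U' : V.affineOpens} [Nonempty U.1] [Nonempty U'.1] (h : U'.1 ≤ U.1) :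
    Ideal.map (V.presheaf.map (homOfLE h).op).hom
      ((N.sec U).comap (Algebra.linearMap Γ(V, U.1) V.functionField)) =
        (N.sec U').comap (Algebra.linearMap Γ(V, U'.1) V.functionField) := by
  refine le_antisymm (Ideal.map_le_iff_le_comap.2 fun a ha => ?_) fun x hx => ?_
  · change algebraMap Γ(V, U'.1) V.functionField (V.presheaf.map (homOfLE h).op a) ∈ N.sec U'
    rw [algebraMap_res h]
    exact N.sec_le h ha
  · have key : ∀ y ∈ Submodule.span Γ(V, U'.1) (N.sec U : Set V.functionField),
        ∃ z ∈ Ideal.map (V.presheaf.map (homOfLE h).op).hom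
          ((N.sec U).comap (Algebra.linearMap Γ(V, U.1) V.functionField)),
          algebraMap Γ(V, U'.1) V.functionField z = y := by
      intro y hy
      induction hy using Submodule.span_induction with
      | mem y hy =>
        obtain ⟨a, rfl⟩ := Submodule.mem_one.1 (hN U hy)
        exact ⟨_, Ideal.mem_map_of_mem _ hy, algebraMap_res h a⟩
      | zero => exact ⟨0, Ideal.zero_mem _, map_zero _⟩
      | add y y' _ _ hy hy' =>
        obtain ⟨z, hz, rfl⟩ := hy
        obtain ⟨z', hz', rfl⟩ := hy'
        exact ⟨z + z', Ideal.add_mem _ hz hz', map_add _ _ _⟩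
      | smul c y _ hy =>
        obtain ⟨z, hz, rfl⟩ := hy
        exact ⟨c * z, Ideal.mul_mem_left _ _ hz, by rw [map_mul, Algebra.smul_def]⟩
    obtain ⟨z, hz, hzx⟩ := key _ (by rw [N.span_eq U U' h]; exact hx)
    rwa [← injective_algebraMap U' hzx]

/-- A fractional ideal sheaf contained in the structure sheaf, as an ideal sheaf. -/
def toIdeal (N : FracIdeal V) (hN : ∀ (U : V.affineOpens) [Nonempty U.1], N.sec U ≤ 1) :
    V.IdealSheafData where
  ideal U := ⨅ _ : Nonempty U.1, (N.sec U).comap (Algebra.linearMap Γ(V, U.1) V.functionField)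
  map_ideal_basicOpen U f := by
    by_cases hf : Nonempty (V.affineBasicOpen f).1
    · have hU : Nonempty U.1 := hf.map fun x => ⟨x.1, V.basicOpen_le f x.2⟩
      rw [iInf_pos hU, iInf_pos hf]
      exact N.map_comap_sec hN (U' := V.affineBasicOpen f) (V.basicOpen_le f)
    · have := subsingleton_section _ hf
      have := (Submodule.subsingleton_iff Γ(V, (V.affineBasicOpen f).1)).2 this
      exact Subsingleton.elim (α := Ideal Γ(V, (V.affineBasicOpen f).1)) _ _

variable {N : FracIdeal V} {hN : ∀ (U : V.affineOpens) [Nonempty U.1], N.sec U ≤ 1}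

lemma sections_toIdeal (U : V.affineOpens) [hU : Nonempty U.1] :
    sections (N.toIdeal hN) U = N.sec U := by
  have h : (N.toIdeal hN).ideal U =
      (N.sec U).comap (Algebra.linearMap Γ(V, U.1) V.functionField) := iInf_pos hU
  rw [sections, h, Submodule.map_comap_eq, inf_eq_right]
  refine (hN U).trans ?_
  rw [Submodule.one_eq_range]

lemma toIdeal_ne_bot : N.toIdeal hN ≠ ⊥ := by
  intro h
  obtain ⟨U, hU, -⟩ := exists_affineOpens_mem (genericPoint V)
  have h1 := sections_toIdeal (hN := hN) U
  rw [h] at h1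
  exact N.ne_bot U (h1.symm.trans (Submodule.map_bot _))

lemma span_denominatorIdeal (M : FracIdeal V) {U U' : V.affineOpens} [Nonempty U.1]
    [Nonempty U'.1] (h : U'.1 ≤ U.1) :
    Submodule.span Γ(V, U'.1) (denominatorIdeal (M.sec U) : Set V.functionField) =
      denominatorIdeal (M.sec U') := by
  refine le_antisymm (Submodule.span_le.2 fun y hy => ?_)
    (le_of_forall_span_stalkRing_le fun x hx => ?_)
  · rw [← M.span_eq U U' h]
    have hle := range_algebraMap_le_of_le h
    exact mem_denominatorIdeal_span hle hy
  · rw [span_span_stalkRing hx]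
    refine Submodule.span_le.2 fun y hy => ?_
    obtain ⟨hy1, hy2⟩ := mem_denominatorIdeal.1 hy
    obtain ⟨p, rfl⟩ := U.2.range_fromSpec.ge (h hx)
    have hp : p.asIdeal.IsPrime := p.isPrime
    have hR : ∀ z ∈ stalkRing (U.2.fromSpec p), ∃ s ∉ p.asIdeal, ∃ a,
        algebraMap Γ(V, U.1) V.functionField s * z = algebraMap Γ(V, U.1) V.functionField a :=
      fun z hz => (mem_stalkRing_fromSpec U.2 p).1 hz
    have hyN : ∀ m ∈ M.sec U, y * m ∈ stalkRing (U.2.fromSpec p) := fun m hm =>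
      range_le_stalkRing hx (hy1 m (M.sec_le h hm))
    obtain ⟨s, hs, hsy⟩ := exists_smul_mem_denominatorIdeal (M.fg U) hR
      (range_le_stalkRing hx hy2) hyN
    have hs0 : algebraMap Γ(V, U.1) V.functionField s ≠ 0 := fun h0 => by
      have : s = 0 := injective_algebraMap U (h0.trans (map_zero _).symm)
      exact hs (this ▸ p.asIdeal.zero_mem)
    have hinv : (algebraMap Γ(V, U.1) V.functionField s)⁻¹ ∈ stalkRing (U.2.fromSpec p) :=
      (mem_stalkRing_fromSpec U.2 p).2 ⟨s, hs, 1, by rw [mul_inv_cancel₀ hs0, map_one]⟩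
    have : y = (⟨_, hinv⟩ : stalkRing (U.2.fromSpec p)) • (s • y) := by
      rw [Algebra.smul_def, Algebra.smul_def]
      exact (inv_mul_cancel_left₀ hs0 y).symm
    rw [this]
    exact Submodule.smul_mem _ _ (Submodule.subset_span hsy)

/-- The ideal sheaf of denominators of `M`: the functions `a` such that `a M` is contained in the
structure sheaf. -/
def denominators [IsLocallyNoetherian V] (M : FracIdeal V) : FracIdeal V where
  sec U _ := denominatorIdeal (M.sec U)
  fg U _ := by
    have := IsLocallyNoetherian.component_noetherian U
    exact fg_denominatorIdeal _
  ne_bot U _ := by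
    have := isFractionRing_section U
    exact denominatorIdeal_ne_bot (M.fg U)
  span_eq U U' _ _ h := M.span_denominatorIdeal h

end FracIdeal

end ToIdeal

/-! ### Resolution from a solution of the equation -/

section Resolution

variable {V : Scheme.{u}} [IsIntegral V]

lemma IsInvertible.ne_bot {D : V.IdealSheafData} (hD : IsInvertible D) : D ≠ ⊥ := by
  rintro rfl
  obtain ⟨U, hU, a, ha, h⟩ := hD (genericPoint V)
  have : Nonempty U.1 := ⟨⟨_, hU⟩⟩
  refine nonZeroDivisors.ne_zero ha ?_
  rw [← Ideal.span_singleton_eq_bot]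
  exact h.symm

lemma sections_mul_eq_map {D : V.IdealSheafData} {U : V.affineOpens} [Nonempty U.1] {a : Γ(V, U.1)}
    (h : D.ideal U = Ideal.span {a}) (N : Submodule Γ(V, U.1) V.functionField) :
    sections D U * N =
      N.map (LinearMap.mulLeft Γ(V, U.1) (algebraMap Γ(V, U.1) V.functionField a)) := by
  rw [sections, h, Ideal.span, Submodule.map_span, Set.image_singleton]
  ext x
  exact Submodule.mem_span_singleton_mul

lemma LocallyGenerates.of_map_mulLeft {A K : Type*} [CommRing A] [Field K] [Algebra A K]
    {N : Submodule A K} {a f : K} {R : Subring K} {S : Set K} (ha : a ≠ 0)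
    (h : LocallyGenerates (S ∪ (fun m => m / (a * f)) '' (N.map (LinearMap.mulLeft A a))) R) :
    LocallyGenerates (S ∪ (fun m => m / f) '' N) R := by
  convert h using 2
  rw [Submodule.map_coe, Set.image_image]
  refine Set.image_congr fun m _ => ?_
  rw [LinearMap.mulLeft_apply, mul_div_mul_left _ _ ha]

variable {k : Type u} [Field k] {W : Scheme.{u}} [IsIntegral W]
  {s : V ⟶ Spec (.of k)} {L : Foliation s} {r : ℕ}
  {δ : Fin r → Derivation ℤ V.functionField V.functionField}
  [IsLocallyNoetherian V] [V.IsSeparated] {hδ : LinearIndependent V.functionField δ}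
  {hE : ∀ (U : V.affineOpens) [Nonempty U.1], ∃ E : Submodule Γ(V, U.1) V.functionField, E.FG ∧
      ∀ i a, δ i (algebraMap Γ(V, U.1) V.functionField a) ∈ E}
  {M : FracIdeal V}

namespace FracIdeal

lemma IsModel.hasPrincipalJacobian (heq : ∀ (U : V.affineOpens) [Nonempty U.1],
    gaussF δ (M.sec U * gaussF δ (M.sec U)) = gaussF δ (M.sec U) ^ (r + 2)) {g : W ⟶ V}
    [IsDominant g] (H : (M.mul (M.gauss δ hδ hE)).IsModel g) (w : W) :
    HasPrincipalJacobian δ (locRing g w) (locRing g w) := by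
  obtain ⟨U, _, hU⟩ := exists_affineOpens_mem (g w)
  obtain ⟨f, hf, hf0, hgen⟩ := H.exists_locallyGenerates w U hU
  exact hasPrincipalJacobian_of_gaussEquation δ (heq U) hf hf0 hgen

/-- If every nonzero ideal sheaf contains an invertible one, then the fractional ideal sheaf
`M F(M)` is the product of an ideal sheaf and an invertible sheaf, so that its blowup is the
blowup of an ideal sheaf. -/
theorem resolvableByBlowup (F : Frame L (RingHom.id _) δ)
    (hE : ∀ (U : V.affineOpens) [Nonempty U.1], ∃ E : Submodule Γ(V, U.1) V.functionField, E.FG ∧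
      ∀ i a, δ i (algebraMap Γ(V, U.1) V.functionField a) ∈ E)
    (heq : ∀ (U : V.affineOpens) [Nonempty U.1],
      gaussF δ (M.sec U * gaussF δ (M.sec U)) = gaussF δ (M.sec U) ^ (r + 2))
    (hV : HasEnoughDivisors V) : L.ResolvableByBlowup := by
  let M' := M.mul (M.gauss δ F.linearIndependent hE)
  have hC : ∀ (U : V.affineOpens) [Nonempty U.1], M'.denominators.sec U ≤ 1 :=
    fun U _ => denominatorIdeal_le_one _
  obtain ⟨D, hD, hDC⟩ := hV (M'.denominators.toIdeal hC) toIdeal_ne_bot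
  let N := (ofIdeal D hD.ne_bot).mul M'
  have hDsec : ∀ (U : V.affineOpens) [Nonempty U.1], sections D U ≤ denominatorIdeal (M'.sec U) :=
    fun U _ => (Submodule.map_mono (hDC U)).trans (sections_toIdeal (hN := hC) U).le
  have hN : ∀ (U : V.affineOpens) [Nonempty U.1], N.sec U ≤ 1 := fun U _ =>
    (mul_le_mul_left (hDsec U) (M'.sec U)).trans (denominatorIdeal_mul_le_one _)
  obtain ⟨X⟩ := (ofIdeal (N.toIdeal hN) toIdeal_ne_bot).nonempty_model
  refine ⟨N.toIdeal hN, toIdeal_ne_bot, X.W, inferInstance, X.π, inferInstance,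
    isBlowup_ofIdeal X, (F.lift_isNonsingular_iff functionFieldMap_bijective).2 fun w => ?_⟩
  obtain ⟨U, hU, a, ha, hDa⟩ := hD (X.π w)
  have hUne : Nonempty U.1 := ⟨⟨_, hU⟩⟩
  obtain ⟨f, hf, hf0, hgen⟩ := (isModel_π X).exists_locallyGenerates w U hU
  have hsec : (ofIdeal (N.toIdeal hN) toIdeal_ne_bot).sec U =
      (M'.sec U).map (LinearMap.mulLeft Γ(V, U.1) (algebraMap Γ(V, U.1) V.functionField a)) :=
    (sections_toIdeal (hN := hN) U).trans (sections_mul_eq_map hDa (M'.sec U))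
  rw [hsec] at hf hgen
  obtain ⟨h, hh, rfl⟩ := hf
  have hgen' := LocallyGenerates.of_map_mulLeft (left_ne_zero_of_mul hf0) hgen
  exact hasPrincipalJacobian_of_gaussEquation δ (heq U) hh (right_ne_zero_of_mul hf0) hgen'

end FracIdeal

end Resolution

/-! ### Solutions of the equation from a resolution -/

section ChartPowers

variable {K : Type*} [Field K] {A : Type*} [CommRing A] [Algebra A K] {J : Submodule A K} {f : K}

lemma exists_pow_mul_mem_of_mem_chartRing (hf : f ∈ J) (hf0 : f ≠ 0) {b : K}
    (hb : b ∈ chartRing J f) : ∃ m, f ^ m * b ∈ J ^ m := by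
  have hpow : ∀ m, f ^ m ∈ J ^ m := fun m => Submodule.pow_mem_pow J hf m
  induction (show b ∈ Algebra.adjoin A _ from hb) using Algebra.adjoin_induction with
  | mem x hx =>
    obtain ⟨j, hj, rfl⟩ := hx
    refine ⟨1, ?_⟩
    rw [pow_one, pow_one, mul_div_cancel₀ _ hf0]
    exact hj
  | algebraMap a => exact ⟨0, by simp⟩
  | add x y hx hy ihx ihy =>
    obtain ⟨m, hm⟩ := ihx hx
    obtain ⟨n, hn⟩ := ihy hy
    refine ⟨m + n, ?_⟩
    rw [mul_add]
    refine Submodule.add_mem _ ?_ ?_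
    · rw [pow_add J, pow_add, mul_right_comm]
      exact Submodule.mul_mem_mul hm (hpow n)
    · rw [pow_add J, pow_add, mul_assoc]
      exact Submodule.mul_mem_mul (hpow m) hn
  | mul x y hx hy ihx ihy =>
    obtain ⟨m, hm⟩ := ihx hx
    obtain ⟨n, hn⟩ := ihy hy
    refine ⟨m + n, ?_⟩
    rw [pow_add J, pow_add, mul_mul_mul_comm]
    exact Submodule.mul_mem_mul hm hn

lemma exists_pow_mul_mem_of_mem_span (hf : f ∈ J) (hf0 : f ≠ 0) {Y : Submodule A K} {x : K}
    (hx : x ∈ Submodule.span (chartRing J f) (Y : Set K)) : ∃ m, f ^ m * x ∈ J ^ m * Y := by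
  have hpow : ∀ m, f ^ m ∈ J ^ m := fun m => Submodule.pow_mem_pow J hf m
  induction hx using Submodule.span_induction with
  | mem x hx => exact ⟨0, by simpa using hx⟩
  | zero => exact ⟨0, by simp⟩
  | add x y _ _ hx hy =>
    obtain ⟨m, hm⟩ := hx
    obtain ⟨n, hn⟩ := hy
    refine ⟨m + n, ?_⟩
    rw [mul_add]
    refine Submodule.add_mem _ ?_ ?_
    · rw [add_comm, pow_add J, pow_add, mul_assoc, mul_assoc]
      exact Submodule.mul_mem_mul (hpow n) hm
    · rw [pow_add J, pow_add, mul_assoc, mul_assoc]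
      exact Submodule.mul_mem_mul (hpow m) hn
  | smul c x _ hx =>
    obtain ⟨m, hm⟩ := hx
    obtain ⟨n, hn⟩ := exists_pow_mul_mem_of_mem_chartRing hf hf0 c.2
    refine ⟨n + m, ?_⟩
    have : f ^ (n + m) * c • x = (f ^ n * c) * (f ^ m * x) := by
      rw [Subring.smul_def, smul_eq_mul]; ring
    rw [this, pow_add, mul_assoc (J ^ n)]
    exact Submodule.mul_mem_mul hn hm

lemma LocallyGenerates.pow {R : Subring K} (hf : f ∈ J) (hf0 : f ≠ 0)
    (h : LocallyGenerates ((algebraMap A K).range ∪ (fun m => m / f) '' J) R) {n : ℕ} (hn : n ≠ 0) :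
    LocallyGenerates ((algebraMap A K).range ∪ (fun m => m / f ^ n) '' (J ^ n : Submodule A K))
      R := by
  have hAR := range_le_of_locallyGenerates h
  have hJ := (div_mem_iff_span_eq (S := (J : Set K)) hf hf0).2 fun m hm =>
    h.1 (Or.inr ⟨m, hm, rfl⟩)
  have hJn : Submodule.span R ((J ^ n : Submodule A K) : Set K) = Submodule.span R {f ^ n} := by
    rw [span_pow_of_range_le hAR, hJ, Submodule.span_pow, Set.singleton_pow]
  refine h.mono ?_ ?_
  · refine Set.union_subset_union_right _ ?_
    rintro _ ⟨m, hm, rfl⟩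
    obtain ⟨n, rfl⟩ := Nat.exists_eq_succ_of_ne_zero hn
    refine ⟨f ^ n * m, ?_, ?_⟩
    · rw [Nat.succ_eq_add_one, pow_succ J]
      exact Submodule.mul_mem_mul (Submodule.pow_mem_pow J hf n) hm
    · change f ^ n * m / f ^ (n + 1) = m / f
      rw [pow_succ, mul_div_mul_left _ _ (pow_ne_zero _ hf0)]
  · rintro _ (hx | ⟨m, hm, rfl⟩)
    · exact h.1 (Or.inl hx)
    · exact (div_mem_iff_span_eq (S := ((J ^ n : Submodule A K) : Set K))
        (Submodule.pow_mem_pow J hf n) (pow_ne_zero _ hf0)).1 hJn m hm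

/-- The equation holds in the local rings of the blowup of `J` in which the jacobians generate a
principal ideal. -/
lemma span_gaussF_mul_gaussF {r : ℕ} (δ : Fin r → Derivation ℤ K K) {R : Subring K} [IsLocalRing R]
    (hf : f ∈ J) (hf0 : f ≠ 0)
    (h : LocallyGenerates ((algebraMap A K).range ∪ (fun m => m / f) '' J) R)
    (hjac : HasPrincipalJacobian δ R R) :
    Submodule.span R (gaussF δ (J * gaussF δ J) : Set K) =
      Submodule.span R ((gaussF δ J ^ (r + 2) : Submodule A K) : Set K) := by
  have hAR := range_le_of_locallyGenerates h
  have hJ := (div_mem_iff_span_eq (S := (J : Set K)) hf hf0).2 fun m hm =>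
    h.1 (Or.inr ⟨m, hm, rfl⟩)
  obtain ⟨y, hy, hspan⟩ := (hasPrincipalJacobian_iff_gaussF δ le_rfl hf hf0 h).1 hjac
  obtain ⟨g, hg, hg0, hspan⟩ := exists_generator_mem Subtype.val_injective hy hspan
  have hfg : f * g ∈ J * gaussF δ J := Submodule.mul_mem_mul hf hg
  have hfg0 : f * g ≠ 0 := mul_ne_zero hf0 hg0
  have hN : Submodule.span R ((J * gaussF δ J : Submodule A K) : Set K) =
      Submodule.span R {f * g} := by
    rw [span_mul_of_range_le hAR, hJ, hspan, Submodule.span_mul_span,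
      Set.singleton_mul_singleton]
  have h' : LocallyGenerates ((algebraMap A K).range ∪
      (fun m => m / (f * g)) '' (J * gaussF δ J : Submodule A K)) R := by
    refine h.mono ?_ ?_
    · refine Set.union_subset_union_right _ ?_
      rintro _ ⟨m, hm, rfl⟩
      exact ⟨m * g, Submodule.mul_mem_mul hm hg, mul_div_mul_right _ _ hg0⟩
    · rintro _ (hx | ⟨m, hm, rfl⟩)
      · exact h.1 (Or.inl hx)
      · exact (div_mem_iff_span_eq (S := ((J * gaussF δ J : Submodule A K) : Set K))
          hfg hfg0).1 hN m hm
  have h1 : (gaussF δ (1 : Submodule R K)).map (LinearMap.mulLeft R (f ^ (r + 1))) =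
      Submodule.span R {g} := (span_gaussF_eq δ hf hf0 h).symm.trans hspan
  rw [span_gaussF_eq δ hfg hfg0 h', span_pow_of_range_le hAR, hspan, mul_pow, mul_comm (f ^ _),
    LinearMap.mulLeft_mul, Submodule.map_comp, h1, map_mulLeft_span_singleton, Submodule.span_pow,
    Set.singleton_pow, ← pow_succ]

end ChartPowers

section Solution

variable {V : Scheme.{u}} [IsIntegral V] {r : ℕ}
  (δ : Fin r → Derivation ℤ V.functionField V.functionField)

namespace FracIdeal

/-- If the jacobians generate principal ideals in the local rings of the blowup of `M`, then both
sides of the equation for `M ^ n` agree over the charts of the blowup, so that they agree up to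
powers of `M`. -/
lemma exists_pow_mul_mem [V.IsSeparated] {M : FracIdeal V} (X : M.Model)
    (hX : ∀ w, HasPrincipalJacobian δ (locRing X.π w) (locRing X.π w)) (U : V.affineOpens)
    [Nonempty U.1] {n : ℕ} (hn : n ≠ 0) {f : V.functionField} (hf : f ∈ M.sec U)
    {x : V.functionField} (hx : x ∈ gaussF δ (M.sec U ^ n * gaussF δ (M.sec U ^ n))) :
    ∃ m, f ^ m * x ∈ M.sec U ^ m * gaussF δ (M.sec U ^ n) ^ (r + 2) := by
  by_cases hf0 : f = 0
  · exact ⟨1, by rw [hf0, zero_pow one_ne_zero, zero_mul]; exact Submodule.zero_mem _⟩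
  refine exists_pow_mul_mem_of_mem_span hf hf0 ?_
  have hB : (algebraMap Γ(V, U.1) V.functionField).range ≤
      (algebraMap (chartRing (M.sec U) f) V.functionField).range := by
    rw [algebraMap_range_subring]; exact range_le_chartRing _ _
  have hle : Submodule.span (chartRing (M.sec U) f)
      (gaussF δ (M.sec U ^ n * gaussF δ (M.sec U ^ n)) : Set V.functionField) ≤
        Submodule.span (chartRing (M.sec U) f)
          ((gaussF δ (M.sec U ^ n) ^ (r + 2) : Submodule Γ(V, U.1) V.functionField) :
            Set V.functionField) := by
    refine le_of_forall_span_le fun p => ?_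
    refine ⟨locRing X.π (X.ι _ (chartRing_mem_charts hf hf0) p), fun y hy => ?_, ?_⟩
    · obtain ⟨a, t, ht, h⟩ := mem_locRing_ι.1 hy
      exact ⟨t, ht, a, by rw [mul_comm]; exact h⟩
    · have hgen := locallyGenerates_locRing_chart (X := X) hf hf0 p
      have hBR : (algebraMap (chartRing (M.sec U) f) V.functionField).range ≤
          (algebraMap (locRing X.π (X.ι _ (chartRing_mem_charts hf hf0) p))
            V.functionField).range := by
        rw [algebraMap_range_subring, algebraMap_range_subring]; exact le_locRing_ι p
      rw [span_span_of_range_le hBR, span_span_of_range_le hBR]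
      exact (span_gaussF_mul_gaussF δ (Submodule.pow_mem_pow _ hf n) (pow_ne_zero _ hf0)
        (hgen.pow hf hf0 hn) (hX _)).le
  exact hle (Submodule.subset_span hx)

end FracIdeal

end Solution

section Existence

variable {V : Scheme.{u}} [IsIntegral V] {I : V.IdealSheafData} {r : ℕ}
  {δ : Fin r → Derivation ℤ V.functionField V.functionField}

lemma pow_ne_bot (hI : I ≠ ⊥) (n : ℕ) : I ^ n ≠ ⊥ := by
  intro h
  obtain ⟨U, _, -⟩ := exists_affineOpens_mem (genericPoint V)
  refine pow_ne_zero n (ideal_ne_bot hI U) ?_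
  have := congrArg (fun J : V.IdealSheafData => J.ideal U) h
  exact this

lemma sections_pow (U : V.affineOpens) [Nonempty U.1] (n : ℕ) :
    sections (I ^ n) U = sections I U ^ n :=
  map_linearMap_pow (I.ideal U) n

variable [IsLocallyNoetherian V]

/-- The equation is local. -/
lemma FracIdeal.gaussEquation_of_cover (M : FracIdeal V) (hδ : LinearIndependent V.functionField δ)
    (hE : ∀ (U : V.affineOpens) [Nonempty U.1], ∃ E : Submodule Γ(V, U.1) V.functionField, E.FG ∧
      ∀ i a, δ i (algebraMap Γ(V, U.1) V.functionField a) ∈ E)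
    (h : ∀ x : V, ∃ (U : V.affineOpens) (_ : Nonempty U.1), x ∈ U.1 ∧
      gaussF δ (M.sec U * gaussF δ (M.sec U)) = gaussF δ (M.sec U) ^ (r + 2))
    (U : V.affineOpens) [Nonempty U.1] :
    gaussF δ (M.sec U * gaussF δ (M.sec U)) = gaussF δ (M.sec U) ^ (r + 2) := by
  let F := M.gauss δ hδ hE
  let N := (M.mul F).gauss δ hδ hE
  refine eq_of_forall_span_stalkRing_eq fun x hx => ?_
  obtain ⟨U', _, hx', heq⟩ := h x
  have h1 := range_le_range_stalkRing hx
  have h2 := range_le_range_stalkRing hx'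
  refine (N.span_sec_eq hx hx' le_rfl).trans ?_
  change Submodule.span (stalkRing x) (gaussF δ (M.sec U' * gaussF δ (M.sec U')) :
    Set V.functionField) = _
  rw [heq, span_pow_of_range_le h2, span_pow_of_range_le h1]
  exact congrArg (· ^ (r + 2)) (F.span_sec_eq hx' hx le_rfl)

variable [V.IsSeparated]

/-- Over an affine open set, the large powers of an ideal sheaf whose blowup is nonsingular satisfy
the equation. -/
lemma exists_forall_ge_gaussEquation_sections (hI : I ≠ ⊥) (X : (FracIdeal.ofIdeal I hI).Model)
    (hX : ∀ w, HasPrincipalJacobian δ (locRing X.π w) (locRing X.π w)) (U : V.affineOpens)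
    [Nonempty U.1] (hU : ∀ n : ℕ, n ≠ 0 → IsUnit (n : Γ(V, U.1)))
    (hE : ∃ E : Submodule Γ(V, U.1) V.functionField, E.FG ∧
      ∀ i a, δ i (algebraMap Γ(V, U.1) V.functionField a) ∈ E) :
    ∃ n₀, ∀ n ≥ n₀, gaussF δ (sections I U ^ n * gaussF δ (sections I U ^ n)) =
      gaussF δ (sections I U ^ n) ^ (r + 2) := by
  have := IsLocallyNoetherian.component_noetherian U
  have hsm : ∀ (n : ℕ) (N : Submodule Γ(V, U.1) V.functionField),
      I.ideal U ^ n • N = sections I U ^ n * N := fun n N => by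
    rw [ideal_smul_eq_map_mul, map_linearMap_pow]
    rfl
  have h := exists_forall_ge_gaussEquation δ hU hE (I.ideal U) fun n hn f hf x hx => by
    simp only [hsm, mul_one] at hx ⊢
    have hfI : algebraMap Γ(V, U.1) V.functionField f ∈ sections I U := ⟨f, hf, rfl⟩
    obtain ⟨m, hm⟩ := FracIdeal.exists_pow_mul_mem δ X hX U hn hfI hx
    refine ⟨m, ?_⟩
    rw [Algebra.smul_def, map_pow]
    exact hm
  simpa only [hsm, mul_one] using h

theorem exists_gaussEquation [CompactSpace V] (hδ : LinearIndependent V.functionField δ)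
    (hE : ∀ (U : V.affineOpens) [Nonempty U.1], ∃ E : Submodule Γ(V, U.1) V.functionField, E.FG ∧
      ∀ i a, δ i (algebraMap Γ(V, U.1) V.functionField a) ∈ E)
    (hU : ∀ (U : V.affineOpens) (n : ℕ), n ≠ 0 → IsUnit (n : Γ(V, U.1)))
    (hI : I ≠ ⊥) (X : (FracIdeal.ofIdeal I hI).Model)
    (hX : ∀ w, HasPrincipalJacobian δ (locRing X.π w) (locRing X.π w)) :
    ∃ n : ℕ, ∀ (U : V.affineOpens) [Nonempty U.1],
      gaussF δ (sections (I ^ n) U * gaussF δ (sections (I ^ n) U)) =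
        gaussF δ (sections (I ^ n) U) ^ (r + 2) := by
  choose U hUne hxU using fun x : V => exists_affineOpens_mem x
  choose n₀ hn₀ using fun x => exists_forall_ge_gaussEquation_sections hI X hX (U x) (hU (U x))
    (hE (U x))
  obtain ⟨t, -, ht⟩ := isCompact_univ.elim_nhds_subcover (fun x => ((U x).1 : Set V))
    fun x _ => (U x).1.isOpen.mem_nhds (hxU x)
  refine ⟨t.sup n₀, fun O _ => ?_⟩
  refine (FracIdeal.ofIdeal (I ^ t.sup n₀) (pow_ne_bot hI _)).gaussEquation_of_cover hδ hE
    (fun x => ?_) O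
  obtain ⟨y, hy, hxy⟩ := Set.mem_iUnion₂.1 (ht (Set.mem_univ x))
  refine ⟨U y, hUne y, hxy, ?_⟩
  change gaussF δ (sections (I ^ t.sup n₀) (U y) * gaussF δ (sections (I ^ t.sup n₀) (U y))) =
    gaussF δ (sections (I ^ t.sup n₀) (U y)) ^ (r + 2)
  rw [sections_pow]
  exact hn₀ y _ (Finset.le_sup hy)

end Existence

end FoliatedVariety

end

theorem corollary4 {k : Type u} [Field k] [CharZero k] {V : Scheme.{u}} [IsIntegral V]
    (s : V ⟶ Spec (.of k)) [LocallyOfFiniteType s] [QuasiCompact s] [IsSeparated s]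
    (L : FoliatedVariety.Foliation s) {r : ℕ}
    (b : Module.Basis (Fin r) V.functionField L.carrier) :
    -- if a blowup of an ideal sheaf resolves the foliation, then the equation has a solution
    (L.ResolvableByBlowup →
      ∃ I : V.IdealSheafData, I ≠ ⊥ ∧ FoliatedVariety.SatisfiesGaussEquation b I) ∧
    -- and conversely
    (FoliatedVariety.HasEnoughDivisors V →
      (∃ I : V.IdealSheafData, I ≠ ⊥ ∧ FoliatedVariety.SatisfiesGaussEquation b I) →
      L.ResolvableByBlowup) ∧
    -- for every solution `I`, blowing up `I` and one Gauss blowup resolve the foliation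
    (∀ I : V.IdealSheafData, I ≠ ⊥ → FoliatedVariety.SatisfiesGaussEquation b I →
      (∃ (V₀ : Scheme.{u}) (_ : IsIntegral V₀) (p : V₀ ⟶ V) (_ : IsDominant p)
        (V₁ : Scheme.{u}) (_ : IsIntegral V₁) (q : V₁ ⟶ V₀) (_ : IsDominant q),
        FoliatedVariety.IsBlowup I p ∧ (L.lift p).IsGaussBlowup q) ∧
      ∀ (V₀ : Scheme.{u}) [IsIntegral V₀] (p : V₀ ⟶ V) [IsDominant p]
        (V₁ : Scheme.{u}) [IsIntegral V₁] (q : V₁ ⟶ V₀) [IsDominant q],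
        FoliatedVariety.IsBlowup I p → (L.lift p).IsGaussBlowup q →
          ((L.lift p).lift q).IsNonsingular ∧ FoliatedVariety.IsLocallyBlowup (q ≫ p)) := by
  open FoliatedVariety in
  have := isLocallyNoetherian_of_field s
  have := isSeparated_of_field s
  have := compactSpace_of_field s
  have F := Frame.ofBasis b
  have hE : ∀ (U : V.affineOpens) [Nonempty U.1], ∃ E : Submodule Γ(V, U.1) V.functionField,
      E.FG ∧ ∀ i a, (b i).1 (algebraMap Γ(V, U.1) V.functionField a) ∈ E :=
    fun U _ => L.exists_fg_derivation_mem s b U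
  refine ⟨?_, ?_, fun I hI heq => ⟨?_, ?_⟩⟩
  · rintro ⟨I, hI, W, _, π, _, hπ, hns⟩
    obtain ⟨X, h, hiso, rfl⟩ := FracIdeal.isModel_of_isBlowup (hI := hI) hπ
    have hbij := (FracIdeal.isModel_of_isBlowup (hI := hI) hπ).bijective
    have hjac := (F.lift_isNonsingular_iff hbij).1 hns
    obtain ⟨n, hn⟩ := exists_gaussEquation F.linearIndependent hE
      (fun U n hn => isUnit_natCast_section s U.1 hn) hI X fun w => by
        obtain ⟨w, rfl⟩ := h.surjective w
        rw [← FracIdeal.exists_eq_locRing]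
        exact hjac w
    exact ⟨I ^ n, pow_ne_bot hI n, hn⟩
  · rintro hV ⟨I, hI, heq⟩
    exact FracIdeal.resolvableByBlowup (M := .ofIdeal I hI) F hE heq hV
  · obtain ⟨X₀⟩ := (FracIdeal.ofIdeal I hI).nonempty_model
    obtain ⟨X⟩ := ((FracIdeal.ofIdeal I hI).mul
      ((FracIdeal.ofIdeal I hI).gauss _ F.linearIndependent hE)).nonempty_model
    obtain ⟨q, hqd, -, hq⟩ := (FracIdeal.isModel_π X₀).exists_isGaussBlowup F
      (FracIdeal.isModel_π X)
    exact ⟨X₀.W, inferInstance, X₀.π, inferInstance, X.W, inferInstance, q, hqd,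
      FracIdeal.isBlowup_ofIdeal X₀, hq⟩
  · intro V₀ _ p _ V₁ _ q _ hp hq
    have Hp := FracIdeal.isModel_of_isBlowup (hI := hI) hp
    have Hq := Hp.isModel_of_isGaussBlowup (hδ := F.linearIndependent) (hE := hE) F hq
    have hjac := FracIdeal.IsModel.hasPrincipalJacobian (M := .ofIdeal I hI) heq Hq
    exact ⟨(F.lift_lift_isNonsingular_iff Hp.bijective hq.extendsGaussMap.birational).2 hjac,
      Hq.isLocallyBlowup⟩
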